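/- All simplicial polytopes are considered up to combinatorial equivalence (isomorphism of boundary complexes). Let $\mathbf k$ be an arbitrary field. For a simplicial polytope $P$ with vertex set $V(P)$ and boundary complex $\Delta(P)$, the graded Betti numbers of $P$ are $$\beta_{i,j}(P)=\sum_{W\subset V(P),\ |W|=j}\dim_{\mathbf k}\widetilde H_{j-i-1}(P|_W;\mathbf k)\qquad(i,j\ge 0),$$ where $P|_W$ is the simplicial complex $\{F\cap W: F\in\Delta(P)\}$. The polytope $P$ is *combinatorially rigid* if every simplicial polytope $P'$ (of any dimension) with $\beta_{i,j}(P')=\beta_{i,j}(P)$ for all $i,j\ge 0$ is combinatorially equivalent to $P$. A *connected sum* of two simplicial $3$-polytopes $P_1,P_2$ is a simplicial $3$-polytope whose boundary complex is obtained from $\Delta(P_1)$ and $\Delta(P_2)$ by choosing a facet $F_1$ of $P_1$ and a facet $F_2$ of $P_2$, identifying the vertices of $F_1$ with those of $F_2$ by some bijection, and removing the face $F_1=F_2$. A simplicial $3$-polytope is *irreducible* if it is not a connected sum of two simplicial $3$-polytopes. $T_4$ denotes the tetrahedron; $T_4\# T_4\# T_4$ is unique up to combinatorial equivalence. **Proposition.**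 Let $P_1,\dots,P_\ell$ be irreducible simplicial $3$-polytopes, $\ell\ge 3$, and let $P$ be an (iterated) connected sum of $P_1,\dots,P_\ell$, in any order, with any bracketing, and with any choices of facets and of identifications of their vertices. If $P\ne T_4\# T_4\# T_4$, then $P$ is not combinatorially rigid. -/

import Mathlib

/-- `S` is the vertex set of a face of the polytope `conv {v i}`: some linear inequality `l x ≤ c`
is valid on the polytope, and `S` is the set of vertices at which it is an equality.
(The choices `l = 0, c = 1` and `l = 0, c = 0` give the empty face and the whole polytope.) -/
def IsPolytopeFace {d n : ℕ} (v : Fin n → (Fin d → ℝ)) (S : Finset (Fin n)) : Prop :=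
  ∃ (l : (Fin d → ℝ) →ₗ[ℝ] ℝ) (c : ℝ), (∀ i, l (v i) ≤ c) ∧ ∀ i, i ∈ S ↔ l (v i) = c

/-- A `d`-dimensional simplicial polytope in `ℝ^d`, i.e. the convex hull of the `n` points
`vertex i`, which are its vertices (no one is in the convex hull of the others), enumerated in some
order. It is full-dimensional, and each of its proper faces is a simplex. -/
structure SimplicialPolytope (d : ℕ) where
  n : ℕ
  vertex : Fin n → (Fin d → ℝ)
  convexIndependent : ConvexIndependent ℝ vertex
  affineSpan_eq_top : affineSpan ℝ (Set.range vertex) = ⊤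
  simplicial : ∀ S : Finset (Fin n), IsPolytopeFace vertex S → S ≠ Finset.univ →
    AffineIndependent ℝ (fun i : S => vertex i)

/-! ### Reduced simplicial homology of a finite complex, through oriented chains

A complex is given by its set `Δ` of faces, the empty face included. -/

section Homology

/-- The set `{F ∩ W : F ∈ Δ}`. -/
def restrictComplex {V : Type*} [DecidableEq V] (Δ : Set (Finset V)) (W : Finset V) :
    Set (Finset V) :=
  {G | ∃ F ∈ Δ, F ∩ W = G}

/-- The `k`-dimensional faces, `k ≥ -1`; the empty face has dimension `-1`. -/
def facesOfDim {V : Type*} (Δ : Set (Finset V)) (k : ℤ) : Set (Finset V) :=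
  {F | F ∈ Δ ∧ (F.card : ℤ) = k + 1}

/-- `K`-linear combinations of the `k`-dimensional faces, written as functions of the face. -/
abbrev SimplicialChain (K : Type*) [Field K] {V : Type*} (Δ : Set (Finset V)) (k : ℤ) : Type _ :=
  facesOfDim Δ k → K

open Classical in
/-- The simplicial boundary map `C_k → C_l`, which is of interest for `l = k - 1` (for all other
`l` it is zero): a face `{v_0 < ⋯ < v_k}` is sent to the sum over `p` of `(-1)^p` times the face
without `v_p`. So the coefficient of `∂ c` at a face `G` is the sum of the coefficients of `c` at
the faces `G ∪ {v}` with `v ∉ G`, with sign `(-1)^p` if `p` elements of `G` come before `v`. -/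
noncomputable def simplicialBoundary (K : Type*) [Field K] {V : Type*} [Fintype V] [LinearOrder V]
    (Δ : Set (Finset V)) (k l : ℤ) : SimplicialChain K Δ k →ₗ[K] SimplicialChain K Δ l :=
  LinearMap.pi fun G : facesOfDim Δ l =>
    ∑ v ∈ Finset.univ \ G.1, if h : insert v G.1 ∈ facesOfDim Δ k then
      ((-1 : K) ^ (G.1.filter (· < v)).card) • LinearMap.proj ⟨insert v G.1, h⟩ else 0

/-- The `k`-cycles. -/
noncomputable def simplicialCycles (K : Type*) [Field K] {V : Type*} [Fintype V] [LinearOrder V]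
    (Δ : Set (Finset V)) (k : ℤ) : Submodule K (SimplicialChain K Δ k) :=
  LinearMap.ker (simplicialBoundary K Δ k (k - 1))

/-- The `k`-boundaries. -/
noncomputable def simplicialBoundaries (K : Type*) [Field K] {V : Type*} [Fintype V] [LinearOrder V]
    (Δ : Set (Finset V)) (k : ℤ) : Submodule K (SimplicialChain K Δ k) :=
  LinearMap.range (simplicialBoundary K Δ (k + 1) k)

/-- The reduced simplicial homology of `Δ` in degree `k`: cycles modulo boundaries. -/
abbrev ReducedHomology (K : Type*) [Field K] {V : Type*} [Fintype V] [LinearOrder V]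
    (Δ : Set (Finset V)) (k : ℤ) : Type _ :=
  simplicialCycles K Δ k ⧸ (simplicialBoundaries K Δ k).submoduleOf (simplicialCycles K Δ k)

end Homology

namespace SimplicialPolytope

/-- The boundary complex: vertex sets of the proper faces, the empty one included. -/
def boundaryComplex {d : ℕ} (P : SimplicialPolytope d) : Set (Finset (Fin P.n)) :=
  {S | IsPolytopeFace P.vertex S ∧ S ≠ Finset.univ}

/-- The vertex sets of the facets, i.e. of the faces of dimension `d - 1`. -/
def facets {d : ℕ} (P : SimplicialPolytope d) : Set (Finset (Fin P.n)) :=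
  {S | S ∈ P.boundaryComplex ∧ S.card = d}

/-- Combinatorial equivalence: the boundary complexes are isomorphic. -/
def Iso {d e : ℕ} (P : SimplicialPolytope d) (Q : SimplicialPolytope e) : Prop :=
  ∃ f : Fin P.n ≃ Fin Q.n, ∀ S : Finset (Fin P.n),
    S ∈ P.boundaryComplex ↔ S.map f.toEmbedding ∈ Q.boundaryComplex

/-- The graded Betti number `β_{i,j}(P)` over `K`, by Hochster's formula. -/
noncomputable def gradedBetti (K : Type*) [Field K] {d : ℕ} (P : SimplicialPolytope d)
    (i j : ℕ) : ℕ :=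
  ∑ W ∈ (Finset.univ : Finset (Fin P.n)).powersetCard j,
    Module.finrank K (ReducedHomology K (restrictComplex P.boundaryComplex W) ((j : ℤ) - i - 1))

/-- `P` is combinatorially rigid: every simplicial polytope, of any dimension, with the same graded
Betti numbers is combinatorially equivalent to `P`. -/
def IsRigid (K : Type*) [Field K] {d : ℕ} (P : SimplicialPolytope d) : Prop :=
  ∀ (e : ℕ) (Q : SimplicialPolytope e),
    (∀ i j : ℕ, gradedBetti K P i j = gradedBetti K Q i j) → P.Iso Q

/-- `P` is, up to combinatorial equivalence, a connected sum of `P₁` and `P₂` (for `d ≥ 2`): it is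
obtained from them by attaching a facet `F₁` of `P₁` to a facet `F₂` of `P₂` along some
identification of their vertices. The maps `f₁`, `f₂` place the vertices of `P₁`, `P₂` in `P`; the
attached facets become one set of vertices, which is not a face any more, all others survive. -/
def IsConnectedSum {d : ℕ} (P₁ P₂ P : SimplicialPolytope d) : Prop :=
  ∃ (f₁ : Fin P₁.n ↪ Fin P.n) (f₂ : Fin P₂.n ↪ Fin P.n),
    ∃ F₁ ∈ P₁.facets, ∃ F₂ ∈ P₂.facets,
      F₁.map f₁ = F₂.map f₂ ∧
      Finset.univ.map f₁ ∩ Finset.univ.map f₂ = F₁.map f₁ ∧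
      Finset.univ.map f₁ ∪ Finset.univ.map f₂ = Finset.univ ∧
      ∀ S : Finset (Fin P.n), S ∈ P.boundaryComplex ↔
        (∃ T ∈ P₁.boundaryComplex, T ≠ F₁ ∧ T.map f₁ = S) ∨
        (∃ T ∈ P₂.boundaryComplex, T ≠ F₂ ∧ T.map f₂ = S)

/-- `P` is not a connected sum of two simplicial polytopes. -/
def IsIrreducible {d : ℕ} (P : SimplicialPolytope d) : Prop :=
  ¬ ∃ P₁ P₂ : SimplicialPolytope d, IsConnectedSum P₁ P₂ P

/-- `P` is, up to combinatorial equivalence, an iterated connected sum `P₁ # ⋯ # P_ℓ` of the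
members of the multiset `{P₁, …, P_ℓ}`, in some order, with some bracketing, and with some choices
of facets and of identifications of their vertices. -/
inductive IsIteratedConnectedSum {d : ℕ} :
    Multiset (SimplicialPolytope d) → SimplicialPolytope d → Prop
  | single {Q P : SimplicialPolytope d} (h : Q.Iso P) : IsIteratedConnectedSum {Q} P
  | sum {s t : Multiset (SimplicialPolytope d)} {A B P : SimplicialPolytope d}
      (hA : IsIteratedConnectedSum s A) (hB : IsIteratedConnectedSum t B)
      (hP : IsConnectedSum A B P) : IsIteratedConnectedSum (s + t) P

end SimplicialPolytope

/-- The vertices of a regular tetrahedron. -/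
def tetrahedronVertex : Fin 4 → (Fin 3 → ℝ) :=
  ![![1, 1, 1], ![1, -1, -1], ![-1, 1, -1], ![-1, -1, 1]]

theorem affineIndependent_tetrahedronVertex : AffineIndependent ℝ tetrahedronVertex := by
  rw [affineIndependent_iff_of_fintype]
  intro w hw h
  rw [Finset.weightedVSub_eq_linear_combination Finset.univ hw] at h
  have h0 := congrFun h 0
  have h1 := congrFun h 1
  have h2 := congrFun h 2
  simp [Fin.sum_univ_four, tetrahedronVertex] at hw h0 h1 h2
  intro i
  fin_cases i <;> simp <;> linarith

theorem convexIndependent_tetrahedronVertex : ConvexIndependent ℝ tetrahedronVertex :=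
  fun s x hx => (affineIndependent_tetrahedronVertex.mem_affineSpan_iff x s).1
    (convexHull_subset_affineSpan _ hx)

/-- The tetrahedron `T₄`. -/
def tetrahedron : SimplicialPolytope 3 where
  n := 4
  vertex := tetrahedronVertex
  convexIndependent := convexIndependent_tetrahedronVertex
  affineSpan_eq_top := by
    rw [affineIndependent_tetrahedronVertex.affineSpan_eq_top_iff_card_eq_finrank_add_one]
    simp
  simplicial := fun S _ _ =>
    affineIndependent_tetrahedronVertex.comp_embedding (Function.Embedding.subtype (· ∈ S))
/-!
Except in the top degree, where cycles are easy to count, an induced subcomplex of a connected sum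
is the union of induced subcomplexes of the summands that meet in a full simplex. By Mayer–Vietoris
the ranks of the boundary maps are then additive up to a correction, so the graded Betti numbers of
an iterated connected sum depend on the summands only. If `P` were rigid, all iterated connected
sums of the same summands would be isomorphic to each other, and would have the same sum of squared
vertex degrees.

Gluing two facets with vertex degrees `p k` and `q k` changes this sum by `2 ∑ p k * q k` plus a
term that does not see the bijection; since it suffices to transpose two vertices, one of the
polytopes must be degree-regular. A connected sum can be made irregular by gluing at a vertex of
maximal degree: hence there are at most three summands, and each of them is degree-regular. For
three summands `A`, `B`, `C`, gluing `C` to different facets of `A # B` shows that the facets of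
`A # B` have the same degree sum. So all the other facets of `A` meet the removed one in equally
many vertices, hence in all but one, and `A` is a simplex.
-/

section Cone

variable {E : Type*} [AddCommGroup E] [Module ℝ E] {ι : Type*}

/-- `S` consists of the generators on a face of the cone spanned by the `u i`: some linear
functional is nonnegative on the cone and vanishes at exactly the `u i` with `i ∈ S`. -/
def IsConeFace (u : ι → E) (S : Finset ι) : Prop :=
  ∃ φ : E →ₗ[ℝ] ℝ, (∀ i, 0 ≤ φ (u i)) ∧ ∀ i, i ∈ S ↔ φ (u i) = 0

/-- `H` consists of the generators of a facet. Facets are recognised by their number of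
generators, which is the right notion in a simplicial cone. -/
def IsConeFacet (u : ι → E) (H : Finset ι) : Prop :=
  IsConeFace u H ∧ H.card + 1 = Module.finrank ℝ E

/-- The `u i` generate the extreme rays of a full-dimensional cone whose proper faces are
simplicial. The cone over a simplicial polytope placed at height one is of this kind. -/
structure IsSimplicialCone (u : ι → E) : Prop where
  span_eq_top : Submodule.span ℝ (Set.range u) = ⊤
  isConeFace_singleton : ∀ i, IsConeFace u {i}
  linearIndependent : ∀ S : Finset ι, IsConeFace u S → (∃ i, i ∉ S) →
    LinearIndependent ℝ (fun i : S => u i)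

theorem exists_linearMap_eqOn_of_linearIndependent {u : ι → E} {S : Finset ι}
    (h : LinearIndependent ℝ (fun i : S => u i)) (g : ι → ℝ) :
    ∃ ψ : E →ₗ[ℝ] ℝ, ∀ i ∈ S, ψ (u i) = g i := by
  obtain ⟨ψ, hψ⟩ := LinearMap.exists_extend ((Module.Basis.span h).constr ℝ fun i : S => g i)
  refine ⟨ψ, fun i hi => ?_⟩
  have hi' := LinearMap.congr_fun hψ (Module.Basis.span h ⟨i, hi⟩)
  rw [Module.Basis.constr_basis] at hi'
  simpa [Module.Basis.span_apply] using hi'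

theorem IsConeFace.mono [Finite ι] {u : ι → E} {S T : Finset ι} (hS : IsConeFace u S)
    (hli : LinearIndependent ℝ (fun i : S => u i)) (hTS : T ⊆ S) : IsConeFace u T := by
  classical
  obtain ⟨φ, hφ, hφS⟩ := hS
  obtain ⟨ψ, hψ⟩ := exists_linearMap_eqOn_of_linearIndependent hli fun i => if i ∈ T then 0 else 1
  -- Off `S` a large multiple of `φ` dominates `ψ`, and on `S` only `ψ` is left.
  have hlarge : ∀ᶠ N : ℝ in Filter.atTop, ∀ i, i ∉ S → 0 < N * φ (u i) + ψ (u i) := by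
    refine Filter.eventually_all.2 fun i => Filter.eventually_imp_distrib_left.2 fun hi => ?_
    have hpos : 0 < φ (u i) := (hφ i).lt_of_ne' fun h => hi ((hφS i).2 h)
    filter_upwards [Filter.eventually_gt_atTop (-ψ (u i) / φ (u i))] with N hN
    rw [div_lt_iff₀ hpos] at hN
    linarith
  obtain ⟨N, hN⟩ := hlarge.exists
  have hon : ∀ i ∈ S, (N • φ + ψ) (u i) = if i ∈ T then 0 else 1 := fun i hi => by
    simp [(hφS i).1 hi, hψ i hi]
  refine ⟨N • φ + ψ, fun i => ?_, fun i => ?_⟩ <;> by_cases hi : i ∈ S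
  · rw [hon i hi]
    split_ifs <;> norm_num
  · exact (hN i hi).le
  · rw [hon i hi]
    split_ifs with h <;> simp [h]
  · exact iff_of_false (fun h => hi (hTS h)) (hN i hi).ne'

/-- Increasing the weight of `g` until the first of the nonnegative numbers `f i + t * g i`
vanishes. -/
theorem exists_pos_forall_add_mul_nonneg [Finite ι] {f g : ι → ℝ} (hf : ∀ i, 0 ≤ f i)
    (hg : ∀ i, f i = 0 → 0 ≤ g i) (hneg : ∃ i, g i < 0) :
    ∃ t : ℝ, 0 < t ∧ (∀ i, 0 ≤ f i + t * g i) ∧ ∃ i, g i < 0 ∧ f i + t * g i = 0 := by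
  obtain ⟨j, hj, hmin⟩ := Set.exists_min_image {i | g i < 0} (fun i => f i / -g i)
    (Set.toFinite _) hneg
  have hj : 0 < -g j := neg_pos.2 hj
  have hfj : 0 < f j := (hf j).lt_of_ne' fun h => by linarith [hg j h]
  refine ⟨f j / -g j, div_pos hfj hj, fun i => ?_, j, by linarith, ?_⟩
  · rcases le_or_gt 0 (g i) with hi | hi
    · have := mul_nonneg (div_pos hfj hj).le hi
      linarith [hf i]
    · have := (le_div_iff₀ (neg_pos.2 hi)).1 (hmin i hi)
      linarith
  · rw [div_mul_eq_mul_div, div_neg, mul_div_cancel_right₀ _ (by linarith), add_neg_cancel]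

/-- The generators `u i`, `i ∈ S`, together with the sum of all generators, a vector in the
interior of the cone. -/
def coneFrame [Fintype ι] (u : ι → E) (S : Finset ι) : Option S → E :=
  fun o => o.elim (∑ i, u i) fun i => u i

namespace IsSimplicialCone

variable {u : ι → E}

theorem finiteDimensional [Finite ι] (hu : IsSimplicialCone u) : FiniteDimensional ℝ E :=
  ⟨hu.span_eq_top ▸ Submodule.fg_span (Set.finite_range u)⟩

theorem finrank_le_card [Fintype ι] (hu : IsSimplicialCone u) :
    Module.finrank ℝ E ≤ Fintype.card ι := by
  have hle := finrank_range_le_card (R := ℝ) u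
  rwa [Set.finrank, hu.span_eq_top, finrank_top] at hle

theorem exists_notMem_of_card_lt [Finite ι] (hu : IsSimplicialCone u) {S : Finset ι}
    (h : S.card < Module.finrank ℝ E) : ∃ i, i ∉ S := by
  cases nonempty_fintype ι
  obtain ⟨i, -, hi⟩ := Finset.exists_mem_notMem_of_card_lt_card
    (h.trans_le hu.finrank_le_card : S.card < Finset.univ.card)
  exact ⟨i, hi⟩

theorem exists_notMem [Finite ι] (hu : IsSimplicialCone u) {H : Finset ι} (hH : IsConeFacet u H) :
    ∃ i, i ∉ H :=
  hu.exists_notMem_of_card_lt (by have := hH.2; omega)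

theorem mono [Finite ι] (hu : IsSimplicialCone u) {S T : Finset ι} (hS : IsConeFace u S)
    (hne : ∃ i, i ∉ S) (hTS : T ⊆ S) : IsConeFace u T :=
  hS.mono (hu.linearIndependent S hS hne) hTS

theorem linearIndependent_coneFrame [Fintype ι] (hu : IsSimplicialCone u) {S : Finset ι}
    (hS : IsConeFace u S) (hne : ∃ i, i ∉ S) : LinearIndependent ℝ (coneFrame u S) := by
  refine linearIndependent_option.2 ⟨hu.linearIndependent S hS hne, fun hmem => ?_⟩
  obtain ⟨φ, hφ, hφS⟩ := hS
  have hker : Submodule.span ℝ (Set.range (coneFrame u S ∘ some)) ≤ LinearMap.ker φ :=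
    Submodule.span_le.2 (Set.range_subset_iff.2 fun i => (hφS i).1 i.2)
  have hzero : ∑ i, φ (u i) = 0 := by
    rw [← map_sum]
    exact hker hmem
  obtain ⟨i, hi⟩ := hne
  exact hi ((hφS i).2 ((Finset.sum_eq_zero_iff_of_nonneg fun i _ => hφ i).1 hzero i
    (Finset.mem_univ i)))

theorem card_add_one_le [Finite ι] (hu : IsSimplicialCone u) {S : Finset ι}
    (hS : IsConeFace u S) (hne : ∃ i, i ∉ S) : S.card + 1 ≤ Module.finrank ℝ E := by
  cases nonempty_fintype ι
  have := hu.finiteDimensional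
  simpa using (hu.linearIndependent_coneFrame hS hne).fintype_card_le_finrank

theorem exists_ssubset_isConeFace [Finite ι] (hu : IsSimplicialCone u) {S : Finset ι}
    (hS : IsConeFace u S) (hcard : S.card + 1 < Module.finrank ℝ E) :
    ∃ T, IsConeFace u T ∧ (∃ i, i ∉ T) ∧ S ⊂ T := by
  classical
  cases nonempty_fintype ι
  obtain ⟨φ, hφ, hφS⟩ := hS
  obtain ⟨i, hi⟩ := hu.exists_notMem_of_card_lt (by omega : S.card < Module.finrank ℝ E)
  have hlt : Submodule.span ℝ ((insert i S).image u : Set E) < ⊤ := by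
    refine lt_top_iff_ne_top.2 fun h => ?_
    have hle := finrank_span_finset_le_card (R := ℝ) ((insert i S).image u)
    rw [Set.finrank, h, finrank_top] at hle
    have := (Finset.card_image_le (s := insert i S) (f := u)).trans (Finset.card_insert_le i S)
    omega
  obtain ⟨ψ, hψ0, hψ⟩ := Submodule.exists_le_ker_of_lt_top _ hlt
  replace hψ : ∀ j ∈ insert i S, ψ (u j) = 0 := fun j hj =>
    hψ (Submodule.subset_span (by simpa using Finset.mem_image_of_mem u hj))
  obtain ⟨χ, hχ, hneg⟩ : ∃ χ : E →ₗ[ℝ] ℝ, (∀ j ∈ insert i S, χ (u j) = 0) ∧ ∃ j, χ (u j) < 0 := by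
    by_contra! h
    refine hψ0 (LinearMap.ext_on_range hu.span_eq_top fun j => le_antisymm ?_ (h ψ hψ j))
    simpa using h (-ψ) (fun j hj => by simp [hψ j hj]) j
  obtain ⟨t, -, hle, j, hj, hj0⟩ := exists_pos_forall_add_mul_nonneg hφ
    (fun j hj => (hχ j (Finset.mem_insert_of_mem ((hφS j).2 hj))).ge) hneg
  refine ⟨Finset.univ.filter fun k => φ (u k) + t * χ (u k) = 0,
    ⟨φ + t • χ, hle, fun k => by simp⟩, ⟨i, ?_⟩,
    (Finset.ssubset_iff_of_subset fun k hk => ?_).2 ⟨j, by simpa using hj0, fun h => ?_⟩⟩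
  · simpa [hχ i (Finset.mem_insert_self i S)] using mt (hφS i).2 hi
  · simp [(hφS k).1 hk, hχ k (Finset.mem_insert_of_mem hk)]
  · exact hj.ne (hχ j (Finset.mem_insert_of_mem h))

theorem exists_isConeFacet_superset [Finite ι] (hu : IsSimplicialCone u) {S : Finset ι}
    (hS : IsConeFace u S) (hne : ∃ i, i ∉ S) : ∃ H, IsConeFacet u H ∧ S ⊆ H := by
  induction hk : Module.finrank ℝ E - S.card using Nat.strong_induction_on generalizing S with
  | _ k ih =>
    rcases (hu.card_add_one_le hS hne).eq_or_lt with h | h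
    · exact ⟨S, ⟨hS, h⟩, subset_rfl⟩
    · obtain ⟨T, hT, hTne, hST⟩ := hu.exists_ssubset_isConeFace hS h
      obtain ⟨H, hH, hTH⟩ := ih _ (by have := Finset.card_lt_card hST; omega) hT hTne rfl
      exact ⟨H, hH, hST.1.trans hTH⟩

section Facet

variable [Fintype ι] (hu : IsSimplicialCone u) {H : Finset ι} (hH : IsConeFacet u H)

/-- The basis of the ambient space consisting of the generators of a facet and the sum of all
generators. The coordinate of the latter is the height over the facet. -/
noncomputable def facetBasis : Module.Basis (Option H) ℝ E :=
  basisOfLinearIndependentOfCardEqFinrank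
    (hu.linearIndependent_coneFrame hH.1 (hu.exists_notMem hH)) (by simpa using hH.2)

@[simp]
theorem facetBasis_some (i : H) : hu.facetBasis hH (some i) = u i := by
  simp [facetBasis, coneFrame]

@[simp]
theorem facetBasis_none : hu.facetBasis hH none = ∑ i, u i := by
  simp [facetBasis, coneFrame]

/-- The linear functional that vanishes on the facet `H` and is `1` at the sum of all generators. -/
noncomputable def height : E →ₗ[ℝ] ℝ :=
  (hu.facetBasis hH).coord none

/-- The linear functional that is `1` at the generator `u x` of the facet `H` and vanishes at the
other generators of `H` and at the sum of all generators. Adding a positive multiple of it to the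
height over `H` tilts the facet about its ridge opposite to `x`. -/
noncomputable def tilt (x : H) : E →ₗ[ℝ] ℝ :=
  (hu.facetBasis hH).coord (some x)

theorem height_sum : hu.height hH (∑ i, u i) = 1 := by
  rw [← hu.facetBasis_none hH, height, Module.Basis.coord_apply, Module.Basis.repr_self,
    Finsupp.single_eq_same]

theorem height_of_mem {i : ι} (hi : i ∈ H) : hu.height hH (u i) = 0 := by
  rw [← hu.facetBasis_some hH ⟨i, hi⟩, height, Module.Basis.coord_apply, Module.Basis.repr_self,
    Finsupp.single_eq_of_ne (Option.some_ne_none _).symm]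

theorem tilt_sum (x : H) : hu.tilt hH x (∑ i, u i) = 0 := by
  rw [← hu.facetBasis_none hH, tilt, Module.Basis.coord_apply, Module.Basis.repr_self,
    Finsupp.single_eq_of_ne (Option.some_ne_none _)]

theorem tilt_self (x : H) : hu.tilt hH x (u x) = 1 := by
  rw [← hu.facetBasis_some hH x, tilt, Module.Basis.coord_apply, Module.Basis.repr_self,
    Finsupp.single_eq_same]

theorem tilt_of_ne (x : H) {i : ι} (hi : i ∈ H) (hix : i ≠ x) : hu.tilt hH x (u i) = 0 := by
  rw [← hu.facetBasis_some hH ⟨i, hi⟩, tilt, Module.Basis.coord_apply, Module.Basis.repr_self,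
    Finsupp.single_eq_of_ne (by simpa [Subtype.ext_iff] using hix.symm)]

theorem eq_height_add_sum_tilt (ψ : E →ₗ[ℝ] ℝ) :
    ψ = ψ (∑ i, u i) • hu.height hH + ∑ x : H, ψ (u x) • hu.tilt hH x := by
  conv_lhs => rw [← (hu.facetBasis hH).sum_dual_apply_smul_coord ψ, Fintype.sum_option,
    facetBasis_none]
  simp only [facetBasis_some]
  rfl

theorem eq_smul_height {ψ : E →ₗ[ℝ] ℝ} (hψ : ∀ i ∈ H, ψ (u i) = 0) :
    ψ = ψ (∑ i, u i) • hu.height hH := by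
  conv_lhs => rw [hu.eq_height_add_sum_tilt hH ψ]
  simp [hψ]

theorem eq_smul_height_add_smul_tilt (x : H) {ψ : E →ₗ[ℝ] ℝ}
    (hψ : ∀ i ∈ H, i ≠ x → ψ (u i) = 0) :
    ψ = ψ (∑ i, u i) • hu.height hH + ψ (u x) • hu.tilt hH x := by
  conv_lhs => rw [hu.eq_height_add_sum_tilt hH ψ]
  congr 1
  refine Fintype.sum_eq_single x fun z hz => ?_
  rw [hψ z z.2 (Subtype.coe_ne_coe.2 hz), zero_smul]

theorem exists_pos_eq_smul_height {φ : E →ₗ[ℝ] ℝ} (hφ : ∀ i, 0 ≤ φ (u i))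
    (hφH : ∀ i, i ∈ H ↔ φ (u i) = 0) : ∃ c : ℝ, 0 < c ∧ φ = c • hu.height hH := by
  obtain ⟨i, hi⟩ := hu.exists_notMem hH
  refine ⟨φ (∑ i, u i), ?_, hu.eq_smul_height hH fun i hi => (hφH i).1 hi⟩
  rw [map_sum]
  exact Finset.sum_pos' (fun i _ => hφ i)
    ⟨i, Finset.mem_univ i, (hφ i).lt_of_ne' fun h => hi ((hφH i).2 h)⟩

theorem height_nonneg (i : ι) : 0 ≤ hu.height hH (u i) := by
  obtain ⟨φ, hφ, hφH⟩ := hH.1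
  obtain ⟨c, hc, rfl⟩ := hu.exists_pos_eq_smul_height hH hφ hφH
  exact nonneg_of_mul_nonneg_right (hφ i) hc

theorem height_eq_zero_iff {i : ι} : hu.height hH (u i) = 0 ↔ i ∈ H := by
  obtain ⟨φ, hφ, hφH⟩ := hH.1
  obtain ⟨c, hc, rfl⟩ := hu.exists_pos_eq_smul_height hH hφ hφH
  simp [hφH i, hc.ne']

theorem height_pos {i : ι} (hi : i ∉ H) : 0 < hu.height hH (u i) :=
  (hu.height_nonneg hH i).lt_of_ne' (mt (hu.height_eq_zero_iff hH).1 hi)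

variable [DecidableEq ι]

theorem exists_height_eq_add_smul_tilt (x : H) {y : ι} (hy : y ∉ H)
    (hH' : IsConeFacet u (insert y (H.erase x))) :
    ∃ c : ℝ, 0 < c ∧ hu.height hH' = hu.height hH + c • hu.tilt hH x := by
  have hx : x.1 ∉ insert y (H.erase x) := by
    rw [Finset.mem_insert, not_or]
    exact ⟨fun h => hy (h ▸ x.2), Finset.notMem_erase _ _⟩
  refine ⟨hu.height hH' (u x), hu.height_pos hH' hx, ?_⟩
  conv_lhs => rw [hu.eq_smul_height_add_smul_tilt hH x (ψ := hu.height hH') fun i hi hix =>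
    hu.height_of_mem hH' (by simp [hi, hix]), height_sum, one_smul]

theorem tilt_neg_of_adjacent (x : H) {y : ι} (hy : y ∉ H)
    (hH' : IsConeFacet u (insert y (H.erase x))) : hu.tilt hH x (u y) < 0 := by
  obtain ⟨c, hc, heq⟩ := hu.exists_height_eq_add_smul_tilt hH x hy hH'
  have hzero := hu.height_of_mem hH' (Finset.mem_insert_self y _)
  rw [heq, LinearMap.add_apply, LinearMap.smul_apply, smul_eq_mul] at hzero
  exact neg_of_mul_neg_right (by linarith [hu.height_pos hH hy]) hc.le

end Facet

theorem exists_adjacent [Finite ι] [DecidableEq ι] (hu : IsSimplicialCone u) {H : Finset ι}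
    (hH : IsConeFacet u H) (x : H) : ∃ y, y ∉ H ∧ IsConeFacet u (insert y (H.erase x)) := by
  cases nonempty_fintype ι
  have hneg : ∃ i, hu.tilt hH x (u i) < 0 := by
    by_contra! h
    have hsum := hu.tilt_sum hH x
    rw [map_sum, Finset.sum_eq_zero_iff_of_nonneg fun i _ => h i] at hsum
    exact one_ne_zero ((hu.tilt_self hH x).symm.trans (hsum x (Finset.mem_univ _)))
  have htilt : ∀ i, hu.height hH (u i) = 0 → 0 ≤ hu.tilt hH x (u i) := fun i hi => by
    by_cases hix : i = x
    · rw [hix, hu.tilt_self]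
      exact zero_le_one
    · exact (hu.tilt_of_ne hH x ((hu.height_eq_zero_iff hH).1 hi) hix).ge
  obtain ⟨t, ht, hle, y, hy, hy0⟩ :=
    exists_pos_forall_add_mul_nonneg (hu.height_nonneg hH) htilt hneg
  have hyH : y ∉ H := fun h => hy.not_ge (htilt y (hu.height_of_mem hH h))
  have hcard : (insert y (H.erase x)).card = H.card := by
    rw [Finset.card_insert_of_notMem (fun h => hyH (Finset.mem_of_mem_erase h)),
      Finset.card_erase_add_one x.2]
  let Z := Finset.univ.filter fun i => hu.height hH (u i) + t * hu.tilt hH x (u i) = 0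
  have hZ : IsConeFace u Z := ⟨hu.height hH + t • hu.tilt hH x, hle, fun k => by simp [Z]⟩
  have hx : x.1 ∉ Z := by simp [Z, hu.height_of_mem hH x.2, hu.tilt_self, ht.ne']
  have hsub : insert y (H.erase x) ⊆ Z := fun i hi => by
    rcases Finset.mem_insert.1 hi with rfl | hi
    · simpa [Z] using hy0
    · obtain ⟨hix, hi⟩ := Finset.mem_erase.1 hi
      simp [Z, hu.height_of_mem hH hi, hu.tilt_of_ne hH x hi hix]
  have hZcard := hu.card_add_one_le hZ ⟨x, hx⟩
  rw [← Finset.eq_of_subset_of_card_le hsub (by have := hH.2; omega)] at hZ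
  exact ⟨y, hyH, hZ, hcard ▸ hH.2⟩

theorem adjacent_unique [Finite ι] [DecidableEq ι] (hu : IsSimplicialCone u) {H : Finset ι}
    (hH : IsConeFacet u H) (x : H) {y z : ι} (hy : y ∉ H) (hz : z ∉ H)
    (hHy : IsConeFacet u (insert y (H.erase x))) (hHz : IsConeFacet u (insert z (H.erase x))) :
    y = z := by
  cases nonempty_fintype ι
  obtain ⟨b, hb, hheight_y⟩ := hu.exists_height_eq_add_smul_tilt hH x hy hHy
  obtain ⟨c, hc, hheight_z⟩ := hu.exists_height_eq_add_smul_tilt hH x hz hHz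
  wlog hbc : b ≤ c generalizing y z b c
  · exact (this hz hy hHz hHy c hc hheight_z b hb hheight_y (le_of_not_ge hbc)).symm
  have hzero := hu.height_of_mem hHy (Finset.mem_insert_self y _)
  have hnonneg := hu.height_nonneg hHz y
  rw [hheight_y, LinearMap.add_apply, LinearMap.smul_apply, smul_eq_mul] at hzero
  rw [hheight_z, LinearMap.add_apply, LinearMap.smul_apply, smul_eq_mul] at hnonneg
  have hcb : c ≤ b :=
    (mul_le_mul_right_of_neg (hu.tilt_neg_of_adjacent hH x hy hHy)).1 (by linarith)
  have hmem : y ∈ insert z (H.erase x) := by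
    rw [← hu.height_eq_zero_iff hHz, hheight_z, hcb.antisymm hbc, ← hheight_y]
    exact hu.height_of_mem hHy (Finset.mem_insert_self y _)
  exact (Finset.mem_insert.1 hmem).resolve_right fun h => hy (Finset.mem_of_mem_erase h)

theorem existsUnique_adjacent [Finite ι] [DecidableEq ι] (hu : IsSimplicialCone u) {H : Finset ι}
    (hH : IsConeFacet u H) {x : ι} (hx : x ∈ H) :
    ∃! y, y ∉ H ∧ IsConeFacet u (insert y (H.erase x)) := by
  cases nonempty_fintype ι
  obtain ⟨y, hy, hfacet⟩ := hu.exists_adjacent hH ⟨x, hx⟩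
  exact ⟨y, ⟨hy, hfacet⟩, fun z hz => hu.adjacent_unique hH ⟨x, hx⟩ hz.1 hy hz.2 hfacet⟩

/-- The simplex algorithm: as long as a facet is not contained in `G`, some neighbouring facet has
a smaller height at the sum of the generators of `G`. -/
theorem exists_adjacent_height_lt [Fintype ι] [DecidableEq ι] (hu : IsSimplicialCone u)
    {G H : Finset ι} (hG : IsConeFacet u G) (hH : IsConeFacet u H) (hne : H ≠ G) :
    ∃ x ∈ H, ∃ y ∉ H, ∃ hH' : IsConeFacet u (insert y (H.erase x)),
      hu.height hH' (∑ g ∈ G, u g) < hu.height hH (∑ g ∈ G, u g) := by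
  obtain ⟨g, hg, hgH⟩ : ∃ g ∈ G, g ∉ H := by
    by_contra! h
    exact hne (Finset.eq_of_subset_of_card_le h (by have := hG.2; have := hH.2; omega)).symm
  have hpos : 0 < hu.height hH (∑ g ∈ G, u g) := by
    rw [map_sum]
    exact Finset.sum_pos' (fun i _ => hu.height_nonneg hH i) ⟨g, hg, hu.height_pos hH hgH⟩
  have hzero : hu.height hG (∑ g ∈ G, u g) = 0 := by
    rw [map_sum]
    exact Finset.sum_eq_zero fun g hg => hu.height_of_mem hG hg
  rw [hu.eq_height_add_sum_tilt hH (hu.height hG), height_sum, one_smul, LinearMap.add_apply,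
    LinearMap.sum_apply] at hzero
  obtain ⟨x, -, hx⟩ := Finset.exists_lt_of_sum_lt (s := Finset.univ) (g := fun _ => (0 : ℝ))
    (f := fun x : H => (hu.height hG (u x) • hu.tilt hH x) (∑ g ∈ G, u g))
    (by rw [Finset.sum_const_zero]; linarith)
  have htilt : hu.tilt hH x (∑ g ∈ G, u g) < 0 :=
    neg_of_mul_neg_right hx (hu.height_nonneg hG x)
  obtain ⟨y, hy, hH'⟩ := hu.exists_adjacent hH x
  obtain ⟨c, hc, heq⟩ := hu.exists_height_eq_add_smul_tilt hH x hy hH'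
  refine ⟨x, x.2, y, hy, hH', ?_⟩
  rw [heq, LinearMap.add_apply, LinearMap.smul_apply, smul_eq_mul]
  linarith [mul_neg_of_pos_of_neg hc htilt]

/-- Any two facets are joined by a path of facets, consecutive ones sharing a ridge. -/
theorem mem_of_adjacent_closed [Finite ι] [DecidableEq ι] (hu : IsSimplicialCone u)
    {𝓢 : Set (Finset ι)} (hfacet : ∀ H ∈ 𝓢, IsConeFacet u H) (hne : 𝓢.Nonempty)
    (hclosed : ∀ H ∈ 𝓢, ∀ x ∈ H, ∀ y ∉ H, IsConeFacet u (insert y (H.erase x)) →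
      insert y (H.erase x) ∈ 𝓢) {G : Finset ι} (hG : IsConeFacet u G) : G ∈ 𝓢 := by
  cases nonempty_fintype ι
  obtain ⟨H₀, hH₀⟩ := hne
  obtain ⟨H, hH, hmin⟩ := Set.exists_min_image {H : {H // IsConeFacet u H} | H.1 ∈ 𝓢}
    (fun H => hu.height H.2 (∑ g ∈ G, u g)) (Set.toFinite _) ⟨⟨H₀, hfacet H₀ hH₀⟩, hH₀⟩
  by_contra hGS
  obtain ⟨x, hx, y, hy, hH', hlt⟩ :=
    hu.exists_adjacent_height_lt hG H.2 fun h => hGS (h ▸ hH)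
  exact (hmin ⟨_, hH'⟩ (hclosed H hH x hx y hy hH')).not_gt hlt

end IsSimplicialCone

end Cone

section Orientation

theorem exists_orderEmbOfFin_insert_eq_insertNth {ι : Type*} [LinearOrder ι] {R : Finset ι} {m : ℕ}
    (hR : R.card = m) {x : ι} (h : (insert x R).card = m + 1) :
    ∃ p : Fin (m + 1), (p : ℕ) = (R.filter (· < x)).card ∧
      ⇑((insert x R).orderEmbOfFin h) = p.insertNth x (R.orderEmbOfFin hR) := by
  let w := (insert x R).orderEmbOfFin h
  obtain ⟨p, hp⟩ : ∃ p, w p = x := by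
    rw [← Set.mem_range, Finset.range_orderEmbOfFin]
    exact_mod_cast Finset.mem_insert_self x R
  refine ⟨p, ?_, ?_⟩
  · have hfilter : R.filter (· < x) = (Finset.Iio p).map w.toEmbedding := by
      ext i
      simp only [Finset.mem_filter, Finset.mem_map, Finset.mem_Iio, RelEmbedding.coe_toEmbedding]
      refine ⟨fun ⟨hi, hix⟩ => ?_, ?_⟩
      · obtain ⟨j, rfl⟩ : i ∈ Set.range w := by
          rw [Finset.range_orderEmbOfFin]
          exact_mod_cast Finset.mem_insert_of_mem hi
        exact ⟨j, w.lt_iff_lt.1 (hix.trans_eq hp.symm), rfl⟩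
      · rintro ⟨j, hj, rfl⟩
        have hlt : w j < x := (w.lt_iff_lt.2 hj).trans_eq hp
        exact ⟨Finset.mem_of_mem_insert_of_ne (Finset.orderEmbOfFin_mem _ h j) hlt.ne, hlt⟩
    rw [hfilter, Finset.card_map, Fin.card_Iio]
  · refine Fin.eq_insertNth_iff.2 ⟨hp, Finset.orderEmbOfFin_unique hR (fun j => ?_)
      (w.strictMono.comp p.strictMono_succAbove)⟩
    refine Finset.mem_of_mem_insert_of_ne (Finset.orderEmbOfFin_mem _ h _) fun hj => ?_
    exact p.succAbove_ne j (w.injective (hj.trans hp.symm))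

/-- The sign of a nonzero real number. -/
noncomputable def unitSign (t : ℝ) : ℤˣ := if 0 < t then 1 else -1

theorem unitSign_neg {t : ℝ} (ht : t ≠ 0) : unitSign (-t) = -unitSign t := by
  rcases ht.lt_or_gt with h | h <;> simp [unitSign, h, h.not_gt]

theorem unitSign_neg_one_pow_mul (p : ℕ) {t : ℝ} (ht : t ≠ 0) :
    unitSign ((-1) ^ p * t) = (-1) ^ p * unitSign t := by
  rcases Nat.even_or_odd p with h | h <;> simp [h.neg_one_pow, unitSign_neg ht]

theorem unitSign_eq_neg_of_mul_neg {s t : ℝ} (h : s * t < 0) : unitSign s = -unitSign t := by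
  rcases mul_neg_iff.1 h with ⟨hs, ht⟩ | ⟨hs, ht⟩ <;> simp [unitSign, hs, ht, hs.not_gt, ht.not_gt]

/-- A coherent orientation of the complex `Δ` with facets of `m` vertices, relative to the
orientations given by the order of the vertices: in the boundary of the sum of the facets with
signs `ε`, the two terms at a ridge `R` cancel. -/
def IsCoherentOrientation {V : Type*} [LinearOrder V] (Δ : Set (Finset V)) (m : ℕ)
    (ε : Finset V → ℤˣ) : Prop :=
  ∀ (R : Finset V) (x y : V), R.card + 1 = m → x ∉ R → y ∉ R → x ≠ y →
    insert x R ∈ Δ → insert y R ∈ Δ →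
      (-1) ^ (R.filter (· < x)).card * ε (insert x R) =
        -((-1) ^ (R.filter (· < y)).card * ε (insert y R))

variable {E : Type*} [AddCommGroup E] [Module ℝ E] {ι : Type*} [Fintype ι] [LinearOrder ι]

/-- The volume of the frame formed by the sum of all generators and the generators `u i`, `i ∈ H`,
in increasing order. It is `0` by convention if `H` does not have `m` elements. -/
noncomputable def frameVolume (u : ι → E) {m : ℕ} (ω : E [⋀^Fin (m + 1)]→ₗ[ℝ] ℝ) (H : Finset ι) :
    ℝ :=
  if h : H.card = m then ω.curryLeft (∑ i, u i) (u ∘ H.orderEmbOfFin h) else 0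

theorem neg_one_pow_mul_frameVolume_insert (u : ι → E) {m : ℕ} (ω : E [⋀^Fin (m + 2)]→ₗ[ℝ] ℝ)
    {R : Finset ι} (hR : R.card = m) {x : ι} (hx : x ∉ R) :
    (-1) ^ (R.filter (· < x)).card * frameVolume u ω (insert x R) =
      (ω.curryLeft (∑ i, u i)).curryLeft (u x) (u ∘ R.orderEmbOfFin hR) := by
  have h : (insert x R).card = m + 1 := by rw [Finset.card_insert_of_notMem hx, hR]
  obtain ⟨p, hp, heq⟩ := exists_orderEmbOfFin_insert_eq_insertNth hR h
  have hcomp : u ∘ p.insertNth x (R.orderEmbOfFin hR) =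
      p.insertNth (u x) (u ∘ R.orderEmbOfFin hR) :=
    Fin.eq_insertNth_iff.2 ⟨by simp, funext fun j => by simp [Fin.removeNth]⟩
  rw [frameVolume, dif_pos h, heq, hcomp, ← hp, AlternatingMap.curryLeft_apply_apply _ (u x),
    ← AlternatingMap.neg_one_pow_smul_map_insertNth _ p, zsmul_eq_mul]
  push_cast
  rfl

namespace IsSimplicialCone

variable {u : ι → E}

theorem frameVolume_ne_zero (hu : IsSimplicialCone u) {m : ℕ} {ω : E [⋀^Fin (m + 1)]→ₗ[ℝ] ℝ}
    (hω : ω ≠ 0) {H : Finset ι} (hH : IsConeFacet u H) (h : H.card = m) :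
    frameVolume u ω H ≠ 0 := by
  let e := (finSuccEquiv m).trans (H.orderIsoOfFin h).toEquiv.optionCongr
  have hbasis : Matrix.vecCons (∑ i, u i) (u ∘ H.orderEmbOfFin h) =
      (hu.facetBasis hH).reindex e.symm := by
    funext i
    rw [Module.Basis.reindex_apply, Equiv.symm_symm]
    cases i using Fin.cases <;> simp [e]
  rw [frameVolume, dif_pos h, AlternatingMap.curryLeft_apply_apply, hbasis]
  exact (AlternatingMap.map_basis_ne_zero_iff _ ω).2 hω

theorem frameVolume_mul_frameVolume_neg (hu : IsSimplicialCone u) {m : ℕ}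
    {ω : E [⋀^Fin (m + 2)]→ₗ[ℝ] ℝ} (hω : ω ≠ 0) {R : Finset ι} (hR : R.card = m) {x y : ι}
    (hx : x ∉ R) (hy : y ∉ R) (hxy : x ≠ y) (hRx : IsConeFacet u (insert x R))
    (hRy : IsConeFacet u (insert y R)) :
    ((-1) ^ (R.filter (· < x)).card * frameVolume u ω (insert x R)) *
      ((-1) ^ (R.filter (· < y)).card * frameVolume u ω (insert y R)) < 0 := by
  let w := u ∘ R.orderEmbOfFin hR
  let χ : E →ₗ[ℝ] ℝ :=
    { toFun := fun e => (ω.curryLeft (∑ i, u i)).curryLeft e w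
      map_add' := fun a b => by simp
      map_smul' := fun c a => by simp }
  have hχ : ∀ z ∉ R, (-1) ^ (R.filter (· < z)).card * frameVolume u ω (insert z R) = χ (u z) :=
    fun z hz => neg_one_pow_mul_frameVolume_insert u ω hR hz
  have hχx : χ (u x) ≠ 0 := by
    rw [← hχ x hx]
    exact mul_ne_zero (pow_ne_zero _ (by norm_num)) (hu.frameVolume_ne_zero hω hRx
      (by rw [Finset.card_insert_of_notMem hx, hR]))
  have hχsum : χ (∑ i, u i) = 0 := by
    change ω.curryLeft _ (Matrix.vecCons _ w) = 0
    rw [AlternatingMap.curryLeft_apply_apply]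
    exact ω.map_eq_zero_of_eq _ (i := 0) (j := 1) rfl Fin.zero_ne_one
  have hχR : ∀ r ∈ R, χ (u r) = 0 := fun r hr => by
    obtain ⟨j, rfl⟩ : r ∈ Set.range (R.orderEmbOfFin hR) := by
      rwa [Finset.range_orderEmbOfFin]
    exact (ω.curryLeft _).map_eq_zero_of_eq (Matrix.vecCons _ w) (i := 0) (j := j.succ) rfl
      (Fin.succ_ne_zero j).symm
  let x' : (insert x R : Finset ι) := ⟨x, Finset.mem_insert_self x R⟩
  have htilt : χ = χ (u x) • hu.tilt hRx x' := by
    conv_lhs => rw [hu.eq_smul_height_add_smul_tilt hRx x' fun i hi hix =>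
      hχR i (Finset.mem_of_mem_insert_of_ne hi hix), hχsum, zero_smul, zero_add]
  have hneg : hu.tilt hRx x' (u y) < 0 :=
    hu.tilt_neg_of_adjacent hRx x' (by simp [hxy.symm, hy])
      (by simpa [x', Finset.erase_insert hx] using hRy)
  rw [hχ x hx, hχ y hy, htilt, LinearMap.smul_apply, LinearMap.smul_apply, hu.tilt_self]
  have := mul_neg_of_pos_of_neg (mul_self_pos.2 hχx) hneg
  simp only [smul_eq_mul]
  linarith

omit [Fintype ι] in
theorem exists_isCoherentOrientation [Finite ι] (hu : IsSimplicialCone u) :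
    ∃ ε, IsCoherentOrientation {S | IsConeFace u S} (Module.finrank ℝ E - 1) ε := by
  cases nonempty_fintype ι
  rcases lt_or_ge (Module.finrank ℝ E) 2 with hlt | hge
  · exact ⟨1, fun R x y hR => by omega⟩
  obtain ⟨m, hm⟩ := Nat.exists_eq_add_of_le' hge
  have := hu.finiteDimensional
  let ω := (Module.finBasisOfFinrankEq ℝ E hm).det
  have hω : ω ≠ 0 := Module.Basis.det_ne_zero _
  refine ⟨fun H => unitSign (frameVolume u ω H), fun R x y hR hx hy hxy hRx hRy => ?_⟩
  replace hR : R.card = m := by omega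
  have hfacet : ∀ z ∉ R, IsConeFace u (insert z R) → IsConeFacet u (insert z R) := fun z hz h =>
    ⟨h, by rw [Finset.card_insert_of_notMem hz, hR, hm]⟩
  have hneg := hu.frameVolume_mul_frameVolume_neg hω hR hx hy hxy (hfacet x hx hRx)
    (hfacet y hy hRy)
  rw [← unitSign_neg_one_pow_mul _ (right_ne_zero_of_mul (left_ne_zero_of_mul hneg.ne)),
    ← unitSign_neg_one_pow_mul _ (right_ne_zero_of_mul (right_ne_zero_of_mul hneg.ne))]
  exact unitSign_eq_neg_of_mul_neg hneg

end IsSimplicialCone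

end Orientation

section Homogenization

variable {ι : Type*} {E E' : Type*} [AddCommGroup E] [Module ℝ E] [AddCommGroup E'] [Module ℝ E']

/-- The points `v i` in homogeneous coordinates, i.e. placed at height one. -/
def homogenize (v : ι → E) (i : ι) : ℝ × E := (1, v i)

theorem isPolytopeFace_iff_isConeFace {d n : ℕ} (v : Fin n → Fin d → ℝ) (S : Finset (Fin n)) :
    IsPolytopeFace v S ↔ IsConeFace (homogenize v) S := by
  constructor
  · rintro ⟨l, c, h, hS⟩
    refine ⟨c • LinearMap.fst ℝ ℝ _ - l.comp (LinearMap.snd ℝ ℝ _), fun i => ?_, fun i => ?_⟩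
    · simpa [homogenize] using h i
    · rw [hS i, ← sub_eq_zero, ← neg_eq_zero]
      simp [homogenize]
  · rintro ⟨φ, h, hS⟩
    have hφ : ∀ i, φ (homogenize v i) = φ (1, 0) + φ (0, v i) := fun i => by
      rw [← map_add]
      simp [homogenize]
    refine ⟨-φ.comp (LinearMap.inr ℝ ℝ _), φ (1, 0), fun i => ?_, fun i => ?_⟩
    · have := (h i).trans_eq (hφ i)
      simp only [LinearMap.neg_apply, LinearMap.comp_apply, LinearMap.inr_apply]
      linarith
    · rw [hS i, hφ, add_comm, ← neg_eq_iff_add_eq_zero]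
      rfl

theorem affineIndependent_iff_linearIndependent_homogenize (v : ι → E) :
    AffineIndependent ℝ v ↔ LinearIndependent ℝ (homogenize v) := by
  rw [affineIndependent_iff, linearIndependent_iff']
  refine forall₂_congr fun s w => ?_
  have hsum : ∑ i ∈ s, w i • homogenize v i = (∑ i ∈ s, w i, ∑ i ∈ s, w i • v i) := by
    rw [Prod.ext_iff, Prod.fst_sum, Prod.snd_sum]
    simp [homogenize]
  rw [hsum, Prod.mk_eq_zero, and_imp]

theorem one_mem_span_homogenize_iff [Finite ι] {v : ι → E} (p : E) :
    ((1 : ℝ), p) ∈ Submodule.span ℝ (Set.range (homogenize v)) ↔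
      p ∈ affineSpan ℝ (Set.range v) := by
  cases nonempty_fintype ι
  rw [Submodule.mem_span_range_iff_exists_fun]
  simp only [homogenize, Prod.ext_iff, Prod.fst_sum, Prod.snd_sum, Prod.smul_fst, Prod.smul_snd,
    smul_eq_mul, mul_one]
  constructor
  · rintro ⟨w, hw, rfl⟩
    rw [← Finset.univ.affineCombination_eq_linear_combination v w hw]
    exact affineCombination_mem_affineSpan hw v
  · intro hp
    obtain ⟨w, hw, hp⟩ := eq_affineCombination_of_mem_affineSpan_of_fintype hp
    exact ⟨w, hw, by rw [hp, Finset.univ.affineCombination_eq_linear_combination v w hw]⟩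

theorem span_homogenize_eq_top_iff [Finite ι] {v : ι → E} :
    Submodule.span ℝ (Set.range (homogenize v)) = ⊤ ↔ affineSpan ℝ (Set.range v) = ⊤ := by
  constructor
  · exact fun h => eq_top_iff.2 fun p _ => (one_mem_span_homogenize_iff p).1 (h ▸ trivial)
  · intro h
    have hmem : ∀ p, ((1 : ℝ), p) ∈ Submodule.span ℝ (Set.range (homogenize v)) := fun p =>
      (one_mem_span_homogenize_iff p).2 (h ▸ trivial)
    refine eq_top_iff.2 fun q _ => ?_
    have hq : q = ((1 : ℝ), q.2) + (q.1 - 1) • ((1 : ℝ), (0 : E)) := by simp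
    rw [hq]
    exact add_mem (hmem _) (Submodule.smul_mem _ _ (hmem 0))

theorem isConeFace_smul_iff {u : ι → E} {c : ι → ℝ} (hc : ∀ i, 0 < c i) {S : Finset ι} :
    IsConeFace (fun i => c i • u i) S ↔ IsConeFace u S := by
  simp only [IsConeFace, map_smul, smul_eq_mul, mul_nonneg_iff_of_pos_left (hc _), mul_eq_zero,
    (hc _).ne', false_or]

theorem isConeFace_linearEquiv_iff {u : ι → E} (L : E ≃ₗ[ℝ] E') {S : Finset ι} :
    IsConeFace (fun i => L (u i)) S ↔ IsConeFace u S := by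
  constructor
  · rintro ⟨φ, h, hS⟩
    exact ⟨φ.comp L.toLinearMap, h, hS⟩
  · rintro ⟨φ, h, hS⟩
    exact ⟨φ.comp L.symm.toLinearMap, by simpa using h, by simpa using hS⟩

namespace IsSimplicialCone

variable {u : ι → E}

theorem map_linearEquiv (hu : IsSimplicialCone u) (L : E ≃ₗ[ℝ] E') :
    IsSimplicialCone fun i => L (u i) where
  span_eq_top := by
    have h : (Set.range fun i => L (u i)) = L.toLinearMap '' Set.range u := by
      rw [← Set.range_comp]
      rfl
    rw [h, Submodule.span_image, hu.span_eq_top, Submodule.map_top, LinearEquiv.range]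
  isConeFace_singleton i := (isConeFace_linearEquiv_iff L).2 (hu.isConeFace_singleton i)
  linearIndependent S hS hne :=
    (hu.linearIndependent S ((isConeFace_linearEquiv_iff L).1 hS) hne).map' L.toLinearMap L.ker

theorem smul (hu : IsSimplicialCone u) {c : ι → ℝ} (hc : ∀ i, 0 < c i) :
    IsSimplicialCone fun i => c i • u i where
  span_eq_top := by
    rw [eq_top_iff, ← hu.span_eq_top, Submodule.span_le]
    rintro _ ⟨i, rfl⟩
    have hmem := Submodule.smul_mem (Submodule.span ℝ (Set.range fun i => c i • u i)) (c i)⁻¹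
      (Submodule.subset_span ⟨i, rfl⟩)
    rwa [smul_smul, inv_mul_cancel₀ (hc i).ne', one_smul] at hmem
  isConeFace_singleton i := (isConeFace_smul_iff hc).2 (hu.isConeFace_singleton i)
  linearIndependent S hS hne :=
    (hu.linearIndependent S ((isConeFace_smul_iff hc).1 hS) hne).units_smul
      fun i => Units.mk0 (c i) (hc i).ne'

theorem isConeFace_empty [Finite ι] (hu : IsSimplicialCone u) (h : 2 ≤ Module.finrank ℝ E) :
    IsConeFace u ∅ := by
  obtain ⟨i, -⟩ := hu.exists_notMem_of_card_lt (S := ∅) (by rw [Finset.card_empty]; omega)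
  exact hu.mono (hu.isConeFace_singleton i)
    (hu.exists_notMem_of_card_lt (by rw [Finset.card_singleton]; omega)) (Finset.empty_subset _)

end IsSimplicialCone

theorem isPolytopeFace_singleton {d n : ℕ} {v : Fin n → Fin d → ℝ} (hv : ConvexIndependent ℝ v)
    (i : Fin n) : IsPolytopeFace v {i} := by
  have hclosed : IsClosed (convexHull ℝ (v '' {i}ᶜ)) :=
    (Set.Finite.isCompact_convexHull ℝ (Set.toFinite _)).isClosed
  have hnot : v i ∉ convexHull ℝ (v '' {i}ᶜ) := fun h => by simpa using hv _ i h
  obtain ⟨f, c, hf, hc⟩ := geometric_hahn_banach_closed_point (convex_convexHull ℝ _) hclosed hnot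
  have hlt : ∀ j, j ≠ i → f (v j) < f (v i) := fun j hj =>
    (hf _ (subset_convexHull ℝ _ ⟨j, hj, rfl⟩)).trans hc
  refine ⟨f.toLinearMap, f (v i), fun j => ?_, fun j => ?_⟩
  · rcases eq_or_ne j i with rfl | h
    · exact le_rfl
    · exact (hlt j h).le
  · rw [Finset.mem_singleton]
    exact ⟨fun h => by simp [h], fun h => by_contra fun hj => (hlt j hj).ne h⟩

theorem convexIndependent_of_isPolytopeFace_singleton {d n : ℕ} {v : Fin n → Fin d → ℝ}
    (h : ∀ i, IsPolytopeFace v {i}) : ConvexIndependent ℝ v := by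
  intro s i hi
  by_contra his
  obtain ⟨l, c, hl, hS⟩ := h i
  have hsub : convexHull ℝ (v '' s) ⊆ {x | l x < c} := by
    refine convexHull_min ?_ (convex_halfSpace_lt l.isLinear c)
    rintro _ ⟨j, hj, rfl⟩
    refine (hl j).lt_of_ne fun h => his ?_
    rwa [← Finset.mem_singleton.1 ((hS j).2 h)]
  exact (hsub hi : l (v i) < c).ne ((hS i).1 (Finset.mem_singleton_self i))

theorem exists_linearEquiv_fst_eq {d : ℕ} (hE : Module.finrank ℝ E = d + 1) {φ : E →ₗ[ℝ] ℝ}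
    (hφ : φ ≠ 0) : ∃ L : E ≃ₗ[ℝ] ℝ × (Fin d → ℝ), ∀ e, (L e).1 = φ e := by
  have : FiniteDimensional ℝ E := .of_finrank_pos (by omega)
  obtain ⟨N, hN⟩ := (LinearMap.ker φ).exists_isCompl
  have hker : Module.finrank ℝ (LinearMap.ker φ) = Module.finrank ℝ (Fin d → ℝ) := by
    have := Module.Dual.finrank_ker_add_one_of_ne_zero hφ
    rw [Module.finrank_fin_fun]
    omega
  let π : E →ₗ[ℝ] LinearMap.ker φ := Submodule.projectionOnto _ N hN
  have hcompl : IsCompl (LinearMap.ker φ) (LinearMap.ker π) := by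
    rwa [Submodule.ker_projectionOnto hN]
  refine ⟨(LinearMap.equivProdOfSurjectiveOfIsCompl φ π
    (LinearMap.range_eq_top.2 (LinearMap.surjective hφ))
    (Submodule.range_projectionOnto hN) hcompl).trans
      ((LinearEquiv.refl ℝ ℝ).prodCongr (LinearEquiv.ofFinrankEq _ _ hker)), fun e => rfl⟩

theorem finset_ne_univ_iff [Fintype ι] {S : Finset ι} : S ≠ Finset.univ ↔ ∃ i, i ∉ S :=
  Finset.eq_univ_iff_forall.not.trans not_forall

namespace SimplicialPolytope

variable {d : ℕ}

theorem isSimplicialCone (P : SimplicialPolytope d) : IsSimplicialCone (homogenize P.vertex) where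
  span_eq_top := span_homogenize_eq_top_iff.2 P.affineSpan_eq_top
  isConeFace_singleton i :=
    (isPolytopeFace_iff_isConeFace _ _).1 (isPolytopeFace_singleton P.convexIndependent i)
  linearIndependent S hS hne :=
    (affineIndependent_iff_linearIndependent_homogenize _).1
      (P.simplicial S ((isPolytopeFace_iff_isConeFace _ _).2 hS)
        (finset_ne_univ_iff.2 hne))

theorem mem_boundaryComplex_iff (P : SimplicialPolytope d) {S : Finset (Fin P.n)} :
    S ∈ P.boundaryComplex ↔ IsConeFace (homogenize P.vertex) S ∧ ∃ i, i ∉ S := by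
  rw [← isPolytopeFace_iff_isConeFace, ← finset_ne_univ_iff]
  rfl

theorem mem_facets_iff (P : SimplicialPolytope d) {S : Finset (Fin P.n)} :
    S ∈ P.facets ↔ IsConeFacet (homogenize P.vertex) S := by
  have hfinrank : Module.finrank ℝ (ℝ × (Fin d → ℝ)) = d + 1 := by simp [add_comm]
  rw [IsConeFacet, hfinrank, add_left_inj]
  constructor
  · exact fun h => ⟨((mem_boundaryComplex_iff P).1 h.1).1, h.2⟩
  · exact fun h => ⟨(mem_boundaryComplex_iff P).2 ⟨h.1,
      P.isSimplicialCone.exists_notMem ⟨h.1, by rw [h.2, hfinrank]⟩⟩, h.2⟩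

theorem succ_le_n (P : SimplicialPolytope d) : d + 1 ≤ P.n := by
  simpa [add_comm] using P.isSimplicialCone.finrank_le_card

instance (P : SimplicialPolytope d) : Nonempty (Fin P.n) :=
  ⟨⟨0, d.succ_pos.trans_le P.succ_le_n⟩⟩

theorem homogenize_inv_smul {n : ℕ} {u : Fin n → ℝ × (Fin d → ℝ)} (hpos : ∀ i, 0 < (u i).1) :
    homogenize (fun i => (u i).1⁻¹ • (u i).2) = fun i => (u i).1⁻¹ • u i :=
  funext fun i => Prod.ext (inv_mul_cancel₀ (hpos i).ne').symm rfl

/-- The section of a simplicial cone by the hyperplane at height one. -/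
noncomputable def ofCone {n : ℕ} {u : Fin n → ℝ × (Fin d → ℝ)} (hu : IsSimplicialCone u)
    (hpos : ∀ i, 0 < (u i).1) : SimplicialPolytope d :=
  have hcone : IsSimplicialCone (homogenize fun i => (u i).1⁻¹ • (u i).2) := by
    rw [homogenize_inv_smul hpos]
    exact hu.smul fun i => inv_pos.2 (hpos i)
  { n := n
    vertex := fun i => (u i).1⁻¹ • (u i).2
    convexIndependent := convexIndependent_of_isPolytopeFace_singleton fun i =>
      (isPolytopeFace_iff_isConeFace _ _).2 (hcone.isConeFace_singleton i)
    affineSpan_eq_top := span_homogenize_eq_top_iff.1 hcone.span_eq_top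
    simplicial := fun S hS hne => (affineIndependent_iff_linearIndependent_homogenize _).2
      (hcone.linearIndependent S ((isPolytopeFace_iff_isConeFace _ _).1 hS)
        (finset_ne_univ_iff.1 hne)) }

theorem mem_boundaryComplex_ofCone {n : ℕ} {u : Fin n → ℝ × (Fin d → ℝ)}
    (hu : IsSimplicialCone u) (hpos : ∀ i, 0 < (u i).1) {S : Finset (Fin n)} :
    S ∈ (ofCone hu hpos).boundaryComplex ↔ IsConeFace u S ∧ ∃ i, i ∉ S := by
  refine ((ofCone hu hpos).mem_boundaryComplex_iff (S := S)).trans (and_congr_left' ?_)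
  rw [← isConeFace_smul_iff fun i => inv_pos.2 (hpos i), ← homogenize_inv_smul hpos]
  rfl

end SimplicialPolytope

end Homogenization

section Roof

variable {κ : Type*}

/-- Homogeneous coordinates in which a distinguished facet is the standard simplex in the
hyperplane where the last coordinate vanishes. -/
abbrev RoofSpace (κ : Type*) := (κ → ℝ) × ℝ

/-- The reflection in the hyperplane of the distinguished facet. -/
noncomputable def roofReflection (κ : Type*) : RoofSpace κ ≃ₗ[ℝ] RoofSpace κ :=
  LinearEquiv.prodCongr (LinearEquiv.refl ℝ _) (LinearEquiv.neg ℝ)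

@[simp]
theorem roofReflection_apply (p : RoofSpace κ) : roofReflection κ p = (p.1, -p.2) := rfl

namespace RoofSpace

theorem map_eq_add (χ : RoofSpace κ →ₗ[ℝ] ℝ) (p : RoofSpace κ) :
    χ p = χ (p.1, 0) + p.2 * χ (0, 1) := by
  have hp : p = (p.1, 0) + p.2 • ((0, 1) : RoofSpace κ) := by simp
  conv_lhs => rw [hp, map_add, map_smul, smul_eq_mul]

variable [DecidableEq κ]

theorem map_base_eq_sum [Fintype κ] (χ : RoofSpace κ →ₗ[ℝ] ℝ) (x : κ → ℝ) :
    χ (x, 0) = ∑ k, x k * χ (Pi.single k 1, 0) := by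
  conv_lhs => rw [← Finset.univ_sum_single x]
  have hsingle : ∀ k, ((Pi.single k (x k), 0) : RoofSpace κ) = x k • (Pi.single k 1, 0) := by
    simp [← Pi.single_smul]
  have hsum : ((∑ k, Pi.single k (x k), 0) : RoofSpace κ) = ∑ k, (Pi.single k (x k), 0) :=
    map_sum (LinearMap.inl ℝ (κ → ℝ) ℝ) _ _
  simp only [hsum, hsingle, map_sum, map_smul, smul_eq_mul]

variable [Finite κ] {χ : RoofSpace κ →ₗ[ℝ] ℝ}

theorem map_base_nonneg (hχ : ∀ k, 0 ≤ χ (Pi.single k 1, 0)) {x : κ → ℝ} (hx : ∀ k, 0 ≤ x k) :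
    0 ≤ χ (x, 0) := by
  cases nonempty_fintype κ
  rw [map_base_eq_sum]
  exact Finset.sum_nonneg fun k _ => mul_nonneg (hx k) (hχ k)

theorem map_base_pos (hχ : ∀ k, 0 ≤ χ (Pi.single k 1, 0)) (hne : ∃ k, χ (Pi.single k 1, 0) ≠ 0)
    {x : κ → ℝ} (hx : ∀ k, 0 < x k) : 0 < χ (x, 0) := by
  obtain ⟨k, hk⟩ := hne
  cases nonempty_fintype κ
  rw [map_base_eq_sum]
  exact Finset.sum_pos' (fun k _ => mul_nonneg (hx k).le (hχ k))
    ⟨k, Finset.mem_univ k, mul_pos (hx k) ((hχ k).lt_of_ne' hk)⟩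

theorem map_base_eq_zero (hχ : ∀ k, χ (Pi.single k 1, 0) = 0) (x : κ → ℝ) : χ (x, 0) = 0 := by
  cases nonempty_fintype κ
  simp [map_base_eq_sum, hχ]

theorem map_roofReflection_pos (hχ : ∀ k, 0 ≤ χ (Pi.single k 1, 0)) (hne : χ ≠ 0)
    (hχ' : χ (0, 1) ≤ 0) {p : RoofSpace κ} (hp : ∀ k, 0 < p.1 k) (hp' : 0 < p.2) :
    0 < χ (roofReflection κ p) := by
  rw [map_eq_add, roofReflection_apply]
  by_cases hbase : ∃ k, χ (Pi.single k 1, 0) ≠ 0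
  · nlinarith [map_base_pos hχ hbase hp, mul_nonneg hp'.le (neg_nonneg.2 hχ')]
  · have hzero := map_base_eq_zero (not_exists_not.1 hbase)
    have hneg : χ (0, 1) ≠ 0 := fun h0 => hne <| LinearMap.ext fun q => by
      rw [map_eq_add, hzero, h0, mul_zero, add_zero, LinearMap.zero_apply]
    rw [hzero, zero_add]
    exact mul_pos_of_neg_of_neg (neg_lt_zero.2 hp') (hχ'.lt_of_ne hneg)

end RoofSpace

/-- `T` consists of the generators on a face that is visible from above, that is, on a face
supported by a functional that does not increase upwards. -/
def IsUpperFace {ι : Type*} (u : ι → RoofSpace κ) (T : Finset ι) : Prop :=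
  ∃ χ : RoofSpace κ →ₗ[ℝ] ℝ, χ ≠ 0 ∧ χ (0, 1) ≤ 0 ∧ (∀ i, 0 ≤ χ (u i)) ∧ ∀ i, i ∈ T ↔ χ (u i) = 0

theorem isUpperFace_roofReflection_iff {ι : Type*} {w : ι → RoofSpace κ} {S : Finset ι} :
    IsUpperFace (fun i => roofReflection κ (w i)) S ↔ ∃ χ : RoofSpace κ →ₗ[ℝ] ℝ,
      χ ≠ 0 ∧ 0 ≤ χ (0, 1) ∧ (∀ i, 0 ≤ χ (w i)) ∧ ∀ i, i ∈ S ↔ χ (w i) = 0 := by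
  have hcomp : Function.Surjective fun χ : RoofSpace κ →ₗ[ℝ] ℝ =>
      χ.comp (roofReflection κ).toLinearMap := fun χ =>
    ⟨χ.comp (roofReflection κ).toLinearMap, LinearMap.ext fun p => by simp⟩
  have hne : ∀ χ : RoofSpace κ →ₗ[ℝ] ℝ, χ.comp (roofReflection κ).toLinearMap ≠ 0 ↔ χ ≠ 0 :=
    fun χ => not_congr ⟨fun h0 => LinearMap.ext fun p => by
      simpa using LinearMap.congr_fun h0 (roofReflection κ p), fun h0 => by simp [h0]⟩
  have hdown : ∀ χ : RoofSpace κ →ₗ[ℝ] ℝ, χ (roofReflection κ (0, 1)) = -χ (0, 1) := fun χ => by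
    rw [← map_neg]
    simp
  rw [IsUpperFace, hcomp.exists]
  simp only [hne, LinearMap.comp_apply, LinearEquiv.coe_coe, hdown, Left.neg_nonpos_iff]
  simp

theorem isConeFace_and_exists_notMem_iff_isUpperFace_or {ι : Type*} {w : ι → RoofSpace κ}
    (hw : Submodule.span ℝ (Set.range w) = ⊤) {S : Finset ι} :
    IsConeFace w S ∧ (∃ i, i ∉ S) ↔
      IsUpperFace w S ∨ IsUpperFace (fun i => roofReflection κ (w i)) S := by
  have hproper : ∀ χ : RoofSpace κ →ₗ[ℝ] ℝ, (∀ i, i ∈ S ↔ χ (w i) = 0) →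
      ((∃ i, i ∉ S) ↔ χ ≠ 0) := fun χ hS => by
    rw [← not_forall, Ne, not_iff_not]
    refine ⟨fun h => LinearMap.ext_on_range hw fun i => ?_, fun h i => (hS i).2 (by simp [h])⟩
    rw [(hS i).1 (h i), LinearMap.zero_apply]
  rw [isUpperFace_roofReflection_iff]
  constructor
  · rintro ⟨⟨χ, hχ, hS⟩, hne⟩
    exact (le_total (χ (0, 1)) 0).imp (fun h => ⟨χ, (hproper χ hS).1 hne, h, hχ, hS⟩)
      fun h => ⟨χ, (hproper χ hS).1 hne, h, hχ, hS⟩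
  · rintro (⟨χ, hne, -, hχ, hS⟩ | ⟨χ, hne, -, hχ, hS⟩) <;>
      exact ⟨⟨χ, hχ, hS⟩, (hproper χ hS).2 hne⟩

/-- The distinguished facet `a` is the standard simplex, and all other points lie strictly above its
interior. -/
structure IsRoof [DecidableEq κ] {ι : Type*} (u : ι → RoofSpace κ) (a : κ ↪ ι) : Prop where
  base : ∀ k, u (a k) = (Pi.single k 1, 0)
  fst_pos : ∀ i ∉ Set.range a, ∀ k, 0 < (u i).1 k
  snd_pos : ∀ i ∉ Set.range a, 0 < (u i).2

theorem IsSimplicialCone.exists_forall_tilt_add_mul_height_pos {E ι : Type*} [AddCommGroup E]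
    [Module ℝ E] [Fintype ι] {u : ι → E} (hu : IsSimplicialCone u) {H : Finset ι}
    (hH : IsConeFacet u H) :
    ∃ M : ℝ, ∀ i ∉ H, ∀ x : H, 0 < hu.tilt hH x (u i) + M * hu.height hH (u i) := by
  have hlarge : ∀ i ∉ H, ∀ x : H, ∀ᶠ M : ℝ in Filter.atTop,
      0 < hu.tilt hH x (u i) + M * hu.height hH (u i) := fun i hi x =>
    (Filter.tendsto_atTop_add_const_left _ _
      (Filter.tendsto_id.atTop_mul_const (hu.height_pos hH hi))).eventually_gt_atTop 0
  refine Filter.Eventually.exists (f := Filter.atTop) ?_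
  simpa only [Filter.eventually_all] using hlarge

theorem IsSimplicialCone.exists_isRoof {E ι : Type*} [AddCommGroup E] [Module ℝ E] [Finite ι]
    [Fintype κ] [DecidableEq κ] {u : ι → E} (hu : IsSimplicialCone u) {a : κ ↪ ι}
    (ha : IsConeFacet u (Finset.univ.map a)) :
    ∃ L : E ≃ₗ[ℝ] RoofSpace κ, IsRoof (fun i => L (u i)) a := by
  classical
  cases nonempty_fintype ι
  let x : κ → Finset.univ.map a := fun k => ⟨a k, Finset.mem_map_of_mem a (Finset.mem_univ k)⟩
  have hrange : ∀ i ∉ Set.range a, i ∉ Finset.univ.map a := fun i hi => by simpa using hi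
  obtain ⟨M, hM⟩ := hu.exists_forall_tilt_add_mul_height_pos ha
  let L : E →ₗ[ℝ] RoofSpace κ :=
    (LinearMap.pi fun k => hu.tilt ha (x k) + M • hu.height ha).prod (hu.height ha)
  have hL : Function.Injective L := by
    refine (injective_iff_map_eq_zero L).2 fun e he =>
      (hu.facetBasis ha).forall_coord_eq_zero_iff.1 ?_
    have hsnd : hu.height ha e = 0 := congrArg Prod.snd he
    have hfst : ∀ k, hu.tilt ha (x k) e + M * hu.height ha e = 0 := fun k =>
      congrFun (congrArg Prod.fst he) k
    rintro (_ | ⟨i, hi⟩)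
    · exact hsnd
    · obtain ⟨k, -, rfl⟩ := Finset.mem_map.1 hi
      have hk := hfst k
      rwa [hsnd, mul_zero, add_zero] at hk
  have := hu.finiteDimensional
  have hrank : Module.finrank ℝ E = Module.finrank ℝ (RoofSpace κ) := by
    simp [← ha.2]
  refine ⟨L.linearEquivOfInjective hL hrank, fun k => ?_, fun i hi k => hM i (hrange i hi) (x k),
    fun i hi => hu.height_pos ha (hrange i hi)⟩
  have hk : hu.height ha (u (a k)) = 0 := hu.height_of_mem ha (x k).2
  refine Prod.ext (funext fun j => ?_) hk
  change hu.tilt ha (x j) (u (a k)) + M * hu.height ha (u (a k)) = (Pi.single k 1 : κ → ℝ) j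
  rw [hk, mul_zero, add_zero]
  rcases eq_or_ne j k with rfl | h
  · rw [hu.tilt_self ha (x j), Pi.single_eq_same]
  · rw [hu.tilt_of_ne ha (x j) (x k).2 (a.injective.ne h.symm), Pi.single_eq_of_ne h]

namespace IsRoof

variable [DecidableEq κ] {ι : Type*} {u : ι → RoofSpace κ} {a : κ ↪ ι}

theorem map_single_nonneg (h : IsRoof u a) {χ : RoofSpace κ →ₗ[ℝ] ℝ} (hχ : ∀ i, 0 ≤ χ (u i))
    (k : κ) : 0 ≤ χ (Pi.single k 1, 0) :=
  h.base k ▸ hχ (a k)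

theorem exists_base_notMem_of_isUpperFace [Finite κ] (h : IsRoof u a)
    (hne : Set.range a ≠ Set.univ) {T : Finset ι} (hT : IsUpperFace u T) : ∃ k, a k ∉ T := by
  obtain ⟨χ, hχ0, hχ', hχ, hT⟩ := hT
  obtain ⟨i, hi⟩ := (Set.ne_univ_iff_exists_notMem _).1 hne
  by_contra! hall
  have hbase : ∀ x, χ (x, 0) = 0 :=
    RoofSpace.map_base_eq_zero fun k => h.base k ▸ (hT (a k)).1 (hall k)
  have hup : χ (0, 1) = 0 := by
    have hi' := hχ i
    rw [RoofSpace.map_eq_add, hbase, zero_add] at hi'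
    exact hχ'.antisymm (nonneg_of_mul_nonneg_right hi' (h.snd_pos i hi))
  refine hχ0 (LinearMap.ext fun p => ?_)
  rw [RoofSpace.map_eq_add, hbase, hup, mul_zero, add_zero, LinearMap.zero_apply]

theorem isUpperFace_of_isConeFace [Fintype κ] (h : IsRoof u a) {T : Finset ι}
    (hT : IsConeFace u T) (hne : ∃ i, i ∉ T) (hTa : T ≠ Finset.univ.map a) : IsUpperFace u T := by
  obtain ⟨χ, hχ, hT⟩ := hT
  obtain ⟨i₀, hi₀⟩ := hne
  by_cases hup : χ (0, 1) ≤ 0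
  · exact ⟨χ, fun h0 => hi₀ ((hT i₀).2 (by simp [h0])), hup, hχ, hT⟩
  have hbase := h.map_single_nonneg hχ
  have hpos : ∀ i ∉ Set.range a, 0 < χ (u i) := fun i hi => by
    rw [RoofSpace.map_eq_add]
    exact add_pos_of_nonneg_of_pos (RoofSpace.map_base_nonneg hbase fun k => (h.fst_pos i hi k).le)
      (mul_pos (h.snd_pos i hi) (not_le.1 hup))
  have hsub : T ⊆ Finset.univ.map a := fun i hi => by
    by_contra hia
    exact (hpos i (by simpa using hia)).ne' ((hT i).1 hi)
  obtain ⟨k, hk⟩ : ∃ k, χ (Pi.single k 1, 0) ≠ 0 := by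
    by_contra! hzero
    refine hTa (hsub.antisymm fun i hi => ?_)
    obtain ⟨k, -, rfl⟩ := Finset.mem_map.1 hi
    exact (hT _).2 (h.base k ▸ hzero k)
  -- Forgetting the last coordinate makes the functional constant in the vertical direction, without
  -- changing it on the base.
  let χ' : RoofSpace κ →ₗ[ℝ] ℝ := χ.comp ((LinearMap.inl ℝ _ _).comp (LinearMap.fst ℝ _ _))
  have hχ'a : ∀ k, χ' (u (a k)) = χ (u (a k)) := fun k => by simp [χ', h.base]
  have hχ'pos : ∀ i ∉ Set.range a, 0 < χ' (u i) := fun i hi =>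
    RoofSpace.map_base_pos hbase ⟨k, hk⟩ (h.fst_pos i hi)
  refine ⟨χ', fun h0 => hk ?_, (map_zero χ).le, fun i => ?_, fun i => ?_⟩
  · rw [← h.base, ← hχ'a, h0, LinearMap.zero_apply]
  · by_cases hi : i ∈ Set.range a
    · obtain ⟨k, rfl⟩ := hi
      exact (hχ'a k).symm ▸ hχ _
    · exact (hχ'pos i hi).le
  · by_cases hi : i ∈ Set.range a
    · obtain ⟨k, rfl⟩ := hi
      rw [hχ'a, hT]
    · rw [hT]
      exact iff_of_false (hpos i hi).ne' (hχ'pos i hi).ne'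

theorem isUpperFace_iff [Fintype κ] (h : IsRoof u a) (hne : Set.range a ≠ Set.univ)
    {T : Finset ι} :
    IsUpperFace u T ↔ (IsConeFace u T ∧ ∃ i, i ∉ T) ∧ T ≠ Finset.univ.map a := by
  constructor
  · intro hT
    obtain ⟨k, hk⟩ := h.exists_base_notMem_of_isUpperFace hne hT
    obtain ⟨χ, -, -, hχ, hχT⟩ := hT
    exact ⟨⟨⟨χ, hχ, hχT⟩, a k, hk⟩, fun hTa => hk (hTa ▸ Finset.mem_map_of_mem a (by simp))⟩
  · exact fun hT => h.isUpperFace_of_isConeFace hT.1.1 hT.1.2 hT.2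

end IsRoof

/-- Two roofs, the second one turned upside down, put together along their common base. -/
structure IsRoofGluing [DecidableEq κ] {α β γ : Type*} (u₁ : α → RoofSpace κ)
    (u₂ : β → RoofSpace κ) (w : γ → RoofSpace κ) (a : κ ↪ α) (b : κ ↪ β) (f₁ : α ↪ γ)
    (f₂ : β ↪ γ) : Prop where
  roof₁ : IsRoof u₁ a
  roof₂ : IsRoof u₂ b
  apply₁ : ∀ i, w (f₁ i) = u₁ i
  apply₂ : ∀ j, w (f₂ j) = roofReflection κ (u₂ j)
  base_eq : ∀ k, f₁ (a k) = f₂ (b k)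
  union_range : Set.range f₁ ∪ Set.range f₂ = Set.univ

namespace IsRoofGluing

variable [DecidableEq κ] {α β γ : Type*} {u₁ : α → RoofSpace κ} {u₂ : β → RoofSpace κ}
  {w : γ → RoofSpace κ} {a : κ ↪ α} {b : κ ↪ β} {f₁ : α ↪ γ} {f₂ : β ↪ γ}

theorem symm (h : IsRoofGluing u₁ u₂ w a b f₁ f₂) :
    IsRoofGluing u₂ u₁ (fun x => roofReflection κ (w x)) b a f₂ f₁ where
  roof₁ := h.roof₂
  roof₂ := h.roof₁
  apply₁ j := by simp [h.apply₂]
  apply₂ i := by rw [h.apply₁]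
  base_eq k := (h.base_eq k).symm
  union_range := by rw [Set.union_comm, h.union_range]

theorem exists_of_notMem_range (h : IsRoofGluing u₁ u₂ w a b f₁ f₂) {x : γ}
    (hx : x ∉ Set.range f₁) : ∃ j ∉ Set.range b, f₂ j = x := by
  obtain ⟨j, rfl⟩ := (h.union_range.ge (Set.mem_univ x)).resolve_left hx
  refine ⟨j, ?_, rfl⟩
  rintro ⟨k, rfl⟩
  exact hx ⟨a k, h.base_eq k⟩

theorem map_pos_of_notMem_range [Finite κ] (h : IsRoofGluing u₁ u₂ w a b f₁ f₂)
    {χ : RoofSpace κ →ₗ[ℝ] ℝ} (hne : χ ≠ 0) (hχ' : χ (0, 1) ≤ 0) (hχ : ∀ i, 0 ≤ χ (u₁ i)) {x : γ}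
    (hx : x ∉ Set.range f₁) : 0 < χ (w x) := by
  obtain ⟨j, hj, rfl⟩ := h.exists_of_notMem_range hx
  rw [h.apply₂]
  exact RoofSpace.map_roofReflection_pos (h.roof₁.map_single_nonneg hχ) hne hχ'
    (h.roof₂.fst_pos j hj) (h.roof₂.snd_pos j hj)

theorem isUpperFace_iff [Finite κ] [Finite α] (h : IsRoofGluing u₁ u₂ w a b f₁ f₂) {S : Finset γ} :
    IsUpperFace w S ↔ ∃ T, IsUpperFace u₁ T ∧ T.map f₁ = S := by
  classical
  cases nonempty_fintype α
  constructor
  · rintro ⟨χ, hne, hχ', hχ, hS⟩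
    have hχ₁ : ∀ i, 0 ≤ χ (u₁ i) := fun i => h.apply₁ i ▸ hχ (f₁ i)
    refine ⟨Finset.univ.filter fun i => χ (u₁ i) = 0, ⟨χ, hne, hχ', hχ₁, by simp⟩, ?_⟩
    ext x
    by_cases hx : x ∈ Set.range f₁
    · obtain ⟨i, rfl⟩ := hx
      simp [hS, h.apply₁]
    · rw [hS]
      refine iff_of_false (fun hmem => hx ?_) (h.map_pos_of_notMem_range hne hχ' hχ₁ hx).ne'
      obtain ⟨i, -, rfl⟩ := Finset.mem_map.1 hmem
      exact ⟨i, rfl⟩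
  · rintro ⟨T, ⟨χ, hne, hχ', hχ, hT⟩, rfl⟩
    have hpos := fun x hx => h.map_pos_of_notMem_range hne hχ' hχ (x := x) hx
    refine ⟨χ, hne, hχ', fun x => ?_, fun x => ?_⟩ <;> by_cases hx : x ∈ Set.range f₁
    · obtain ⟨i, rfl⟩ := hx
      exact h.apply₁ i ▸ hχ i
    · exact (hpos x hx).le
    · obtain ⟨i, rfl⟩ := hx
      rw [Finset.mem_map', hT, h.apply₁]
    · refine iff_of_false (fun hmem => hx ?_) (hpos x hx).ne'
      obtain ⟨i, -, rfl⟩ := Finset.mem_map.1 hmem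
      exact ⟨i, rfl⟩

theorem isConeFace_iff [Fintype κ] [Finite α] [Finite β] (h : IsRoofGluing u₁ u₂ w a b f₁ f₂)
    (hw : Submodule.span ℝ (Set.range w) = ⊤) (ha : Set.range a ≠ Set.univ)
    (hb : Set.range b ≠ Set.univ) {S : Finset γ} :
    IsConeFace w S ∧ (∃ x, x ∉ S) ↔
      (∃ T, (IsConeFace u₁ T ∧ ∃ i, i ∉ T) ∧ T ≠ Finset.univ.map a ∧ T.map f₁ = S) ∨
      ∃ T, (IsConeFace u₂ T ∧ ∃ j, j ∉ T) ∧ T ≠ Finset.univ.map b ∧ T.map f₂ = S := by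
  rw [isConeFace_and_exists_notMem_iff_isUpperFace_or hw, h.isUpperFace_iff, h.symm.isUpperFace_iff]
  simp only [h.roof₁.isUpperFace_iff ha, h.roof₂.isUpperFace_iff hb, and_assoc]

theorem span_eq_top (h : IsRoofGluing u₁ u₂ w a b f₁ f₂)
    (hu : Submodule.span ℝ (Set.range u₁) = ⊤) : Submodule.span ℝ (Set.range w) = ⊤ := by
  rw [eq_top_iff, ← hu]
  refine Submodule.span_mono ?_
  rintro _ ⟨i, rfl⟩
  exact ⟨f₁ i, h.apply₁ i⟩

theorem linearIndependent_map (h : IsRoofGluing u₁ u₂ w a b f₁ f₂) {T : Finset α}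
    (hT : LinearIndependent ℝ fun i : T => u₁ i) :
    LinearIndependent ℝ fun x : T.map f₁ => w x := by
  have hcomp : LinearIndepOn ℝ (w ∘ f₁) (T : Set α) := by
    rwa [show w ∘ f₁ = u₁ from funext h.apply₁]
  have himage := hcomp.image_of_comp f₁ w
  rwa [← Finset.coe_map] at himage

theorem isConeFace_singleton [Finite κ] [Nontrivial κ] [Finite α] [Finite β]
    (h : IsRoofGluing u₁ u₂ w a b f₁ f₂) (h₁ : IsSimplicialCone u₁)
    (ha : Set.range a ≠ Set.univ) (hb : Set.range b ≠ Set.univ) (i : α) :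
    IsConeFace w {f₁ i} := by
  cases nonempty_fintype κ
  have hcard := Fintype.one_lt_card (α := κ)
  refine ((h.isConeFace_iff (h.span_eq_top h₁.span_eq_top) ha hb).2 (Or.inl ⟨{i}, ⟨?_, ?_⟩, ?_⟩)).1
  · exact h₁.isConeFace_singleton i
  · exact h₁.exists_notMem_of_card_lt (by simp; omega)
  · exact ⟨fun he => by simp [← Finset.card_univ, ← Finset.card_map a, ← he] at hcard, by simp⟩

theorem isSimplicialCone [Finite κ] [Nontrivial κ] [Finite α] [Finite β]
    (h : IsRoofGluing u₁ u₂ w a b f₁ f₂) (h₁ : IsSimplicialCone u₁) (h₂ : IsSimplicialCone u₂)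
    (ha : Set.range a ≠ Set.univ) (hb : Set.range b ≠ Set.univ) : IsSimplicialCone w where
  span_eq_top := h.span_eq_top h₁.span_eq_top
  isConeFace_singleton x := by
    rcases h.union_range.ge (Set.mem_univ x) with ⟨i, rfl⟩ | ⟨j, rfl⟩
    · exact h.isConeFace_singleton h₁ ha hb i
    · rw [← isConeFace_linearEquiv_iff (roofReflection κ)]
      exact h.symm.isConeFace_singleton h₂ hb ha j
  linearIndependent S hS hne := by
    cases nonempty_fintype κ
    rcases (h.isConeFace_iff (h.span_eq_top h₁.span_eq_top) ha hb).1 ⟨hS, hne⟩ with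
      ⟨T, ⟨hT, hTne⟩, -, rfl⟩ | ⟨T, ⟨hT, hTne⟩, -, rfl⟩
    · exact h.linearIndependent_map (h₁.linearIndependent T hT hTne)
    · exact .of_comp (roofReflection κ).toLinearMap
        (h.symm.linearIndependent_map (h₂.linearIndependent T hT hTne))

end IsRoofGluing

end Roof

section Gluing

/-- The complex `Δ` is obtained by attaching the facet `F₁` of `Δ₁`, with `m` vertices, to the facet
`F₂` of `Δ₂` and removing it. -/
structure IsGluing {α β γ : Type*} [Fintype α] [Fintype β] [Fintype γ] [DecidableEq γ] (m : ℕ)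
    (Δ₁ : Set (Finset α)) (Δ₂ : Set (Finset β)) (Δ : Set (Finset γ)) (f₁ : α ↪ γ) (f₂ : β ↪ γ)
    (F₁ : Finset α) (F₂ : Finset β) : Prop where
  mem₁ : F₁ ∈ Δ₁
  mem₂ : F₂ ∈ Δ₂
  card_eq : F₁.card = m
  map_eq : F₁.map f₁ = F₂.map f₂
  inter : Finset.univ.map f₁ ∩ Finset.univ.map f₂ = F₁.map f₁
  union : Finset.univ.map f₁ ∪ Finset.univ.map f₂ = Finset.univ
  mem_iff : ∀ S : Finset γ, S ∈ Δ ↔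
    (∃ T ∈ Δ₁, T ≠ F₁ ∧ T.map f₁ = S) ∨ (∃ T ∈ Δ₂, T ≠ F₂ ∧ T.map f₂ = S)

namespace IsGluing

variable {α β γ : Type*} [Fintype α] [Fintype β] [Fintype γ] [DecidableEq γ] {m : ℕ}
  {Δ₁ : Set (Finset α)} {Δ₂ : Set (Finset β)} {Δ : Set (Finset γ)} {f₁ : α ↪ γ} {f₂ : β ↪ γ}
  {F₁ : Finset α} {F₂ : Finset β}

theorem card_eq' (h : IsGluing m Δ₁ Δ₂ Δ f₁ f₂ F₁ F₂) : F₂.card = m := by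
  rw [← Finset.card_map f₂, ← h.map_eq, Finset.card_map, h.card_eq]

theorem symm (h : IsGluing m Δ₁ Δ₂ Δ f₁ f₂ F₁ F₂) : IsGluing m Δ₂ Δ₁ Δ f₂ f₁ F₂ F₁ where
  mem₁ := h.mem₂
  mem₂ := h.mem₁
  card_eq := h.card_eq'
  map_eq := h.map_eq.symm
  inter := by rw [Finset.inter_comm, h.inter, h.map_eq]
  union := by rw [Finset.union_comm, h.union]
  mem_iff S := by rw [h.mem_iff, or_comm]

end IsGluing

theorem exists_pushout {κ α β X : Type*} [Finite α] [Finite β] (a : κ ↪ α) (b : κ ↪ β)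
    (u₁ : α → X) (u₂ : β → X) (h : ∀ k, u₁ (a k) = u₂ (b k)) :
    ∃ (n : ℕ) (f₁ : α ↪ Fin n) (f₂ : β ↪ Fin n) (w : Fin n → X), (∀ k, f₁ (a k) = f₂ (b k)) ∧
      Set.range f₁ ∩ Set.range f₂ = Set.range (f₁ ∘ a) ∧
      Set.range f₁ ∪ Set.range f₂ = Set.univ ∧
      (∀ i, w (f₁ i) = u₁ i) ∧ ∀ j, w (f₂ j) = u₂ j := by
  classical
  let e := Finite.equivFin (α ⊕ ↥(Set.range b)ᶜ)
  let g : β ↪ α ⊕ ↥(Set.range b)ᶜ := (Equiv.Set.sumCompl (Set.range b)).symm.toEmbedding.trans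
    (((Equiv.ofInjective b b.injective).symm.toEmbedding.trans a).sumMap (.refl _))
  have hgb : ∀ k, g (b k) = .inl (a k) := fun k => by
    simp [g, Equiv.Set.sumCompl_symm_apply_of_mem, Equiv.ofInjective_symm_apply]
  have hgc : ∀ j (hj : j ∉ Set.range b), g j = .inr ⟨j, hj⟩ := fun j hj => by
    simp [g, Equiv.Set.sumCompl_symm_apply_of_notMem hj]
  refine ⟨_, Function.Embedding.inl.trans e.toEmbedding, g.trans e.toEmbedding,
    Sum.elim u₁ (u₂ ∘ Subtype.val) ∘ e.symm, fun k => by simp [hgb], ?_, ?_, fun i => by simp,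
    fun j => ?_⟩
  · refine Set.Subset.antisymm ?_ ?_
    · rintro _ ⟨⟨i, rfl⟩, j, hj⟩
      have hgj : g j = .inl i := e.injective hj
      by_cases hjb : j ∈ Set.range b
      · obtain ⟨k, rfl⟩ := hjb
        exact ⟨k, by rw [← Sum.inl_injective ((hgb k).symm.trans hgj)]; rfl⟩
      · rw [hgc j hjb] at hgj
        cases hgj
    · rintro _ ⟨k, rfl⟩
      exact ⟨⟨a k, rfl⟩, b k, by simp [hgb]⟩
  · refine Set.eq_univ_of_forall fun x => ?_
    obtain ⟨i | j, rfl⟩ := e.surjective x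
    · exact .inl ⟨i, rfl⟩
    · exact .inr ⟨j, by simp [hgc j j.2]⟩
  · by_cases hj : j ∈ Set.range b
    · obtain ⟨k, rfl⟩ := hj
      simp [hgb, h]
    · simp [hgc j hj]

theorem card_insert_erase {V : Type*} [DecidableEq V] {H : Finset V} {x y : V} (hx : x ∈ H)
    (hy : y ∉ H) : (insert y (H.erase x)).card = H.card := by
  rw [Finset.card_insert_of_notMem fun h => hy (Finset.mem_of_mem_erase h),
    Finset.card_erase_add_one hx]

/-- A finite simplicial complex `Δ` with vertex set `V`, pure with facets of `m` vertices, in which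
every ridge is in two facets, any two facets are connected by a sequence of adjacent ones, and the
facets can be oriented coherently. -/
structure IsOrientablePseudomanifold {V : Type*} [LinearOrder V] (Δ : Set (Finset V)) (m : ℕ) :
    Prop where
  isLowerSet : IsLowerSet Δ
  singleton_mem : ∀ v, {v} ∈ Δ
  exists_facet_superset : ∀ S ∈ Δ, ∃ H ∈ Δ, H.card = m ∧ S ⊆ H
  existsUnique_adjacent : ∀ H ∈ Δ, H.card = m → ∀ x ∈ H, ∃! y, y ∉ H ∧ insert y (H.erase x) ∈ Δ
  mem_of_adjacent_closed : ∀ 𝓢 : Set (Finset V), (∀ H ∈ 𝓢, H ∈ Δ ∧ H.card = m) → 𝓢.Nonempty →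
    (∀ H ∈ 𝓢, ∀ x ∈ H, ∀ y ∉ H, insert y (H.erase x) ∈ Δ → insert y (H.erase x) ∈ 𝓢) →
    ∀ G ∈ Δ, G.card = m → G ∈ 𝓢
  exists_orientation : ∃ ε, IsCoherentOrientation Δ m ε

namespace SimplicialPolytope

variable {d : ℕ}

theorem isConnectedSum_iff {A B P : SimplicialPolytope d} : IsConnectedSum A B P ↔
    ∃ f₁ f₂ F₁ F₂,
      IsGluing d A.boundaryComplex B.boundaryComplex P.boundaryComplex f₁ f₂ F₁ F₂ := by
  constructor
  · rintro ⟨f₁, f₂, F₁, hF₁, F₂, hF₂, hmap, hinter, hunion, hmem⟩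
    exact ⟨f₁, f₂, F₁, F₂, ⟨hF₁.1, hF₂.1, hF₁.2, hmap, hinter, hunion, hmem⟩⟩
  · rintro ⟨f₁, f₂, F₁, F₂, h⟩
    exact ⟨f₁, f₂, F₁, ⟨h.mem₁, h.card_eq⟩, F₂, ⟨h.mem₂, h.card_eq'⟩, h.map_eq, h.inter,
      h.union, h.mem_iff⟩

theorem isOrientablePseudomanifold (P : SimplicialPolytope d) (hd : 1 ≤ d) :
    IsOrientablePseudomanifold P.boundaryComplex d := by
  have hu := P.isSimplicialCone
  have hfinrank : Module.finrank ℝ (ℝ × (Fin d → ℝ)) = d + 1 := by simp [add_comm]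
  have hfacet : ∀ {H}, IsConeFacet (homogenize P.vertex) H ↔ H ∈ P.boundaryComplex ∧ H.card = d :=
    P.mem_facets_iff.symm
  refine ⟨fun S T hTS hS => ?_, fun v => ?_, fun S hS => ?_, fun H hH hcard x hx => ?_,
    fun 𝓢 h𝓢 hne hclosed G hG hcard => ?_, ?_⟩
  · rw [mem_boundaryComplex_iff] at hS ⊢
    exact ⟨hu.mono hS.1 hS.2 hTS, hS.2.imp fun i hi hiT => hi (hTS hiT)⟩
  · exact P.mem_boundaryComplex_iff.2 ⟨hu.isConeFace_singleton v,
      hu.exists_notMem_of_card_lt (by rw [Finset.card_singleton, hfinrank]; omega)⟩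
  · obtain ⟨hS, hne⟩ := P.mem_boundaryComplex_iff.1 hS
    obtain ⟨H, hH, hSH⟩ := hu.exists_isConeFacet_superset hS hne
    exact ⟨H, (hfacet.1 hH).1, (hfacet.1 hH).2, hSH⟩
  · have hiff : ∀ y, y ∉ H ∧ IsConeFacet (homogenize P.vertex) (insert y (H.erase x)) ↔
        y ∉ H ∧ insert y (H.erase x) ∈ P.boundaryComplex := fun y =>
      and_congr_right fun hy => by rw [hfacet, card_insert_erase hx hy, and_iff_left hcard]
    exact (existsUnique_congr hiff).1 (hu.existsUnique_adjacent (hfacet.2 ⟨hH, hcard⟩) hx)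
  · exact hu.mem_of_adjacent_closed (fun H hH => hfacet.2 (h𝓢 H hH)) hne
      (fun H hH x hx y hy hface => hclosed H hH x hx y hy (hfacet.1 hface).1) (hfacet.2 ⟨hG, hcard⟩)
  · obtain ⟨ε, hε⟩ := hu.exists_isCoherentOrientation
    rw [hfinrank, Nat.add_sub_cancel] at hε
    exact ⟨ε, fun R x y hR hx hy hxy hRx hRy => hε R x y hR hx hy hxy
      (P.mem_boundaryComplex_iff.1 hRx).1 (P.mem_boundaryComplex_iff.1 hRy).1⟩

theorem range_ne_univ (P : SimplicialPolytope d) (a : Fin d → Fin P.n) :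
    Set.range a ≠ Set.univ := fun h => by
  have hle := Fintype.card_le_of_surjective a (Set.range_eq_univ.1 h)
  have := P.succ_le_n
  simp only [Fintype.card_fin] at hle
  omega

theorem exists_mem_boundaryComplex_iff_isConeFace {n : ℕ} {E : Type*} [AddCommGroup E] [Module ℝ E]
    {w : Fin n → E} (hw : IsSimplicialCone w) (hE : Module.finrank ℝ E = d + 1) (hd : 1 ≤ d) :
    ∃ (P : SimplicialPolytope d) (hn : P.n = n), ∀ S : Finset (Fin P.n),
      S ∈ P.boundaryComplex ↔ IsConeFace (w ∘ Fin.cast hn) S ∧ ∃ i, i ∉ S := by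
  obtain ⟨φ, hφ, hzero⟩ := hw.isConeFace_empty (by omega)
  have hpos : ∀ i, 0 < φ (w i) := fun i =>
    (hφ i).lt_of_ne' fun h => Finset.notMem_empty i ((hzero i).2 h)
  obtain ⟨i, -⟩ := hw.exists_notMem_of_card_lt (S := ∅) (by rw [Finset.card_empty]; omega)
  obtain ⟨L, hL⟩ := exists_linearEquiv_fst_eq hE fun h : φ = 0 => (hpos i).ne' (by simp [h])
  exact ⟨ofCone (hw.map_linearEquiv L) fun i => (hL _).symm ▸ hpos i, rfl, fun S =>
    (mem_boundaryComplex_ofCone _ _).trans (and_congr_left' (isConeFace_linearEquiv_iff L))⟩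

theorem exists_isGluing (hd : 2 ≤ d) (A B : SimplicialPolytope d) (a : Fin d ↪ Fin A.n)
    (b : Fin d ↪ Fin B.n) (ha : Finset.univ.map a ∈ A.boundaryComplex)
    (hb : Finset.univ.map b ∈ B.boundaryComplex) :
    ∃ (P : SimplicialPolytope d) (f₁ : Fin A.n ↪ Fin P.n) (f₂ : Fin B.n ↪ Fin P.n),
      IsGluing d A.boundaryComplex B.boundaryComplex P.boundaryComplex f₁ f₂
        (Finset.univ.map a) (Finset.univ.map b) ∧ ∀ k, f₁ (a k) = f₂ (b k) := by
  have : Nontrivial (Fin d) := Fin.nontrivial_iff_two_le.2 hd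
  obtain ⟨L₁, hL₁⟩ := A.isSimplicialCone.exists_isRoof (A.mem_facets_iff.1 ⟨ha, by simp⟩)
  obtain ⟨L₂, hL₂⟩ := B.isSimplicialCone.exists_isRoof (B.mem_facets_iff.1 ⟨hb, by simp⟩)
  obtain ⟨n, f₁, f₂, w, hbase, hinter, hunion, hw₁, hw₂⟩ := exists_pushout a b
    (fun i => L₁ (homogenize A.vertex i))
    (fun j => roofReflection (Fin d) (L₂ (homogenize B.vertex j)))
    fun k => by simp [hL₁.base, hL₂.base, roofReflection_apply]
  have hglue : IsRoofGluing (fun i => L₁ (homogenize A.vertex i))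
      (fun j => L₂ (homogenize B.vertex j)) w a b f₁ f₂ := ⟨hL₁, hL₂, hw₁, hw₂, hbase, hunion⟩
  have hw : IsSimplicialCone w := hglue.isSimplicialCone (A.isSimplicialCone.map_linearEquiv L₁)
    (B.isSimplicialCone.map_linearEquiv L₂) (A.range_ne_univ a) (B.range_ne_univ b)
  obtain ⟨P, rfl, hface⟩ :=
    exists_mem_boundaryComplex_iff_isConeFace (d := d) hw (by simp) (by omega)
  refine ⟨P, f₁, f₂, ⟨ha, hb, by simp, ?_, ?_, ?_, fun S => (hface S).trans ?_⟩, hbase⟩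
  · rw [Finset.map_map, Finset.map_map]
    exact congrArg (Finset.map · _) (DFunLike.ext (a.trans f₁) (b.trans f₂) hbase)
  · rw [← Finset.coe_inj]
    simpa [Set.range_comp] using hinter
  · rw [← Finset.coe_inj]
    simpa using hunion
  · rw [Fin.cast_refl, Function.comp_id,
      hglue.isConeFace_iff hw.span_eq_top (A.range_ne_univ a) (B.range_ne_univ b)]
    simp only [isConeFace_linearEquiv_iff, ← mem_boundaryComplex_iff]

end SimplicialPolytope

end Gluing

section Chains

section Restriction

theorem isLowerSet_image_map {V V' : Type*} {Δ : Set (Finset V)} (f : V ↪ V')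
    (hΔ : IsLowerSet Δ) :
    IsLowerSet ((·.map f) '' Δ) := by
  rintro _ S hS ⟨T, hT, rfl⟩
  obtain ⟨T', hT', rfl⟩ := Finset.subset_map_iff.1 hS
  exact ⟨T', hΔ hT' hT, rfl⟩

variable {V : Type*} [DecidableEq V] {Δ : Set (Finset V)}

theorem mem_restrictComplex (hΔ : IsLowerSet Δ) {W G : Finset V} :
    G ∈ restrictComplex Δ W ↔ G ∈ Δ ∧ G ⊆ W := by
  constructor
  · rintro ⟨F, hF, rfl⟩
    exact ⟨hΔ Finset.inter_subset_left hF, Finset.inter_subset_right⟩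
  · rintro ⟨hG, hGW⟩
    exact ⟨G, hG, Finset.inter_eq_left.2 hGW⟩

theorem isLowerSet_restrictComplex (hΔ : IsLowerSet Δ) (W : Finset V) :
    IsLowerSet (restrictComplex Δ W) := fun S T hTS hS => by
  rw [mem_restrictComplex hΔ] at hS ⊢
  exact ⟨hΔ hTS hS.1, Finset.Subset.trans hTS hS.2⟩

theorem restrictComplex_univ [Fintype V] : restrictComplex Δ Finset.univ = Δ := by
  ext S
  simp [restrictComplex]

theorem restrictComplex_image_map {V' : Type*} [DecidableEq V'] (f : V ↪ V') (Δ : Set (Finset V))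
    (W : Finset V') : restrictComplex ((·.map f) '' Δ) W =
      (·.map f) '' restrictComplex Δ (W.preimage f f.injective.injOn) := by
  have hinter : ∀ T : Finset V, T.map f ∩ W = (T ∩ W.preimage f f.injective.injOn).map f := by
    intro T
    ext x
    simp only [Finset.mem_inter, Finset.mem_map, Finset.mem_preimage]
    grind
  simp only [restrictComplex, Set.exists_mem_image, hinter]
  ext S
  simp

end Restriction

section Boundary

variable {K : Type*} [Field K] {V : Type*} [LinearOrder V]

/-- The sign with which `G` occurs in the boundary of `insert v G`. -/
def incidenceSign (K : Type*) [Field K] (G : Finset V) (v : V) : K :=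
  (-1) ^ (G.filter (· < v)).card

theorem incidenceSign_ne_zero (G : Finset V) (v : V) : incidenceSign K G v ≠ 0 :=
  pow_ne_zero _ (neg_ne_zero.2 one_ne_zero)

theorem incidenceSign_mul_self (G : Finset V) (v : V) :
    incidenceSign K G v * incidenceSign K G v = 1 := by
  rw [incidenceSign, ← mul_pow, neg_one_mul, neg_neg, one_pow]

theorem incidenceSign_eq_prod (G : Finset V) (v : V) :
    incidenceSign K G v = ∏ x ∈ G, if x < v then -1 else 1 := by
  rw [incidenceSign, Finset.prod_ite, Finset.prod_const, Finset.prod_const_one, mul_one]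

theorem incidenceSign_insert {G : Finset V} {x : V} (hx : x ∉ G) (y : V) :
    incidenceSign K (insert x G) y = (if x < y then -1 else 1) * incidenceSign K G y := by
  rw [incidenceSign_eq_prod, incidenceSign_eq_prod, Finset.prod_insert hx]

theorem incidenceSign_swap {G : Finset V} {v w : V} (hv : v ∉ G) (hw : w ∉ G) (hvw : v ≠ w) :
    incidenceSign K G v * incidenceSign K (insert v G) w +
      incidenceSign K G w * incidenceSign K (insert w G) v = 0 := by
  rw [incidenceSign_insert hv, incidenceSign_insert hw]
  rcases lt_or_gt_of_ne hvw with h | h <;> rw [if_pos h, if_neg h.not_gt] <;> ring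

variable [Fintype V]

/-- The simplicial boundary map on chains of all dimensions, as functions of all sets of vertices.
This is the ambient space in which the boundaries of several complexes can be compared. -/
def boundaryMap (K : Type*) [Field K] (V : Type*) [LinearOrder V] [Fintype V] :
    (Finset V → K) →ₗ[K] Finset V → K where
  toFun c G := ∑ v ∈ Finset.univ \ G, incidenceSign K G v * c (insert v G)
  map_add' c c' := by
    ext G
    simp only [Pi.add_apply, mul_add, Finset.sum_add_distrib]
  map_smul' r c := by
    ext G
    simp only [Pi.smul_apply, smul_eq_mul, mul_left_comm, ← Finset.mul_sum, RingHom.id_apply]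

theorem boundaryMap_apply (c : Finset V → K) (G : Finset V) :
    boundaryMap K V c G = ∑ v ∈ Finset.univ \ G, incidenceSign K G v * c (insert v G) := rfl

theorem boundaryMap_boundaryMap (c : Finset V → K) : boundaryMap K V (boundaryMap K V c) = 0 := by
  ext G
  simp only [boundaryMap_apply, Finset.mul_sum, ← mul_assoc]
  rw [Finset.sum_sigma', Pi.zero_apply]
  refine Finset.sum_involution (fun p _ => ⟨p.2, p.1⟩) ?_ ?_ ?_ fun _ _ => rfl <;>
    rintro ⟨v, w⟩ hvw <;>
    simp only [Finset.mem_sigma, Finset.mem_sdiff, Finset.mem_univ, true_and,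
      Finset.mem_insert, not_or] at hvw ⊢
  · rw [Finset.insert_comm v w, ← add_mul,
      incidenceSign_swap hvw.1 hvw.2.2 (Ne.symm hvw.2.1), zero_mul]
  · exact fun _ h => hvw.2.1 (Sigma.mk.inj h).1
  · exact ⟨hvw.2.2, Ne.symm hvw.2.1, hvw.1⟩

/-- The cone over a chain with apex `v`, a contracting homotopy of a full simplex. -/
def coneChain (v : V) (c : Finset V → K) (S : Finset V) : K :=
  if v ∈ S then incidenceSign K (S.erase v) v * c (S.erase v) else 0

omit [Fintype V] in
theorem coneChain_insert {v : V} {G : Finset V} (hv : v ∉ G) (c : Finset V → K) :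
    coneChain v c (insert v G) = incidenceSign K G v * c G := by
  rw [coneChain, if_pos (Finset.mem_insert_self v G), Finset.erase_insert hv]

theorem boundaryMap_coneChain {c : Finset V → K} (hc : boundaryMap K V c = 0) (v : V) :
    boundaryMap K V (coneChain v c) = c := by
  ext G
  rw [boundaryMap_apply]
  by_cases hv : v ∈ G
  · obtain ⟨G, hvG, rfl⟩ : ∃ G', v ∉ G' ∧ insert v G' = G :=
      ⟨G.erase v, Finset.notMem_erase v G, Finset.insert_erase hv⟩
    have hterm : ∀ w ∈ Finset.univ \ insert v G, incidenceSign K (insert v G) w *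
        coneChain v c (insert w (insert v G)) =
        -incidenceSign K G v * (incidenceSign K G w * c (insert w G)) := by
      intro w hw
      simp only [Finset.mem_sdiff, Finset.mem_univ, true_and, Finset.mem_insert, not_or] at hw
      have hswap := incidenceSign_swap (K := K) hvG hw.2 (Ne.symm hw.1)
      have hv := incidenceSign_mul_self (K := K) G v
      have hw' := incidenceSign_mul_self (K := K) (insert w G) v
      rw [Finset.insert_comm, coneChain_insert (by simp [hvG, Ne.symm hw.1])]
      linear_combination (incidenceSign K G v * incidenceSign K (insert w G) v * hswap -
        incidenceSign K (insert v G) w * incidenceSign K (insert w G) v * hv -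
        incidenceSign K G v * incidenceSign K G w * hw') * c (insert w G)
    have hcycle := congrFun hc G
    rw [boundaryMap_apply, ← Finset.add_sum_erase _ _ (a := v) (by simpa using hvG),
      ← Finset.sdiff_insert, Pi.zero_apply] at hcycle
    rw [Finset.sum_congr rfl hterm, ← Finset.mul_sum]
    linear_combination c (insert v G) * incidenceSign_mul_self (K := K) G v -
      incidenceSign K G v * hcycle
  · rw [Finset.sum_eq_single_of_mem v (by simp [hv]), coneChain_insert hv, ← mul_assoc,
      incidenceSign_mul_self, one_mul]
    intro w _ hwv
    rw [coneChain, if_neg (by simp [hv, Ne.symm hwv]), mul_zero]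

end Boundary

section SupportedChains

variable {K : Type*} [Field K] {V : Type*} {X Y : Set (Finset V)}

/-- The chains that are combinations of the members of `X`. -/
def supportedChains (K : Type*) [Field K] {V : Type*} (X : Set (Finset V)) :
    Submodule K (Finset V → K) :=
  Submodule.pi Xᶜ fun _ => ⊥

theorem mem_supportedChains {c : Finset V → K} :
    c ∈ supportedChains K X ↔ ∀ S ∉ X, c S = 0 := Iff.rfl

theorem supportedChains_mono (h : X ⊆ Y) : supportedChains K X ≤ supportedChains K Y :=
  fun _ hc S hS => hc S fun hX => hS (h hX)

theorem supportedChains_union :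
    supportedChains K (X ∪ Y) = supportedChains K X ⊔ supportedChains K Y := by
  classical
  refine le_antisymm (fun c hc => ?_) (sup_le (supportedChains_mono Set.subset_union_left)
    (supportedChains_mono Set.subset_union_right))
  rw [← Set.indicator_self_add_compl X c]
  refine Submodule.add_mem_sup (fun S hS => Set.indicator_of_notMem hS c)
    (mem_supportedChains.2 fun S hS => ?_)
  by_cases hX : S ∈ X
  · exact Set.indicator_of_notMem (by simpa using hX) c
  · rw [Set.indicator_of_mem (by simpa using hX), hc S (by simp [hX, hS])]

variable [LinearOrder V] {Δ : Set (Finset V)} {k : ℤ}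

theorem coneChain_mem_supportedChains {U : Finset V} {v : V} (hv : v ∈ U) {c : Finset V → K}
    (hc : c ∈ supportedChains K (facesOfDim (Set.Iic U) (k - 1))) :
    coneChain v c ∈ supportedChains K (facesOfDim (Set.Iic U) k) := by
  refine mem_supportedChains.2 fun S hS => ?_
  rw [coneChain]
  split_ifs with hvS
  · rw [hc, mul_zero]
    rintro ⟨hSU, hcard⟩
    have := Finset.card_erase_add_one hvS
    refine hS ⟨?_, by omega⟩
    rw [← Finset.insert_erase hvS]
    exact Finset.insert_subset hv hSU
  · rfl

variable [Fintype V]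

theorem boundaryMap_mem_supportedChains (hΔ : IsLowerSet Δ) {c : Finset V → K}
    (hc : c ∈ supportedChains K (facesOfDim Δ k)) :
    boundaryMap K V c ∈ supportedChains K (facesOfDim Δ (k - 1)) := by
  intro G hG
  refine Finset.sum_eq_zero fun v hv => ?_
  rw [hc, mul_zero]
  rintro ⟨hmem, hcard⟩
  rw [Finset.card_insert_of_notMem (Finset.mem_sdiff.1 hv).2] at hcard
  exact hG ⟨hΔ (Finset.subset_insert v G) hmem, by omega⟩

theorem exists_boundaryMap_eq_of_simplex {U : Finset V} (hk : 1 ≤ k) {c : Finset V → K}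
    (hc : c ∈ supportedChains K (facesOfDim (Set.Iic U) (k - 1))) (hcycle : boundaryMap K V c = 0) :
    ∃ b ∈ supportedChains K (facesOfDim (Set.Iic U) k), boundaryMap K V b = c := by
  rcases U.eq_empty_or_nonempty with rfl | ⟨v, hv⟩
  · refine ⟨0, zero_mem _, ?_⟩
    rw [map_zero]
    refine (funext fun S => hc S ?_).symm
    rintro ⟨hS, hcard⟩
    rw [Finset.subset_empty.1 hS, Finset.card_empty] at hcard
    omega
  · exact ⟨coneChain v c, coneChain_mem_supportedChains hv hc, boundaryMap_coneChain hcycle v⟩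

end SupportedChains

section Extension

variable {K : Type*} [Field K] {V : Type*} {Δ : Set (Finset V)} {k : ℤ}

/-- A chain of `Δ` as a function of all sets of vertices. -/
noncomputable def chainExtend : SimplicialChain K Δ k →ₗ[K] Finset V → K :=
  Function.ExtendByZero.linearMap K Subtype.val

theorem chainExtend_coe (c : SimplicialChain K Δ k) (S : facesOfDim Δ k) : chainExtend c S = c S :=
  Subtype.val_injective.extend_apply c 0 S

theorem chainExtend_of_notMem (c : SimplicialChain K Δ k) {S : Finset V}
    (h : S ∉ facesOfDim Δ k) : chainExtend c S = 0 :=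
  Function.extend_apply' _ _ _ fun ⟨T, hT⟩ => h (hT ▸ T.2)

theorem chainExtend_mem_supportedChains (c : SimplicialChain K Δ k) :
    chainExtend c ∈ supportedChains K (facesOfDim Δ k) :=
  fun _ hS => chainExtend_of_notMem c hS

theorem chainExtend_single [DecidableEq V] (H : facesOfDim Δ k) (S : Finset V) :
    chainExtend (Pi.single H (1 : K)) S = if S = H then 1 else 0 := by
  by_cases h : S ∈ facesOfDim Δ k
  · rw [chainExtend_coe _ ⟨S, h⟩, Pi.single_apply]
    simp only [Subtype.ext_iff]
  · rw [chainExtend_of_notMem _ h, if_neg]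
    rintro rfl
    exact h H.2

theorem chainExtend_injective :
    Function.Injective (chainExtend : SimplicialChain K Δ k →ₗ[K] Finset V → K) :=
  fun c c' h => funext fun S => by rw [← chainExtend_coe c, h, chainExtend_coe]

theorem range_chainExtend :
    LinearMap.range (chainExtend : SimplicialChain K Δ k →ₗ[K] Finset V → K) =
      supportedChains K (facesOfDim Δ k) := by
  ext c
  constructor
  · rintro ⟨c, rfl⟩
    exact chainExtend_mem_supportedChains c
  · refine fun hc => ⟨fun S => c S, funext fun S => ?_⟩
    by_cases hS : S ∈ facesOfDim Δ k
    · exact chainExtend_coe _ ⟨S, hS⟩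
    · rw [chainExtend_of_notMem _ hS, hc S hS]

variable [LinearOrder V] [Fintype V]

theorem simplicialBoundary_apply {l : ℤ} (c : SimplicialChain K Δ k) (G : facesOfDim Δ l) :
    simplicialBoundary K Δ k l c G = boundaryMap K V (chainExtend c) G := by
  rw [simplicialBoundary, LinearMap.pi_apply, LinearMap.sum_apply, boundaryMap_apply]
  refine Finset.sum_congr rfl fun v _ => ?_
  split_ifs with h
  · rw [chainExtend_coe c ⟨_, h⟩]
    rfl
  · rw [chainExtend_of_notMem c h, mul_zero, LinearMap.zero_apply]

theorem chainExtend_boundary (hΔ : IsLowerSet Δ) (c : SimplicialChain K Δ k) :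
    chainExtend (simplicialBoundary K Δ k (k - 1) c) = boundaryMap K V (chainExtend c) := by
  ext G
  by_cases h : G ∈ facesOfDim Δ (k - 1)
  · rw [chainExtend_coe _ ⟨G, h⟩, simplicialBoundary_apply]
  · rw [chainExtend_of_notMem _ h,
      boundaryMap_mem_supportedChains hΔ (chainExtend_mem_supportedChains c) G h]

theorem mem_simplicialCycles (hΔ : IsLowerSet Δ) {c : SimplicialChain K Δ k} :
    c ∈ simplicialCycles K Δ k ↔ boundaryMap K V (chainExtend c) = 0 := by
  rw [← chainExtend_boundary hΔ, map_eq_zero_iff _ chainExtend_injective]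
  exact LinearMap.mem_ker

theorem simplicialBoundaries_le_simplicialCycles (hΔ : IsLowerSet Δ) :
    simplicialBoundaries K Δ k ≤ simplicialCycles K Δ k := by
  rintro _ ⟨c, rfl⟩
  rw [mem_simplicialCycles hΔ]
  have hboundary := chainExtend_boundary hΔ c
  rw [add_sub_cancel_right] at hboundary
  rw [hboundary, boundaryMap_boundaryMap]

end Extension

end Chains

section Relabeling

variable {K : Type*} [Field K] {V V' : Type*} [LinearOrder V] [LinearOrder V'] (f : V ↪ V')

/-- The sign of the permutation that `f` induces on the positions of the vertices of `T`. -/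
def relabelSign (K : Type*) [Field K] (f : V ↪ V') (T : Finset V) : K :=
  ∏ x ∈ T, ∏ y ∈ T, if x < y ∧ f y < f x then -1 else 1

theorem relabelSign_ne_zero (T : Finset V) : relabelSign K f T ≠ 0 := by
  refine Finset.prod_ne_zero_iff.2 fun x _ => Finset.prod_ne_zero_iff.2 fun y _ => ?_
  split_ifs <;> simp

theorem incidenceSign_map_mul {G : Finset V} {v : V} (hv : v ∉ G) :
    incidenceSign K (G.map f) (f v) * relabelSign K f (insert v G) =
      relabelSign K f G * incidenceSign K G v := by
  have hpair : ∀ x ∈ G, (if f x < f v then -1 else 1 : K) * ((if v < x ∧ f x < f v then -1 else 1) *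
      if x < v ∧ f v < f x then -1 else 1) = if x < v then -1 else 1 := by
    intro x hx
    rcases lt_or_gt_of_ne (ne_of_mem_of_not_mem hx hv) with h | h <;>
      rcases lt_or_gt_of_ne (f.injective.ne (ne_of_mem_of_not_mem hx hv)) with h' | h' <;>
        simp [h, h', h.not_gt, h'.not_gt]
  rw [incidenceSign_eq_prod, incidenceSign_eq_prod, ← Finset.prod_congr rfl hpair, relabelSign,
    relabelSign, Finset.prod_map]
  simp only [Finset.prod_insert hv, Finset.prod_mul_distrib, lt_irrefl, false_and, if_false,
    one_mul]
  ring

/-- The chain map induced by an injection of the vertices that need not be monotone. -/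
noncomputable def relabelChain (K : Type*) [Field K] (f : V ↪ V') :
    (Finset V → K) →ₗ[K] Finset V' → K :=
  Function.ExtendByZero.linearMap K (·.map f) ∘ₗ LinearMap.mulLeft K (relabelSign K f)

theorem relabelChain_map (c : Finset V → K) (T : Finset V) :
    relabelChain K f c (T.map f) = relabelSign K f T * c T :=
  (Finset.map_injective f).extend_apply (relabelSign K f * c) 0 T

theorem relabelChain_of_notMem {c : Finset V → K} {S : Finset V'}
    (hS : S ∉ Set.range (Finset.map f)) : relabelChain K f c S = 0 :=
  Function.extend_apply' _ _ _ hS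

theorem relabelChain_injective : Function.Injective (relabelChain K f) := by
  intro c c' h
  ext T
  refine mul_left_cancel₀ (relabelSign_ne_zero f T : relabelSign K f T ≠ 0) ?_
  rw [← relabelChain_map, h, relabelChain_map]

theorem map_relabelChain_supportedChains (X : Set (Finset V)) :
    (supportedChains K X).map (relabelChain K f) = supportedChains K ((·.map f) '' X) := by
  ext c
  constructor
  · rintro ⟨c, hc, rfl⟩
    refine mem_supportedChains.2 fun S hS => ?_
    by_cases hrange : S ∈ Set.range (Finset.map f)
    · obtain ⟨T, rfl⟩ := hrange
      rw [relabelChain_map, hc T fun hT => hS ⟨T, hT, rfl⟩, mul_zero]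
    · exact relabelChain_of_notMem f hrange
  · refine fun hc => ⟨fun T => (relabelSign K f T)⁻¹ * c (T.map f), ?_, funext fun S => ?_⟩
    · refine mem_supportedChains.2 fun T hT => ?_
      rw [hc, mul_zero]
      rintro ⟨T', hT', hmap⟩
      exact hT (Finset.map_injective f hmap ▸ hT')
    · by_cases hrange : S ∈ Set.range (Finset.map f)
      · obtain ⟨T, rfl⟩ := hrange
        rw [relabelChain_map, mul_inv_cancel_left₀ (relabelSign_ne_zero f T)]
      · rw [relabelChain_of_notMem f hrange, hc]
        rintro ⟨T, -, rfl⟩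
        exact hrange ⟨T, rfl⟩

theorem boundaryMap_relabelChain [Fintype V] [Fintype V'] (c : Finset V → K) :
    boundaryMap K V' (relabelChain K f c) = relabelChain K f (boundaryMap K V c) := by
  ext S
  by_cases hrange : S ∈ Set.range (Finset.map f)
  · obtain ⟨T, rfl⟩ := hrange
    rw [relabelChain_map, boundaryMap_apply, boundaryMap_apply, Finset.mul_sum]
    have hsubset : (Finset.univ \ T).map f ⊆ Finset.univ \ T.map f := by
      intro w hw
      simp only [Finset.mem_map, Finset.mem_sdiff] at hw ⊢
      grind
    rw [← Finset.sum_subset hsubset, Finset.sum_map]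
    · refine Finset.sum_congr rfl fun v hv => ?_
      rw [← Finset.map_insert, relabelChain_map, ← mul_assoc, ← mul_assoc,
        incidenceSign_map_mul f (Finset.mem_sdiff.1 hv).2]
    · intro w hw hwT
      rw [relabelChain_of_notMem, mul_zero]
      rintro ⟨T', hT'⟩
      obtain ⟨v, -, rfl⟩ := Finset.mem_map.1 (hT' ▸ Finset.mem_insert_self w (T.map f))
      exact hwT (by simpa using hw)
  · rw [relabelChain_of_notMem f hrange, boundaryMap_apply]
    refine Finset.sum_eq_zero fun w _ => ?_
    rw [relabelChain_of_notMem, mul_zero]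
    rintro ⟨T, hT⟩
    obtain ⟨T', -, hT'⟩ := Finset.subset_map_iff.1 (hT ▸ Finset.subset_insert w S)
    exact hrange ⟨T', hT'.symm⟩

end Relabeling

section Ranks

variable {K : Type*} [Field K] {V : Type*} [Fintype V] [LinearOrder V] {Δ Γ : Set (Finset V)}
  {k : ℤ}

/-- The rank of the boundary map `C_k → C_{k-1}`. -/
noncomputable def boundaryRank (K : Type*) [Field K] (Δ : Set (Finset V)) (k : ℤ) : ℕ :=
  Module.finrank K (LinearMap.range (simplicialBoundary K Δ k (k - 1)))

theorem boundaryRank_add_finrank_cycles (k : ℤ) :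
    boundaryRank K Δ k + Module.finrank K (simplicialCycles K Δ k) =
      Nat.card (facesOfDim Δ k) := by
  have := Fintype.ofFinite (facesOfDim Δ k)
  rw [boundaryRank, simplicialCycles, LinearMap.finrank_range_add_finrank_ker,
    Module.finrank_fintype_fun_eq_card, Nat.card_eq_fintype_card]

theorem finrank_reducedHomology (hΔ : IsLowerSet Δ) (k : ℤ) :
    (Module.finrank K (ReducedHomology K Δ k) : ℤ) =
      Nat.card (facesOfDim Δ k) - boundaryRank K Δ k - boundaryRank K Δ (k + 1) := by
  have hboundaries : boundaryRank K Δ (k + 1) = Module.finrank K (simplicialBoundaries K Δ k) := by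
    rw [boundaryRank, simplicialBoundaries, add_sub_cancel_right]
  have hquotient := Submodule.finrank_quotient_add_finrank
    ((simplicialBoundaries K Δ k).submoduleOf (simplicialCycles K Δ k))
  rw [(Submodule.submoduleOfEquivOfLe (simplicialBoundaries_le_simplicialCycles hΔ)).finrank_eq,
    ← hboundaries] at hquotient
  change Module.finrank K (ReducedHomology K Δ k) + _ = _ at hquotient
  have hcycles := boundaryRank_add_finrank_cycles (K := K) (Δ := Δ) k
  omega

theorem facesOfDim_isEmpty {V : Type*} {Δ : Set (Finset V)} {k : ℤ}
    (h : ∀ S ∈ Δ, (S.card : ℤ) ≠ k + 1) : IsEmpty (facesOfDim Δ k) :=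
  ⟨fun S => h S.1 S.2.1 S.2.2⟩

theorem boundaryRank_eq_zero_of_source (h : ∀ S ∈ Δ, (S.card : ℤ) ≠ k + 1) :
    boundaryRank K Δ k = 0 := by
  have := facesOfDim_isEmpty h
  rw [boundaryRank, Subsingleton.elim (simplicialBoundary K Δ k (k - 1)) 0, LinearMap.range_zero,
    finrank_bot]

theorem boundaryRank_eq_zero_of_target (h : ∀ S ∈ Δ, (S.card : ℤ) ≠ k) :
    boundaryRank K Δ k = 0 := by
  have := facesOfDim_isEmpty (Δ := Δ) (k := k - 1) (by simpa using h)
  rw [boundaryRank, Subsingleton.elim (simplicialBoundary K Δ k (k - 1)) 0, LinearMap.range_zero,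
    finrank_bot]

theorem boundaryRank_zero (hΔ : IsLowerSet Δ) {v : V} (hv : {v} ∈ Δ) : boundaryRank K Δ 0 = 1 := by
  have hempty : ∅ ∈ facesOfDim Δ (0 - 1) := ⟨hΔ (Finset.empty_subset {v}) hv, by simp⟩
  have hvertex : {v} ∈ facesOfDim Δ 0 := ⟨hv, by simp⟩
  have : Unique (facesOfDim Δ (0 - 1)) := ⟨⟨⟨∅, hempty⟩⟩, fun S => Subtype.ext (by
    simpa using S.2.2)⟩
  refine le_antisymm ?_ (Nat.one_le_iff_ne_zero.2 fun hrank => ?_)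
  · refine (Submodule.finrank_le _).trans ?_
    rw [Module.finrank_fintype_fun_eq_card, Fintype.card_unique]
  · rw [boundaryRank, Submodule.finrank_eq_zero, LinearMap.range_eq_bot] at hrank
    have hboundary := congrFun (LinearMap.congr_fun hrank (Pi.single ⟨{v}, hvertex⟩ 1)) ⟨∅, hempty⟩
    simp [simplicialBoundary_apply, boundaryMap_apply, chainExtend_single, incidenceSign]
      at hboundary

theorem boundaryRank_eq_finrank_map (hΔ : IsLowerSet Δ) (k : ℤ) : boundaryRank K Δ k =
    Module.finrank K ((supportedChains K (facesOfDim Δ k)).map (boundaryMap K V)) := by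
  have hcomm : chainExtend ∘ₗ simplicialBoundary K Δ k (k - 1) = boundaryMap K V ∘ₗ chainExtend :=
    LinearMap.ext fun c => chainExtend_boundary hΔ c
  rw [← range_chainExtend, ← LinearMap.range_comp, ← hcomm, LinearMap.range_comp, boundaryRank,
    (Submodule.equivMapOfInjective _ chainExtend_injective _).finrank_eq]

theorem boundaryRank_congr (hΔ : IsLowerSet Δ) (hΓ : IsLowerSet Γ)
    (h : facesOfDim Δ k = facesOfDim Γ k) : boundaryRank K Δ k = boundaryRank K Γ k := by
  rw [boundaryRank_eq_finrank_map hΔ, boundaryRank_eq_finrank_map hΓ, h]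

theorem facesOfDim_union {V : Type*} (Δ Γ : Set (Finset V)) (k : ℤ) :
    facesOfDim (Δ ∪ Γ) k = facesOfDim Δ k ∪ facesOfDim Γ k := by
  ext S
  exact or_and_right

/-- By the Mayer-Vietoris argument: a common boundary of chains of `Δ` and of `Γ` is a cycle of the
simplex `U`, and so the boundary of a chain of `U`. -/
theorem boundaryRank_union_add (hΔ : IsLowerSet Δ) (hΓ : IsLowerSet Γ) {U : Finset V}
    (hU : Δ ∩ Γ = Set.Iic U) (hk : 1 ≤ k) :
    boundaryRank K (Δ ∪ Γ) k + boundaryRank K (Set.Iic U) k =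
      boundaryRank K Δ k + boundaryRank K Γ k := by
  have hfaces : ∀ {l : ℤ} {S : Finset V}, S ∈ facesOfDim (Set.Iic U) l ↔
      S ∈ facesOfDim Δ l ∧ S ∈ facesOfDim Γ l := by
    intro l S
    rw [← hU]
    exact and_and_right
  have hinf : (supportedChains K (facesOfDim (Set.Iic U) k)).map (boundaryMap K V) =
      (supportedChains K (facesOfDim Δ k)).map (boundaryMap K V) ⊓
        (supportedChains K (facesOfDim Γ k)).map (boundaryMap K V) := by
    refine le_antisymm
      (le_inf (Submodule.map_mono (supportedChains_mono fun S hS => (hfaces.1 hS).1))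
        (Submodule.map_mono (supportedChains_mono fun S hS => (hfaces.1 hS).2))) ?_
    rintro b ⟨⟨c, hc, rfl⟩, c', hc', hcc'⟩
    refine exists_boundaryMap_eq_of_simplex hk (mem_supportedChains.2 fun S hS => ?_)
      (boundaryMap_boundaryMap c)
    rcases not_and_or.1 (mt hfaces.2 hS) with h | h
    · exact boundaryMap_mem_supportedChains hΔ hc S h
    · rw [← hcc']
      exact boundaryMap_mem_supportedChains hΓ hc' S h
  rw [boundaryRank_eq_finrank_map (hΔ.union hΓ), boundaryRank_eq_finrank_map hΔ,
    boundaryRank_eq_finrank_map hΓ, boundaryRank_eq_finrank_map (isLowerSet_Iic U),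
    facesOfDim_union, supportedChains_union, Submodule.map_sup, hinf,
    Submodule.finrank_sup_add_finrank_inf_eq]

theorem facesOfDim_image_map {V V' : Type*} (f : V ↪ V') (Δ : Set (Finset V)) (k : ℤ) :
    facesOfDim ((·.map f) '' Δ) k = (·.map f) '' facesOfDim Δ k := by
  ext S
  constructor
  · rintro ⟨⟨T, hT, rfl⟩, hcard⟩
    exact ⟨T, ⟨hT, by rwa [Finset.card_map] at hcard⟩, rfl⟩
  · rintro ⟨T, ⟨hT, hcard⟩, rfl⟩
    exact ⟨⟨T, hT, rfl⟩, by rwa [Finset.card_map]⟩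

theorem boundaryRank_image_map {V' : Type*} [Fintype V'] [LinearOrder V'] (f : V ↪ V')
    (hΔ : IsLowerSet Δ) (k : ℤ) :
    boundaryRank K ((·.map f) '' Δ) k = boundaryRank K Δ k := by
  have hcomm : boundaryMap K V' ∘ₗ relabelChain K f = relabelChain K f ∘ₗ boundaryMap K V :=
    LinearMap.ext (boundaryMap_relabelChain f)
  rw [boundaryRank_eq_finrank_map (isLowerSet_image_map f hΔ), boundaryRank_eq_finrank_map hΔ,
    facesOfDim_image_map, ← map_relabelChain_supportedChains, ← Submodule.map_comp, hcomm,
    Submodule.map_comp, (Submodule.equivMapOfInjective _ (relabelChain_injective f) _).finrank_eq]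

end Ranks

section TopCycles

namespace IsOrientablePseudomanifold

variable {K : Type*} [Field K] {V : Type*} [LinearOrder V] {Δ : Set (Finset V)} {m : ℕ}

theorem exists_facet_mem (hΔ : IsOrientablePseudomanifold Δ m) (v : V) :
    ∃ H ∈ Δ, H.card = m ∧ v ∈ H := by
  obtain ⟨H, hH, hcard, hv⟩ := hΔ.exists_facet_superset {v} (hΔ.singleton_mem v)
  exact ⟨H, hH, hcard, Finset.singleton_subset_iff.1 hv⟩

theorem exists_insert_mem_pair (hΔ : IsOrientablePseudomanifold Δ m) {G : Finset V} (hG : G ∈ Δ)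
    (hcard : G.card + 1 = m) : ∃ x y, x ≠ y ∧ x ∉ G ∧ y ∉ G ∧ insert x G ∈ Δ ∧ insert y G ∈ Δ ∧
      ∀ v ∉ G, insert v G ∈ Δ → v = x ∨ v = y := by
  obtain ⟨H, hH, hHcard, hGH⟩ := hΔ.exists_facet_superset G hG
  obtain ⟨x, hx, rfl⟩ := Finset.exists_eq_insert_iff.2 ⟨hGH, hcard.trans hHcard.symm⟩
  obtain ⟨y, ⟨hy, hyG⟩, hunique⟩ :=
    hΔ.existsUnique_adjacent _ hH hHcard x (Finset.mem_insert_self x G)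
  rw [Finset.erase_insert hx] at hyG hunique
  rw [Finset.mem_insert, not_or] at hy
  exact ⟨x, y, Ne.symm hy.1, hx, hy.2, hH, hyG, fun v hv hvG =>
    or_iff_not_imp_left.2 fun hvx => hunique v ⟨by simp [hv, hvx], hvG⟩⟩

variable [Fintype V]

theorem boundaryMap_eq_add (hΔ : IsOrientablePseudomanifold Δ m) {c : Finset V → K}
    (hc : c ∈ supportedChains K Δ) {G : Finset V} (hcard : G.card + 1 = m) {x y : V} (hx : x ∉ G)
    (hy : y ∉ G) (hxy : x ≠ y) (hxG : insert x G ∈ Δ) (hyG : insert y G ∈ Δ) :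
    boundaryMap K V c G =
      incidenceSign K G x * c (insert x G) + incidenceSign K G y * c (insert y G) := by
  obtain ⟨x', y', -, -, -, -, -, hpair⟩ :=
    hΔ.exists_insert_mem_pair (hΔ.isLowerSet (Finset.subset_insert x G) hxG) hcard
  rw [boundaryMap_apply, Finset.sum_eq_add x y hxy]
  · intro v hv hvxy
    rw [hc, mul_zero]
    intro hvG
    have := hpair v (Finset.mem_sdiff.1 hv).2 hvG
    have := hpair x hx hxG
    have := hpair y hy hyG
    grind
  · exact fun h => absurd (Finset.mem_sdiff.2 ⟨Finset.mem_univ x, hx⟩) h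
  · exact fun h => absurd (Finset.mem_sdiff.2 ⟨Finset.mem_univ y, hy⟩) h

theorem cycle_eq_zero (hΔ : IsOrientablePseudomanifold Δ m) {c : Finset V → K}
    (hc : c ∈ supportedChains K (facesOfDim Δ (m - 1))) (hcycle : boundaryMap K V c = 0)
    {H : Finset V} (hH : H ∈ Δ) (hcard : H.card = m) (hcH : c H = 0) : c = 0 := by
  let 𝓢 : Set (Finset V) := {H | (H ∈ Δ ∧ H.card = m) ∧ c H = 0}
  have hclosed : ∀ H ∈ 𝓢, ∀ x ∈ H, ∀ y ∉ H, insert y (H.erase x) ∈ Δ →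
      insert y (H.erase x) ∈ 𝓢 := by
    rintro H ⟨⟨hH, hcard⟩, hcH⟩ x hx y hy hyH
    have hboundary := hΔ.boundaryMap_eq_add (supportedChains_mono (fun S hS => hS.1) hc)
      ((Finset.card_erase_add_one hx).trans hcard)
      (Finset.notMem_erase x H) (fun h => hy (Finset.mem_of_mem_erase h))
      (fun h => hy (h ▸ hx)) (by rwa [Finset.insert_erase hx]) hyH
    rw [hcycle, Pi.zero_apply, Finset.insert_erase hx, hcH, mul_zero, zero_add] at hboundary
    exact ⟨⟨hyH, (card_insert_erase hx hy).trans hcard⟩,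
      (mul_eq_zero.1 hboundary.symm).resolve_left (incidenceSign_ne_zero _ _)⟩
  ext G
  by_cases hG : G ∈ facesOfDim Δ (m - 1)
  · exact (hΔ.mem_of_adjacent_closed 𝓢 (fun H h => h.1) ⟨H, ⟨hH, hcard⟩, hcH⟩ hclosed G hG.1
      (by have := hG.2; omega)).2
  · exact hc G hG

theorem cycles_eq_bot (hΔ : IsOrientablePseudomanifold Δ m) {W : Finset V}
    (hW : W ≠ Finset.univ) : simplicialCycles K (restrictComplex Δ W) (m - 1) = ⊥ := by
  obtain ⟨v, hv⟩ := finset_ne_univ_iff.1 hW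
  obtain ⟨H, hH, hcard, hvH⟩ := hΔ.exists_facet_mem v
  have hsubset : facesOfDim (restrictComplex Δ W) (m - 1) ⊆ facesOfDim Δ (m - 1) :=
    fun S hS => ⟨((mem_restrictComplex hΔ.isLowerSet).1 hS.1).1, hS.2⟩
  refine (Submodule.eq_bot_iff _).2 fun z hz => chainExtend_injective ?_
  rw [mem_simplicialCycles (isLowerSet_restrictComplex hΔ.isLowerSet W)] at hz
  rw [map_zero]
  refine hΔ.cycle_eq_zero (supportedChains_mono hsubset (chainExtend_mem_supportedChains z)) hz hH
    hcard (chainExtend_of_notMem z fun h => ?_)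
  exact hv (((mem_restrictComplex hΔ.isLowerSet).1 h.1).2 hvH)

theorem exists_fundamental_cycle (hΔ : IsOrientablePseudomanifold Δ m) :
    ∃ z ∈ simplicialCycles K Δ (m - 1), ∀ H, z H ≠ 0 := by
  obtain ⟨ε, hε⟩ := hΔ.exists_orientation
  refine ⟨fun H => ((ε H : ℤ) : K), LinearMap.mem_ker.2 (funext fun G => ?_), fun H => ?_⟩
  · have hcard : G.1.card + 1 = m := by have := G.2.2; omega
    obtain ⟨x, y, hxy, hx, hy, hxG, hyG, -⟩ := hΔ.exists_insert_mem_pair G.2.1 hcard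
    have hface : ∀ {v}, v ∉ G.1 → insert v G.1 ∈ Δ → insert v G.1 ∈ facesOfDim Δ (m - 1) :=
      fun hv hvG => ⟨hvG, by rw [Finset.card_insert_of_notMem hv]; omega⟩
    rw [simplicialBoundary_apply, hΔ.boundaryMap_eq_add (supportedChains_mono (fun S hS => hS.1)
      (chainExtend_mem_supportedChains _)) hcard hx hy hxy hxG hyG,
      chainExtend_coe _ ⟨_, hface hx hxG⟩, chainExtend_coe _ ⟨_, hface hy hyG⟩]
    have hcancel := congrArg (fun u : ℤˣ => ((u : ℤ) : K)) (hε G x y hcard hx hy hxy hxG hyG)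
    push_cast at hcancel
    simp only [incidenceSign, hcancel, neg_add_cancel, Pi.zero_apply]
  · rcases Int.units_eq_one_or (ε H) with h | h <;> simp [h]

theorem finrank_cycles [Nonempty V] (hΔ : IsOrientablePseudomanifold Δ m) :
    Module.finrank K (simplicialCycles K Δ (m - 1)) = 1 := by
  obtain ⟨z, hz, hne⟩ := hΔ.exists_fundamental_cycle (K := K)
  obtain ⟨H, hH, hcard, -⟩ := hΔ.exists_facet_mem (Classical.arbitrary V)
  let H' : facesOfDim Δ (m - 1) := ⟨H, hH, by omega⟩
  refine (finrank_eq_one_iff_of_nonzero' (⟨z, hz⟩ : simplicialCycles K Δ (m - 1)) ?_).2 fun y =>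
    ⟨y.1 H' / z H', Subtype.ext (sub_eq_zero.1 ?_)⟩
  · exact fun h => hne H' (congrFun (congrArg Subtype.val h) H')
  · have hmem := sub_mem (Submodule.smul_mem _ (y.1 H' / z H') hz) y.2
    refine chainExtend_injective ?_
    rw [map_zero]
    refine hΔ.cycle_eq_zero (chainExtend_mem_supportedChains _)
      ((mem_simplicialCycles hΔ.isLowerSet).1 hmem) hH hcard ?_
    rw [chainExtend_coe _ H']
    simp [hne H']

end IsOrientablePseudomanifold

end TopCycles

section Counting

section PowerSums

variable {R α β γ : Type*} [CommSemiring R] [Fintype α]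

theorem sum_toLeft_mul_pow_card [Fintype β] (g : Finset α → R) (x : R) :
    ∑ W : Finset (α ⊕ β), g W.toLeft * x ^ W.card =
      (∑ U : Finset α, g U * x ^ U.card) * (1 + x) ^ Fintype.card β := by
  have hsum : ∑ W : Finset (α ⊕ β), g W.toLeft * x ^ W.card =
      ∑ p : Finset α × Finset β, g p.1 * x ^ p.1.card * x ^ p.2.card :=
    Fintype.sum_equiv Finset.sumEquiv.toEquiv _ _ fun W => by
      rw [← Finset.card_toLeft_add_card_toRight, pow_add, mul_assoc]
      rfl
  have hpow := Fintype.sum_pow_mul_eq_add_pow β x 1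
  simp only [one_pow, mul_one] at hpow
  rw [hsum, add_comm 1 x, ← hpow, Finset.sum_mul_sum, Fintype.sum_prod_type]

theorem sum_preimage_mul_pow_card [Fintype γ] (f : α ↪ γ) (g : Finset α → R) (x : R) :
    ∑ W : Finset γ, g (W.preimage f f.injective.injOn) * x ^ W.card =
      (∑ U : Finset α, g U * x ^ U.card) * (1 + x) ^ (Fintype.card γ - Fintype.card α) := by
  classical
  let e : α ⊕ ((Set.range f)ᶜ : Set γ) ≃ γ :=
    ((Equiv.ofInjective f f.injective).sumCongr (Equiv.refl _)).trans
      (Equiv.Set.sumCompl (Set.range f))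
  have he : ∀ i, e (Sum.inl i) = f i := fun i => rfl
  have hcard : Fintype.card ((Set.range f)ᶜ : Set γ) = Fintype.card γ - Fintype.card α := by
    rw [Fintype.card_compl_set, Set.card_range_of_injective f.injective]
  rw [← hcard, ← sum_toLeft_mul_pow_card]
  refine (Fintype.sum_equiv e.finsetCongr _ _ fun W => ?_).symm
  have hW : (W.map e.toEmbedding).preimage f f.injective.injOn = W.toLeft := by
    ext i
    rw [Finset.mem_preimage, ← he, Finset.mem_toLeft, ← e.coe_toEmbedding, Finset.mem_map']
  rw [Equiv.finsetCongr_apply, hW, Finset.card_map]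

end PowerSums

section FacesIn

variable {V V' : Type*} [Fintype V] [Fintype V']

open Classical in
/-- The faces with `k` vertices, all of them in `W`. -/
noncomputable def facesIn (Δ : Set (Finset V)) (k : ℕ) (W : Finset V) : Finset (Finset V) :=
  {G | G ∈ Δ ∧ G ⊆ W ∧ G.card = k}

theorem mem_facesIn {Δ : Set (Finset V)} {k : ℕ} {W G : Finset V} :
    G ∈ facesIn Δ k W ↔ G ∈ Δ ∧ G ⊆ W ∧ G.card = k := by
  simp [facesIn]

theorem card_facesIn_union_add_card_facesIn_inter (Δ Γ : Set (Finset V)) (k : ℕ) (W : Finset V) :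
    (facesIn (Δ ∪ Γ) k W).card + (facesIn (Δ ∩ Γ) k W).card =
      (facesIn Δ k W).card + (facesIn Γ k W).card := by
  classical
  have hunion : facesIn (Δ ∪ Γ) k W = facesIn Δ k W ∪ facesIn Γ k W := by
    ext G
    simp only [mem_facesIn, Finset.mem_union, Set.mem_union, or_and_right]
  have hinter : facesIn (Δ ∩ Γ) k W = facesIn Δ k W ∩ facesIn Γ k W := by
    ext G
    simp only [mem_facesIn, Finset.mem_inter, Set.mem_inter_iff]
    tauto
  rw [hunion, hinter, Finset.card_union_add_card_inter]

theorem card_facesIn_diff_singleton_add [DecidableEq V] {Δ : Set (Finset V)} {F : Finset V}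
    (hF : F ∈ Δ) (k : ℕ) (W : Finset V) :
    (facesIn (Δ \ {F}) k W).card + (if F ⊆ W ∧ F.card = k then 1 else 0) =
      (facesIn Δ k W).card := by
  have herase : facesIn (Δ \ {F}) k W = (facesIn Δ k W).erase F := by
    ext G
    simp only [mem_facesIn, Finset.mem_erase, Set.mem_sdiff, Set.mem_singleton_iff]
    tauto
  have hmem : F ∈ facesIn Δ k W ↔ F ⊆ W ∧ F.card = k := by simp [mem_facesIn, hF]
  split_ifs with h
  · rw [herase, Finset.card_erase_add_one (hmem.2 h)]
  · rw [herase, Finset.erase_eq_of_notMem (mt hmem.1 h), add_zero]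

theorem card_facesIn_image_map (f : V ↪ V') (Δ : Set (Finset V)) (k : ℕ) (W : Finset V') :
    (facesIn ((·.map f) '' Δ) k W).card =
      (facesIn Δ k (W.preimage f f.injective.injOn)).card := by
  rw [← Finset.card_map (Finset.mapEmbedding f).toEmbedding]
  congr 1
  ext G
  simp only [mem_facesIn, Finset.mem_map, Set.mem_image, RelEmbedding.coe_toEmbedding,
    Finset.mapEmbedding_apply, ← Finset.map_subset_iff_subset_preimage]
  constructor
  · rintro ⟨⟨T, hT, rfl⟩, hW, hk⟩
    exact ⟨T, ⟨hT, hW, by rwa [Finset.card_map] at hk⟩, rfl⟩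
  · rintro ⟨T, ⟨hT, hW, hk⟩, rfl⟩
    exact ⟨⟨T, hT, rfl⟩, hW, by rwa [Finset.card_map]⟩

theorem card_facesIn_Iic [DecidableEq V] (F W : Finset V) (k : ℕ) :
    (facesIn (Set.Iic F) k W).card = (W ∩ F).card.choose k := by
  rw [← Finset.card_powersetCard]
  congr 1
  ext G
  rw [mem_facesIn, Finset.mem_powersetCard, Finset.subset_inter_iff, Set.mem_Iic]
  tauto

end FacesIn

end Counting

section GluingInvariants

theorem exists_pair_of_map_eq {δ γ : Type*} [DecidableEq δ] [DecidableEq γ] {f : δ ↪ γ}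
    {T : Finset δ} {x y : γ} (hT : T.map f = {x, y}) :
    ∃ i j, f i = x ∧ f j = y ∧ {i, j} = T := by
  obtain ⟨i, -, rfl⟩ := Finset.mem_map.1 (hT ▸ Finset.mem_insert_self x {y} : x ∈ T.map f)
  obtain ⟨j, -, rfl⟩ := Finset.mem_map.1 (hT ▸ (by simp) : y ∈ T.map f)
  exact ⟨i, j, rfl, rfl, Finset.map_injective f (by simp [Finset.map_insert, hT])⟩

theorem exists_embedding_map_univ_eq {V : Type*} {F : Finset V} {m : ℕ} (h : F.card = m) :
    ∃ a : Fin m ↪ V, Finset.univ.map a = F := by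
  refine ⟨(F.equivFinOfCardEq h).symm.toEmbedding.trans (Function.Embedding.subtype _), ?_⟩
  rw [← Finset.map_map, Finset.map_univ_equiv, Finset.univ_eq_attach, Finset.attach_map_val]

namespace IsGluing

variable {α β γ : Type*} [Fintype α] [Fintype β] [Fintype γ] [DecidableEq γ] {m : ℕ}
  {Δ₁ : Set (Finset α)} {Δ₂ : Set (Finset β)} {Δ : Set (Finset γ)} {f₁ : α ↪ γ} {f₂ : β ↪ γ}
  {F₁ : Finset α} {F₂ : Finset β}

theorem mem_of_eq (h : IsGluing m Δ₁ Δ₂ Δ f₁ f₂ F₁ F₂) {i : α} {j : β} (hij : f₁ i = f₂ j) :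
    i ∈ F₁ := by
  have hi : f₁ i ∈ Finset.univ.map f₁ ∩ Finset.univ.map f₂ := by
    rw [Finset.mem_inter]
    exact ⟨by simp, by simp [hij]⟩
  rwa [h.inter, Finset.mem_map'] at hi

theorem card_add (h : IsGluing m Δ₁ Δ₂ Δ f₁ f₂ F₁ F₂) :
    Fintype.card γ + m = Fintype.card α + Fintype.card β := by
  have hcard := Finset.card_union_add_card_inter (Finset.univ.map f₁) (Finset.univ.map f₂)
  rwa [h.union, h.inter, Finset.card_map, Finset.card_map, Finset.card_map, h.card_eq,
    Finset.card_univ, Finset.card_univ, Finset.card_univ] at hcard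

theorem eq_diff (h : IsGluing m Δ₁ Δ₂ Δ f₁ f₂ F₁ F₂) :
    Δ = ((·.map f₁) '' Δ₁ ∪ (·.map f₂) '' Δ₂) \ {F₁.map f₁} := by
  ext S
  simp only [h.mem_iff, Set.mem_sdiff, Set.mem_union, Set.mem_image, Set.mem_singleton_iff]
  constructor
  · rintro (⟨T, hT, hTF, rfl⟩ | ⟨T, hT, hTF, rfl⟩)
    · exact ⟨Or.inl ⟨T, hT, rfl⟩, fun hF => hTF (Finset.map_injective f₁ hF)⟩
    · exact ⟨Or.inr ⟨T, hT, rfl⟩, fun hF => hTF (Finset.map_injective f₂ (hF.trans h.map_eq))⟩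
  · rintro ⟨⟨T, hT, rfl⟩ | ⟨T, hT, rfl⟩, hF⟩
    · exact Or.inl ⟨T, hT, fun hTF => hF (hTF ▸ rfl), rfl⟩
    · exact Or.inr ⟨T, hT, fun hTF => hF (hTF ▸ h.map_eq.symm), rfl⟩

theorem image_inter_image (h : IsGluing m Δ₁ Δ₂ Δ f₁ f₂ F₁ F₂) (h₁ : IsLowerSet Δ₁)
    (h₂ : IsLowerSet Δ₂) :
    (·.map f₁) '' Δ₁ ∩ (·.map f₂) '' Δ₂ = Set.Iic (F₁.map f₁) := by
  ext G
  constructor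
  · rintro ⟨⟨T, -, rfl⟩, T', -, hTT'⟩
    rw [Set.mem_Iic, ← h.inter]
    exact Finset.subset_inter (Finset.map_subset_map.2 (Finset.subset_univ _))
      (hTT' ▸ Finset.map_subset_map.2 (Finset.subset_univ _))
  · intro hG
    obtain ⟨T, hT, rfl⟩ := Finset.subset_map_iff.1 hG
    obtain ⟨T', hT', hTT'⟩ := Finset.subset_map_iff.1 (h.map_eq ▸ hG : T.map f₁ ⊆ F₂.map f₂)
    exact ⟨⟨T, h₁ hT h.mem₁, rfl⟩, T', h₂ hT' h.mem₂, hTT'.symm⟩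

theorem card_facesIn (h : IsGluing m Δ₁ Δ₂ Δ f₁ f₂ F₁ F₂) (h₁ : IsLowerSet Δ₁)
    (h₂ : IsLowerSet Δ₂) (k : ℕ) (W : Finset γ) :
    ((facesIn Δ k W).card : ℤ) = (facesIn Δ₁ k (W.preimage f₁ f₁.injective.injOn)).card +
      (facesIn Δ₂ k (W.preimage f₂ f₂.injective.injOn)).card -
      ((W ∩ F₁.map f₁).card.choose k + if F₁.map f₁ ⊆ W ∧ m = k then 1 else 0) := by
  have hF : F₁.map f₁ ∈ (·.map f₁) '' Δ₁ ∪ (·.map f₂) '' Δ₂ := Or.inl ⟨F₁, h.mem₁, rfl⟩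
  have hdiff := card_facesIn_diff_singleton_add hF k W
  have hunion := card_facesIn_union_add_card_facesIn_inter ((·.map f₁) '' Δ₁)
    ((·.map f₂) '' Δ₂) k W
  rw [← h.eq_diff, Finset.card_map, h.card_eq] at hdiff
  rw [h.image_inter_image h₁ h₂, card_facesIn_Iic, card_facesIn_image_map,
    card_facesIn_image_map] at hunion
  split_ifs at hdiff ⊢ <;> omega

theorem pair_mem [DecidableEq α] (h : IsGluing m Δ₁ Δ₂ Δ f₁ f₂ F₁ F₂) (hm : 3 ≤ m) {i j : α}
    (hij : {i, j} ∈ Δ₁) : {f₁ i, f₁ j} ∈ Δ := by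
  refine (h.mem_iff _).2 (Or.inl ⟨_, hij, fun hF => ?_, by simp [Finset.map_insert]⟩)
  have hcard := Finset.card_le_two (a := i) (b := j)
  rw [hF, h.card_eq] at hcard
  omega

variable [DecidableEq α] [DecidableEq β]

theorem exists_of_pair_mem (h : IsGluing m Δ₁ Δ₂ Δ f₁ f₂ F₁ F₂) {x y : γ}
    (hxy : {x, y} ∈ Δ) : (∃ i j, f₁ i = x ∧ f₁ j = y ∧ {i, j} ∈ Δ₁) ∨
      ∃ i j, f₂ i = x ∧ f₂ j = y ∧ {i, j} ∈ Δ₂ := by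
  rcases (h.mem_iff _).1 hxy with ⟨T, hT, -, hTe⟩ | ⟨T, hT, -, hTe⟩
  · obtain ⟨i, j, hi, hj, rfl⟩ := exists_pair_of_map_eq hTe
    exact Or.inl ⟨i, j, hi, hj, hT⟩
  · obtain ⟨i, j, hi, hj, rfl⟩ := exists_pair_of_map_eq hTe
    exact Or.inr ⟨i, j, hi, hj, hT⟩

end IsGluing

theorem IsGluing.boundaryRank_restrictComplex_add {K α β γ : Type*} [Field K] [Fintype α]
    [Fintype β] [Fintype γ] [LinearOrder α] [LinearOrder β] [LinearOrder γ] {m : ℕ}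
    {Δ₁ : Set (Finset α)} {Δ₂ : Set (Finset β)} {Δ : Set (Finset γ)} {f₁ : α ↪ γ} {f₂ : β ↪ γ}
    {F₁ : Finset α} {F₂ : Finset β} (h : IsGluing m Δ₁ Δ₂ Δ f₁ f₂ F₁ F₂) (h₁ : IsLowerSet Δ₁)
    (h₂ : IsLowerSet Δ₂) (hΔ : IsLowerSet Δ) {k : ℤ} (hk : 1 ≤ k) (hkm : k + 1 ≠ m)
    (W : Finset γ) :
    boundaryRank K (restrictComplex Δ W) k + boundaryRank K (Set.Iic (W ∩ F₁.map f₁)) k =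
      boundaryRank K (restrictComplex Δ₁ (W.preimage f₁ f₁.injective.injOn)) k +
        boundaryRank K (restrictComplex Δ₂ (W.preimage f₂ f₂.injective.injOn)) k := by
  have hX₁ := isLowerSet_image_map f₁ h₁
  have hX₂ := isLowerSet_image_map f₂ h₂
  have hY₁ := isLowerSet_restrictComplex hX₁ W
  have hY₂ := isLowerSet_restrictComplex hX₂ W
  have hinter : restrictComplex ((·.map f₁) '' Δ₁) W ∩ restrictComplex ((·.map f₂) '' Δ₂) W =
      Set.Iic (W ∩ F₁.map f₁) := by
    ext S
    have hS : S ∈ (·.map f₁) '' Δ₁ ∧ S ∈ (·.map f₂) '' Δ₂ ↔ S ⊆ F₁.map f₁ :=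
      Set.ext_iff.1 (h.image_inter_image h₁ h₂) S
    have hIic : S ∈ Set.Iic (W ∩ F₁.map f₁) ↔ S ⊆ W ∧ S ⊆ F₁.map f₁ := Finset.subset_inter_iff
    rw [Set.mem_inter_iff, mem_restrictComplex hX₁, mem_restrictComplex hX₂, hIic, ← hS]
    tauto
  have hfaces : facesOfDim (restrictComplex Δ W) k = facesOfDim
      (restrictComplex ((·.map f₁) '' Δ₁) W ∪ restrictComplex ((·.map f₂) '' Δ₂) W) k := by
    ext S
    have hcard : (S.card : ℤ) = k + 1 → S ≠ F₁.map f₁ := by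
      rintro hS rfl
      rw [Finset.card_map, h.card_eq] at hS
      exact hkm hS.symm
    have hS := Set.ext_iff.1 h.eq_diff S
    rw [Set.mem_sdiff, Set.mem_union, Set.mem_singleton_iff] at hS
    simp only [facesOfDim, Set.mem_ofPred_eq, Set.mem_union, mem_restrictComplex hΔ,
      mem_restrictComplex hX₁, mem_restrictComplex hX₂, hS]
    tauto
  rw [boundaryRank_congr (isLowerSet_restrictComplex hΔ W) (hY₁.union hY₂) hfaces,
    boundaryRank_union_add hY₁ hY₂ hinter hk, restrictComplex_image_map, restrictComplex_image_map,
    boundaryRank_image_map f₁ (isLowerSet_restrictComplex h₁ _),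
    boundaryRank_image_map f₂ (isLowerSet_restrictComplex h₂ _)]

end GluingInvariants

section AdditiveWeights

open Polynomial

theorem map_preimage_eq_inter {α β : Type*} [Fintype α] [DecidableEq β] (f : α ↪ β)
    (W : Finset β) : (W.preimage f f.injective.injOn).map f = W ∩ Finset.univ.map f := by
  ext x
  simp only [Finset.mem_map, Finset.mem_preimage, Finset.mem_inter, Finset.mem_univ, true_and]
  grind

theorem Iic_map {α β : Type*} (f : α ↪ β) (U : Finset α) :
    Set.Iic (U.map f) = (·.map f) '' Set.Iic U := by
  ext S
  simpa only [Set.mem_Iic, Set.mem_image, eq_comm] using Finset.subset_map_iff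

namespace SimplicialPolytope

variable {d : ℕ}

/-- An integer weight `w` of the induced subcomplexes of all polytopes is additive with correction
`g` if it is an isomorphism invariant, and additive under connected sums up to a correction that
depends only on the part inside the common facet, whose vertices are labelled by `Fin d`. -/
structure IsAdditiveWeight (w : ∀ P : SimplicialPolytope d, Finset (Fin P.n) → ℤ)
    (g : Finset (Fin d) → ℤ) : Prop where
  glue : ∀ {A B P : SimplicialPolytope d} {f₁ : Fin A.n ↪ Fin P.n} {f₂ : Fin B.n ↪ Fin P.n}
    {F₁ : Finset (Fin A.n)} {F₂ : Finset (Fin B.n)},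
    IsGluing d A.boundaryComplex B.boundaryComplex P.boundaryComplex f₁ f₂ F₁ F₂ →
    ∀ {c : Fin d ↪ Fin P.n}, Finset.univ.map c = F₁.map f₁ → ∀ W : Finset (Fin P.n),
    w P W = w A (W.preimage f₁ f₁.injective.injOn) + w B (W.preimage f₂ f₂.injective.injOn) -
      g (W.preimage c c.injective.injOn)
  iso : ∀ {Q P : SimplicialPolytope d} (e : Fin Q.n ≃ Fin P.n),
    (∀ S, S ∈ Q.boundaryComplex ↔ S.map e.toEmbedding ∈ P.boundaryComplex) →
    ∀ W, w P (W.map e.toEmbedding) = w Q W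

/-- The generating polynomial of a weight of the subsets of `V`, by the size of the subset. -/
noncomputable def weightPolynomial {V : Type*} [Fintype V] (w : Finset V → ℤ) : ℚ[X] :=
  ∑ W : Finset V, C (w W : ℚ) * X ^ W.card

theorem coeff_weightPolynomial {V : Type*} [Fintype V] (w : Finset V → ℤ) (j : ℕ) :
    (weightPolynomial w).coeff j =
      ((∑ W ∈ (Finset.univ : Finset V).powersetCard j, w W : ℤ) : ℚ) := by
  rw [weightPolynomial, finsetSum_coeff, Finset.powersetCard_eq_filter, Finset.sum_filter,
    Finset.powerset_univ]
  push_cast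
  refine Finset.sum_congr rfl fun W _ => ?_
  simp only [coeff_C_mul, coeff_X_pow, mul_ite, mul_one, mul_zero, eq_comm]

/-- The weight polynomial normalized so that it becomes additive under connected sums. -/
noncomputable def weightInvariant (w : ∀ P : SimplicialPolytope d, Finset (Fin P.n) → ℤ)
    (g : Finset (Fin d) → ℤ) (P : SimplicialPolytope d) : RatFunc ℚ :=
  algebraMap ℚ[X] (RatFunc ℚ) (weightPolynomial (w P)) /
      algebraMap ℚ[X] (RatFunc ℚ) (1 + X) ^ (P.n - d) -
    algebraMap ℚ[X] (RatFunc ℚ) (weightPolynomial g)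

theorem algebraMap_one_add_X_ne_zero : algebraMap ℚ[X] (RatFunc ℚ) (1 + X) ≠ 0 :=
  RatFunc.algebraMap_ne_zero (by simpa [add_comm] using X_add_C_ne_zero (1 : ℚ))

theorem IsConnectedSum.n_sub_eq {A B P : SimplicialPolytope d} (h : IsConnectedSum A B P) :
    P.n - d = (A.n - d) + (B.n - d) := by
  obtain ⟨f₁, f₂, F₁, F₂, h⟩ := isConnectedSum_iff.1 h
  have hcard := h.card_add
  simp only [Fintype.card_fin] at hcard
  have hA := A.succ_le_n
  have hB := B.succ_le_n
  omega

theorem Iso.n_eq {e : ℕ} {P : SimplicialPolytope d} {Q : SimplicialPolytope e} (h : P.Iso Q) :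
    P.n = Q.n := by
  obtain ⟨f, -⟩ := h
  simpa using Fintype.card_congr f

theorem IsIteratedConnectedSum.n_sub_eq {s : Multiset (SimplicialPolytope d)}
    {P : SimplicialPolytope d} (h : IsIteratedConnectedSum s P) :
    P.n - d = (s.map fun Q => Q.n - d).sum := by
  induction h with
  | single h => simp [h.n_eq]
  | sum hA hB hP ihA ihB =>
    rw [hP.n_sub_eq, ihA, ihB, Multiset.map_add, Multiset.sum_add]

theorem IsIteratedConnectedSum.n_eq {s : Multiset (SimplicialPolytope d)}
    {P Q : SimplicialPolytope d} (hP : IsIteratedConnectedSum s P)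
    (hQ : IsIteratedConnectedSum s Q) : P.n = Q.n := by
  have hn := hP.n_sub_eq.trans hQ.n_sub_eq.symm
  have := P.succ_le_n
  have := Q.succ_le_n
  omega

namespace IsAdditiveWeight

variable {w : ∀ P : SimplicialPolytope d, Finset (Fin P.n) → ℤ} {g : Finset (Fin d) → ℤ}

theorem weightPolynomial_glue (hw : IsAdditiveWeight w g) {A B P : SimplicialPolytope d}
    (h : IsConnectedSum A B P) :
    weightPolynomial (w P) = weightPolynomial (w A) * (1 + X) ^ (B.n - d) +
      weightPolynomial (w B) * (1 + X) ^ (A.n - d) -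
      weightPolynomial g * (1 + X) ^ (P.n - d) := by
  obtain ⟨f₁, f₂, F₁, F₂, h⟩ := isConnectedSum_iff.1 h
  obtain ⟨c, hc⟩ := exists_embedding_map_univ_eq ((Finset.card_map f₁).trans h.card_eq)
  have hcard := h.card_add
  have hA := A.succ_le_n
  have hB := B.succ_le_n
  have hsumA := sum_preimage_mul_pow_card f₁ (fun U => C (w A U : ℚ)) (X : ℚ[X])
  have hsumB := sum_preimage_mul_pow_card f₂ (fun U => C (w B U : ℚ)) (X : ℚ[X])
  have hsumg := sum_preimage_mul_pow_card c (fun U => C (g U : ℚ)) (X : ℚ[X])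
  simp only [Fintype.card_fin] at hcard hsumA hsumB hsumg
  rw [show P.n - A.n = B.n - d by omega] at hsumA
  rw [show P.n - B.n = A.n - d by omega] at hsumB
  simp only [weightPolynomial]
  rw [← hsumA, ← hsumB, ← hsumg, ← Finset.sum_add_distrib, ← Finset.sum_sub_distrib]
  refine Finset.sum_congr rfl fun W _ => ?_
  rw [hw.glue h hc W, Int.cast_sub, Int.cast_add, C_sub, C_add, sub_mul, add_mul]

theorem weightPolynomial_iso (hw : IsAdditiveWeight w g) {Q P : SimplicialPolytope d}
    (h : Q.Iso P) : weightPolynomial (w Q) = weightPolynomial (w P) := by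
  obtain ⟨e, he⟩ := h
  refine Fintype.sum_equiv e.finsetCongr _ _ fun W => ?_
  rw [Equiv.finsetCongr_apply, hw.iso e he W, Finset.card_map]

theorem weightInvariant_eq_sum (hw : IsAdditiveWeight w g) {s : Multiset (SimplicialPolytope d)}
    {P : SimplicialPolytope d} (h : IsIteratedConnectedSum s P) :
    weightInvariant w g P = (s.map (weightInvariant w g)).sum := by
  induction h with
  | single h =>
    have hn := congrArg (· - d) h.n_eq
    rw [Multiset.map_singleton, Multiset.sum_singleton, weightInvariant, weightInvariant,
      hw.weightPolynomial_iso h, ← hn]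
  | sum _ _ hP ihA ihB =>
    have hX := algebraMap_one_add_X_ne_zero
    rw [Multiset.map_add, Multiset.sum_add, ← ihA, ← ihB, weightInvariant, weightInvariant,
      weightInvariant, hw.weightPolynomial_glue hP, hP.n_sub_eq, map_sub, map_add, map_mul,
      map_mul, map_mul, map_pow, map_pow, map_pow, pow_add]
    field_simp
    ring

theorem sum_powersetCard_eq (hw : IsAdditiveWeight w g) {s : Multiset (SimplicialPolytope d)}
    {P Q : SimplicialPolytope d} (hP : IsIteratedConnectedSum s P)
    (hQ : IsIteratedConnectedSum s Q) (j : ℕ) :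
    ∑ W ∈ (Finset.univ : Finset (Fin P.n)).powersetCard j, w P W =
      ∑ W ∈ (Finset.univ : Finset (Fin Q.n)).powersetCard j, w Q W := by
  have hinv := (hw.weightInvariant_eq_sum hP).trans (hw.weightInvariant_eq_sum hQ).symm
  rw [weightInvariant, weightInvariant, hP.n_sub_eq.trans hQ.n_sub_eq.symm, sub_left_inj,
    div_left_inj' (pow_ne_zero _ algebraMap_one_add_X_ne_zero)] at hinv
  have hcoeff := congrArg (coeff · j) (RatFunc.algebraMap_injective ℚ hinv)
  simpa only [coeff_weightPolynomial, Int.cast_inj] using hcoeff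

end IsAdditiveWeight

theorem image_map_boundaryComplex {Q P : SimplicialPolytope d} {e : Fin Q.n ≃ Fin P.n}
    (he : ∀ S, S ∈ Q.boundaryComplex ↔ S.map e.toEmbedding ∈ P.boundaryComplex) :
    (·.map e.toEmbedding) '' Q.boundaryComplex = P.boundaryComplex := by
  ext S
  obtain ⟨T, rfl⟩ := e.finsetCongr.surjective S
  simp only [Equiv.finsetCongr_apply, Set.mem_image, Finset.map_inj, exists_eq_right, he]

theorem isAdditiveWeight_card_facesIn (hd : 1 ≤ d) (k : ℕ) :
    IsAdditiveWeight (fun P : SimplicialPolytope d => fun W =>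
      ((facesIn P.boundaryComplex k W).card : ℤ))
      (fun U => U.card.choose k + if U = Finset.univ ∧ d = k then 1 else 0) where
  glue {A B P f₁ f₂ F₁ F₂} h c hc W := by
    have huniv : Finset.univ.map c ⊆ W ↔ W.preimage c c.injective.injOn = Finset.univ := by
      rw [Finset.map_subset_iff_subset_preimage, Finset.univ_subset_iff]
    simp only [h.card_facesIn (isOrientablePseudomanifold _ hd).isLowerSet
      (isOrientablePseudomanifold _ hd).isLowerSet k W, ← hc, huniv, ← map_preimage_eq_inter,
      Finset.card_map]
  iso {Q P} e he W := by
    rw [← image_map_boundaryComplex he, card_facesIn_image_map, Finset.preimage_map]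

theorem isAdditiveWeight_boundaryRank (K : Type*) [Field K] (hd : 1 ≤ d) {k : ℤ} (hk : 1 ≤ k)
    (hkd : k + 1 ≠ d) :
    IsAdditiveWeight (fun P : SimplicialPolytope d => fun W =>
      (boundaryRank K (restrictComplex P.boundaryComplex W) k : ℤ))
      (fun U => boundaryRank K (Set.Iic U) k) where
  glue {A B P f₁ f₂ F₁ F₂} h c hc W := by
    have hadd := h.boundaryRank_restrictComplex_add (K := K)
      (isOrientablePseudomanifold _ hd).isLowerSet (isOrientablePseudomanifold _ hd).isLowerSet
      (isOrientablePseudomanifold _ hd).isLowerSet hk hkd W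
    rw [← hc, ← map_preimage_eq_inter, Iic_map, boundaryRank_image_map c (isLowerSet_Iic _)] at hadd
    lia
  iso {Q P} e he W := by
    rw [← image_map_boundaryComplex he, restrictComplex_image_map, Finset.preimage_map,
      boundaryRank_image_map _
        (isLowerSet_restrictComplex (isOrientablePseudomanifold _ hd).isLowerSet W)]

end SimplicialPolytope

end AdditiveWeights

section Betti

theorem natCard_facesOfDim_restrictComplex {V : Type*} [Fintype V] [DecidableEq V]
    {Δ : Set (Finset V)} (hΔ : IsLowerSet Δ) (W : Finset V) {k : ℤ} {m : ℕ} (hm : k + 1 = m) :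
    Nat.card (facesOfDim (restrictComplex Δ W) k) = (facesIn Δ m W).card := by
  rw [← Set.ncard_coe_finset, Nat.card_coe_set_eq]
  congr 1
  ext G
  simp only [facesOfDim, Set.mem_ofPred_eq, mem_restrictComplex hΔ, Finset.mem_coe, mem_facesIn, hm,
    Nat.cast_inj, and_assoc]

theorem sum_powersetCard_card {α M : Type*} [AddCommMonoid M] (s : Finset α) (j : ℕ) (f : ℕ → M) :
    ∑ W ∈ s.powersetCard j, f W.card = s.card.choose j • f j := by
  rw [Finset.sum_congr rfl fun W hW => congrArg f (Finset.mem_powersetCard.1 hW).2,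
    Finset.sum_const, Finset.card_powersetCard]

namespace IsOrientablePseudomanifold

variable {K : Type*} [Field K] {V : Type*} [Fintype V] [LinearOrder V] {Δ : Set (Finset V)}
  {m : ℕ}

theorem boundaryRank_restrictComplex_zero (hΔ : IsOrientablePseudomanifold Δ m) (W : Finset V) :
    boundaryRank K (restrictComplex Δ W) 0 = if W.card = 0 then 0 else 1 := by
  split_ifs with hW
  · rw [Finset.card_eq_zero] at hW
    subst hW
    refine boundaryRank_eq_zero_of_source fun S hS => ?_
    rw [Finset.subset_empty.1 ((mem_restrictComplex hΔ.isLowerSet).1 hS).2]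
    simp
  · obtain ⟨v, hv⟩ := Finset.card_ne_zero.1 hW
    exact boundaryRank_zero (isLowerSet_restrictComplex hΔ.isLowerSet W)
      ((mem_restrictComplex hΔ.isLowerSet).2
        ⟨hΔ.singleton_mem v, Finset.singleton_subset_iff.2 hv⟩)

theorem boundaryRank_restrictComplex_top [Nonempty V] (hΔ : IsOrientablePseudomanifold Δ m)
    (W : Finset V) :
    boundaryRank K (restrictComplex Δ W) (m - 1) + (if W.card = Fintype.card V then 1 else 0) =
      (facesIn Δ m W).card := by
  have hrank := boundaryRank_add_finrank_cycles (K := K) (Δ := restrictComplex Δ W) (m - 1)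
  rw [natCard_facesOfDim_restrictComplex hΔ.isLowerSet W (sub_add_cancel (m : ℤ) 1)] at hrank
  rw [← hrank, add_right_inj]
  simp only [Finset.card_eq_iff_eq_univ]
  split_ifs with hW
  · rw [hW, restrictComplex_univ, hΔ.finrank_cycles]
  · rw [hΔ.cycles_eq_bot hW, finrank_bot]

end IsOrientablePseudomanifold

namespace SimplicialPolytope

theorem IsIteratedConnectedSum.sum_natCard_facesOfDim_eq {d : ℕ} (hd : 1 ≤ d)
    {s : Multiset (SimplicialPolytope d)} {P Q : SimplicialPolytope d}
    (hP : IsIteratedConnectedSum s P) (hQ : IsIteratedConnectedSum s Q) (j : ℕ) (k : ℤ) :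
    ∑ W ∈ (Finset.univ : Finset (Fin P.n)).powersetCard j,
        (Nat.card (facesOfDim (restrictComplex P.boundaryComplex W) k) : ℤ) =
      ∑ W ∈ (Finset.univ : Finset (Fin Q.n)).powersetCard j,
        (Nat.card (facesOfDim (restrictComplex Q.boundaryComplex W) k) : ℤ) := by
  obtain hk | hk := lt_or_ge (k + 1) 0
  · have hempty : ∀ {V : Type} (Δ : Set (Finset V)), Nat.card (facesOfDim Δ k) = 0 := fun Δ =>
      have := facesOfDim_isEmpty (Δ := Δ) (k := k) fun S _ => by lia
      Nat.card_of_isEmpty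
    simp only [hempty, Nat.cast_zero, Finset.sum_const_zero]
  · obtain ⟨m, hm⟩ := Int.eq_ofNat_of_zero_le hk
    simp only [natCard_facesOfDim_restrictComplex (isOrientablePseudomanifold _ hd).isLowerSet _ hm]
    exact (isAdditiveWeight_card_facesIn hd m).sum_powersetCard_eq hP hQ j

theorem IsIteratedConnectedSum.sum_boundaryRank_eq {d : ℕ} (hd : 1 ≤ d) (K : Type*) [Field K]
    {s : Multiset (SimplicialPolytope d)} {P Q : SimplicialPolytope d}
    (hP : IsIteratedConnectedSum s P) (hQ : IsIteratedConnectedSum s Q) (j : ℕ) (k : ℤ) :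
    ∑ W ∈ (Finset.univ : Finset (Fin P.n)).powersetCard j,
        (boundaryRank K (restrictComplex P.boundaryComplex W) k : ℤ) =
      ∑ W ∈ (Finset.univ : Finset (Fin Q.n)).powersetCard j,
        (boundaryRank K (restrictComplex Q.boundaryComplex W) k : ℤ) := by
  have hpseudo (R : SimplicialPolytope d) := R.isOrientablePseudomanifold hd
  have hn := hP.n_eq hQ
  obtain hk | rfl | hk : k < 0 ∨ k = 0 ∨ 1 ≤ k := by lia
  · have hzero {n : ℕ} (Δ : Set (Finset (Fin n))) : boundaryRank K Δ k = 0 :=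
      boundaryRank_eq_zero_of_target fun S _ => by lia
    simp only [hzero, Nat.cast_zero, Finset.sum_const_zero]
  · simp only [(hpseudo _).boundaryRank_restrictComplex_zero,
      sum_powersetCard_card _ j fun c => ((if c = 0 then 0 else 1 : ℕ) : ℤ), Finset.card_fin, hn]
  obtain rfl | hkd := eq_or_ne k (d - 1)
  · have hrank (R : SimplicialPolytope d) (W : Finset (Fin R.n)) :
        (boundaryRank K (restrictComplex R.boundaryComplex W) (d - 1) : ℤ) =
          (facesIn R.boundaryComplex d W).card - if W.card = R.n then 1 else 0 := by
      have htop := (hpseudo R).boundaryRank_restrictComplex_top (K := K) W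
      rw [Fintype.card_fin] at htop
      lia
    simp only [hrank, Finset.sum_sub_distrib, Finset.card_fin, hn,
      sum_powersetCard_card _ j fun c => if c = Q.n then (1 : ℤ) else 0,
      (isAdditiveWeight_card_facesIn hd d).sum_powersetCard_eq hP hQ j]
  · exact (isAdditiveWeight_boundaryRank K hd hk (by lia)).sum_powersetCard_eq hP hQ j

theorem IsIteratedConnectedSum.gradedBetti_eq {d : ℕ} (hd : 1 ≤ d) (K : Type*) [Field K]
    {s : Multiset (SimplicialPolytope d)} {P Q : SimplicialPolytope d}
    (hP : IsIteratedConnectedSum s P) (hQ : IsIteratedConnectedSum s Q) (i j : ℕ) :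
    gradedBetti K P i j = gradedBetti K Q i j := by
  have hpseudo (R : SimplicialPolytope d) := R.isOrientablePseudomanifold hd
  have hfinrank (R : SimplicialPolytope d) (W) (k : ℤ) := finrank_reducedHomology (K := K)
    (isLowerSet_restrictComplex (hpseudo R).isLowerSet W) k
  rw [← Nat.cast_inj (R := ℤ), gradedBetti, gradedBetti]
  simp only [Nat.cast_sum, hfinrank, Finset.sum_sub_distrib,
    hP.sum_natCard_facesOfDim_eq hd hQ, hP.sum_boundaryRank_eq hd K hQ]

end SimplicialPolytope

end Betti

section Degree

variable {V : Type*} [Fintype V] {Δ : Set (Finset V)}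

open Classical in
/-- The neighbours of a vertex of the complex `Δ` in its `1`-skeleton. -/
noncomputable def neighbors (Δ : Set (Finset V)) (v : V) : Finset V :=
  {w | w ≠ v ∧ {v, w} ∈ Δ}

theorem mem_neighbors [DecidableEq V] {v w : V} :
    w ∈ neighbors Δ v ↔ w ≠ v ∧ {v, w} ∈ Δ := by
  simp only [neighbors, Finset.mem_filter, Finset.mem_univ, true_and]
  convert Iff.rfl

/-- The degree of a vertex of the complex `Δ` in its `1`-skeleton. -/
noncomputable def degree (Δ : Set (Finset V)) (v : V) : ℕ :=
  (neighbors Δ v).card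

/-- The sum of the squares of the vertex degrees, the isomorphism invariant that tells connected
sums with the same Betti numbers apart. -/
noncomputable def degreeSqSum (Δ : Set (Finset V)) : ℤ :=
  ∑ v, (degree Δ v : ℤ) ^ 2

/-- All vertices have the same degree. -/
def IsDegreeRegular (Δ : Set (Finset V)) : Prop :=
  ∀ u v, degree Δ u = degree Δ v

theorem degree_map_equiv {V' : Type*} [Fintype V'] {Δ' : Set (Finset V')} (e : V ≃ V')
    (he : ∀ S, S ∈ Δ ↔ S.map e.toEmbedding ∈ Δ') (v : V) : degree Δ' (e v) = degree Δ v := by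
  classical
  rw [degree, degree, ← Finset.card_map e.toEmbedding]
  congr 1
  ext x
  obtain ⟨w, rfl⟩ := e.surjective x
  simp only [Finset.mem_map_equiv, e.symm_apply_apply, mem_neighbors, he, Finset.map_insert,
    Finset.map_singleton, e.injective.ne_iff, Equiv.coe_toEmbedding]

theorem sum_mul_comp_swap {ι R : Type*} [Fintype ι] [DecidableEq ι] [CommRing R] (p q : ι → R)
    (k l : ι) : ∑ i, p i * q (Equiv.swap k l i) =
      ∑ i, p i * q i - (p k - p l) * (q k - q l) := by
  obtain rfl | hkl := eq_or_ne k l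
  · simp
  have hsupport : ∑ i, p i * (q i - q (Equiv.swap k l i)) =
      ∑ i ∈ {k, l}, p i * (q i - q (Equiv.swap k l i)) := by
    refine (Finset.sum_subset (Finset.subset_univ _) fun i _ hi => ?_).symm
    rw [Finset.mem_insert, Finset.mem_singleton, not_or] at hi
    rw [Equiv.swap_apply_of_ne_of_ne hi.1 hi.2, sub_self, mul_zero]
  rw [Finset.sum_pair hkl, Equiv.swap_apply_left, Equiv.swap_apply_right] at hsupport
  simp only [mul_sub, Finset.sum_sub_distrib] at hsupport
  linear_combination -hsupport

namespace IsGluing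

variable {α β γ : Type*} [Fintype α] [Fintype β] [Fintype γ] [DecidableEq γ] {m : ℕ}
  {Δ₁ : Set (Finset α)} {Δ₂ : Set (Finset β)} {Δ : Set (Finset γ)} {f₁ : α ↪ γ} {f₂ : β ↪ γ}
  {F₁ : Finset α} {F₂ : Finset β}

theorem degree_of_notMem (h : IsGluing m Δ₁ Δ₂ Δ f₁ f₂ F₁ F₂) (hm : 3 ≤ m) {i : α}
    (hi : i ∉ F₁) : degree Δ (f₁ i) = degree Δ₁ i := by
  classical
  rw [degree, degree, ← Finset.card_map f₁]
  congr 1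
  ext x
  rw [mem_neighbors, Finset.mem_map]
  constructor
  · rintro ⟨hne, hx⟩
    obtain ⟨i', j, hi', rfl, hij⟩ | ⟨i', j, hi', rfl, -⟩ := h.exists_of_pair_mem hx
    · rw [f₁.injective hi'] at hij
      exact ⟨j, mem_neighbors.2 ⟨fun hj => hne (by rw [hj]), hij⟩, rfl⟩
    · exact absurd (h.mem_of_eq hi'.symm) hi
  · rintro ⟨j, hj, rfl⟩
    rw [mem_neighbors] at hj
    exact ⟨f₁.injective.ne hj.1, h.pair_mem hm hj.2⟩

theorem neighbors_eq_union (h : IsGluing m Δ₁ Δ₂ Δ f₁ f₂ F₁ F₂) (hm : 3 ≤ m) {i : α} {j : β}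
    (hij : f₁ i = f₂ j) :
    neighbors Δ (f₁ i) = (neighbors Δ₁ i).map f₁ ∪ (neighbors Δ₂ j).map f₂ := by
  classical
  ext x
  simp only [Finset.mem_union, Finset.mem_map, mem_neighbors]
  constructor
  · rintro ⟨hne, hx⟩
    obtain ⟨i', k, hi', rfl, hik⟩ | ⟨i', k, hi', rfl, hik⟩ := h.exists_of_pair_mem hx
    · rw [f₁.injective hi'] at hik
      exact Or.inl ⟨k, ⟨fun he => hne (by rw [he]), hik⟩, rfl⟩
    · rw [f₂.injective (hi'.trans hij)] at hik
      exact Or.inr ⟨k, ⟨fun he => hne (by rw [he, hij]), hik⟩, rfl⟩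
  · rintro (⟨k, ⟨hne, hk⟩, rfl⟩ | ⟨k, ⟨hne, hk⟩, rfl⟩)
    · exact ⟨f₁.injective.ne hne, h.pair_mem hm hk⟩
    · rw [hij]
      exact ⟨f₂.injective.ne hne, h.symm.pair_mem hm hk⟩

theorem map_neighbors_inter_map_neighbors (h : IsGluing m Δ₁ Δ₂ Δ f₁ f₂ F₁ F₂)
    [DecidableEq α] (h₁ : IsLowerSet Δ₁) (h₂ : IsLowerSet Δ₂) {i : α} {j : β} (hij : f₁ i = f₂ j) :
    (neighbors Δ₁ i).map f₁ ∩ (neighbors Δ₂ j).map f₂ = (F₁.erase i).map f₁ := by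
  classical
  ext x
  rw [Finset.mem_inter]
  constructor
  · rintro ⟨hx₁, hx₂⟩
    obtain ⟨k, hk, rfl⟩ := Finset.mem_map.1 hx₁
    obtain ⟨l, -, hl⟩ := Finset.mem_map.1 hx₂
    exact Finset.mem_map_of_mem f₁
      (Finset.mem_erase.2 ⟨(mem_neighbors.1 hk).1, h.mem_of_eq hl.symm⟩)
  · intro hx
    obtain ⟨k, hk, rfl⟩ := Finset.mem_map.1 hx
    obtain ⟨hki, hkF⟩ := Finset.mem_erase.1 hk
    obtain ⟨l, hl, hlk⟩ := Finset.mem_map.1 (h.map_eq ▸ Finset.mem_map_of_mem f₁ hkF)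
    have hlj : l ≠ j := fun he => hki (f₁.injective (by rw [hij, ← he, hlk]))
    have hpair₁ : {i, k} ⊆ F₁ := Finset.insert_subset (h.mem_of_eq hij)
      (Finset.singleton_subset_iff.2 hkF)
    have hpair₂ : {j, l} ⊆ F₂ := Finset.insert_subset (h.symm.mem_of_eq hij.symm)
      (Finset.singleton_subset_iff.2 hl)
    exact ⟨Finset.mem_map_of_mem f₁ (mem_neighbors.2 ⟨hki, h₁ hpair₁ h.mem₁⟩),
      hlk ▸ Finset.mem_map_of_mem f₂ (mem_neighbors.2 ⟨hlj, h₂ hpair₂ h.mem₂⟩)⟩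

theorem degree_add (h : IsGluing m Δ₁ Δ₂ Δ f₁ f₂ F₁ F₂) (hm : 3 ≤ m) (h₁ : IsLowerSet Δ₁)
    (h₂ : IsLowerSet Δ₂) {i : α} {j : β} (hij : f₁ i = f₂ j) :
    degree Δ (f₁ i) + (m - 1) = degree Δ₁ i + degree Δ₂ j := by
  classical
  have hcard := Finset.card_union_add_card_inter ((neighbors Δ₁ i).map f₁)
    ((neighbors Δ₂ j).map f₂)
  rwa [← h.neighbors_eq_union hm hij, h.map_neighbors_inter_map_neighbors h₁ h₂ hij,
    Finset.card_map, Finset.card_map, Finset.card_map, Finset.card_erase_of_mem (h.mem_of_eq hij),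
    h.card_eq] at hcard

theorem sum_add_sum_base (h : IsGluing m Δ₁ Δ₂ Δ f₁ f₂ F₁ F₂) {a : Fin m ↪ α}
    (ha : Finset.univ.map a = F₁) {M : Type*} [AddCommMonoid M] (g : γ → M) :
    ∑ x, g x + ∑ k, g (f₁ (a k)) = ∑ i, g (f₁ i) + ∑ j, g (f₂ j) := by
  have hsum := Finset.sum_union_inter (s₁ := Finset.univ.map f₁) (s₂ := Finset.univ.map f₂) (f := g)
  rwa [h.union, h.inter, ← ha, Finset.sum_map, Finset.sum_map, Finset.sum_map,
    Finset.sum_map] at hsum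

theorem sum_degree_sq_sub (h : IsGluing m Δ₁ Δ₂ Δ f₁ f₂ F₁ F₂) (hm : 3 ≤ m) {a : Fin m ↪ α}
    (ha : Finset.univ.map a = F₁) :
    ∑ i, (degree Δ (f₁ i) : ℤ) ^ 2 = degreeSqSum Δ₁ +
      ∑ k, ((degree Δ (f₁ (a k)) : ℤ) ^ 2 - (degree Δ₁ (a k) : ℤ) ^ 2) := by
  rw [Fintype.sum_of_injective a a.injective _
    (fun i => (degree Δ (f₁ i) : ℤ) ^ 2 - (degree Δ₁ i : ℤ) ^ 2) _ fun _ => rfl,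
    Finset.sum_sub_distrib, degreeSqSum, add_sub_cancel]
  intro i hi
  rw [h.degree_of_notMem hm (by simpa [← ha] using hi), sub_self]

theorem degreeSqSum_eq (h : IsGluing m Δ₁ Δ₂ Δ f₁ f₂ F₁ F₂) (hm : 3 ≤ m) (h₁ : IsLowerSet Δ₁)
    (h₂ : IsLowerSet Δ₂) {a : Fin m ↪ α} {b : Fin m ↪ β} (ha : Finset.univ.map a = F₁)
    (hb : Finset.univ.map b = F₂) (hab : ∀ k, f₁ (a k) = f₂ (b k)) :
    degreeSqSum Δ = degreeSqSum Δ₁ + degreeSqSum Δ₂ +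
      (2 * ∑ k, (degree Δ₁ (a k) * degree Δ₂ (b k) : ℤ) -
        2 * (m - 1) * (∑ k, (degree Δ₁ (a k) : ℤ) + ∑ k, (degree Δ₂ (b k) : ℤ)) +
        m * (m - 1) ^ 2) := by
  have hbase := h.sum_add_sum_base ha fun x => (degree Δ x : ℤ) ^ 2
  have hdegree (k : Fin m) : (degree Δ (f₂ (b k)) : ℤ) =
      degree Δ₁ (a k) + degree Δ₂ (b k) - (m - 1) := by
    have hadd := h.degree_add hm h₁ h₂ (hab k)
    rw [hab] at hadd
    lia
  have hsquare : ∑ k, (degree Δ (f₂ (b k)) : ℤ) ^ 2 =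
      ∑ k, (degree Δ₁ (a k) : ℤ) ^ 2 + ∑ k, (degree Δ₂ (b k) : ℤ) ^ 2 +
      (2 * ∑ k, (degree Δ₁ (a k) * degree Δ₂ (b k) : ℤ) -
        2 * (m - 1) * (∑ k, (degree Δ₁ (a k) : ℤ) + ∑ k, (degree Δ₂ (b k) : ℤ)) +
        m * (m - 1) ^ 2) := by
    have hconst : (m * (m - 1) ^ 2 : ℤ) = ∑ _k : Fin m, ((m : ℤ) - 1) ^ 2 := by simp
    rw [hconst]
    simp only [hdegree, mul_add, Finset.mul_sum, ← Finset.sum_add_distrib, ← Finset.sum_sub_distrib]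
    exact Finset.sum_congr rfl fun k _ => by ring
  rw [h.sum_degree_sq_sub hm ha, h.symm.sum_degree_sq_sub hm hb, Finset.sum_sub_distrib,
    Finset.sum_sub_distrib] at hbase
  simp only [hab] at hbase
  rw [degreeSqSum]
  linarith

end IsGluing

end Degree

section DegreeRegularity

namespace IsOrientablePseudomanifold

variable {V : Type*} [LinearOrder V] {Δ : Set (Finset V)} {m : ℕ}

theorem eq_of_forall_facet_eq (hΔ : IsOrientablePseudomanifold Δ m) (hm : 2 ≤ m) {β : Type*}
    {g : V → β} (hg : ∀ H ∈ Δ, H.card = m → ∀ u ∈ H, ∀ v ∈ H, g u = g v) (u v : V) :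
    g u = g v := by
  obtain ⟨H, hH, hHcard, hu⟩ := hΔ.exists_facet_mem u
  obtain ⟨G, hG, hGcard, hv⟩ := hΔ.exists_facet_mem v
  have hclosed := hΔ.mem_of_adjacent_closed {H | (H ∈ Δ ∧ H.card = m) ∧ ∀ w ∈ H, g u = g w}
    (fun H h => h.1) ⟨H, ⟨hH, hHcard⟩, hg H hH hHcard u hu⟩ ?_ G hG hGcard
  · exact hclosed.2 v hv
  · rintro H ⟨⟨-, hcard⟩, hconst⟩ x hx y hy hface
    have hcard' := (card_insert_erase hx hy).trans hcard
    obtain ⟨z, hz, hzx⟩ := Finset.exists_mem_ne (hcard ▸ hm) x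
    refine ⟨⟨hface, hcard'⟩, fun w hw => (hconst z hz).trans (hg _ hface hcard' z ?_ w hw)⟩
    exact Finset.mem_insert_of_mem (Finset.mem_erase.2 ⟨hzx, hz⟩)

theorem le_degree [Fintype V] (hΔ : IsOrientablePseudomanifold Δ m) (hm : 2 ≤ m) (v : V) :
    m ≤ degree Δ v := by
  obtain ⟨H, hH, hcard, hv⟩ := hΔ.exists_facet_mem v
  obtain ⟨x, hx, hxv⟩ := Finset.exists_mem_ne (hcard ▸ hm) v
  obtain ⟨y, ⟨hy, hyH⟩, -⟩ := hΔ.existsUnique_adjacent H hH hcard x hx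
  have hpair : ∀ {G w}, G ∈ Δ → v ∈ G → w ∈ G → {v, w} ∈ Δ := fun hG hvG hwG =>
    hΔ.isLowerSet (Finset.insert_subset hvG (Finset.singleton_subset_iff.2 hwG)) hG
  rw [← hcard, ← card_insert_erase hv hy]
  refine Finset.card_le_card fun w hw => mem_neighbors.2 ?_
  obtain rfl | hw := Finset.mem_insert.1 hw
  · exact ⟨fun h => hy (h ▸ hv), hpair hyH (Finset.mem_insert_of_mem
      (Finset.mem_erase.2 ⟨hxv.symm, hv⟩)) (Finset.mem_insert_self _ _)⟩
  · obtain ⟨hwv, hwH⟩ := Finset.mem_erase.1 hw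
    exact ⟨hwv, hpair hH hv hwH⟩

end IsOrientablePseudomanifold

namespace IsGluing

variable {α β γ : Type*} [Fintype α] [LinearOrder β] [Fintype β] [Fintype γ]
  [DecidableEq γ] {m : ℕ} {Δ₁ : Set (Finset α)} {Δ₂ : Set (Finset β)} {Δ : Set (Finset γ)}
  {f₁ : α ↪ γ} {f₂ : β ↪ γ} {F₁ : Finset α} {F₂ : Finset β}

theorem degree_lt_degree (h : IsGluing m Δ₁ Δ₂ Δ f₁ f₂ F₁ F₂) (hm : 3 ≤ m) (h₁ : IsLowerSet Δ₁)
    (h₂ : IsOrientablePseudomanifold Δ₂ m) {i : α} (hi : i ∈ F₁) :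
    degree Δ₁ i < degree Δ (f₁ i) := by
  obtain ⟨j, -, hj⟩ := Finset.mem_map.1 (h.map_eq ▸ Finset.mem_map_of_mem f₁ hi)
  have hadd := h.degree_add hm h₁ h₂.isLowerSet hj.symm
  have hle := h₂.le_degree (by lia) j
  lia

end IsGluing

namespace SimplicialPolytope

variable {d : ℕ}

theorem Iso.refl (P : SimplicialPolytope d) : P.Iso P :=
  ⟨Equiv.refl _, fun S => by simp⟩

theorem Iso.trans {d' d'' : ℕ} {P : SimplicialPolytope d} {Q : SimplicialPolytope d'}
    {R : SimplicialPolytope d''} (hPQ : P.Iso Q) (hQR : Q.Iso R) : P.Iso R := by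
  obtain ⟨e, he⟩ := hPQ
  obtain ⟨f, hf⟩ := hQR
  refine ⟨e.trans f, fun S => ?_⟩
  rw [he, hf, Finset.map_map]
  rfl

theorem Iso.degreeSqSum_eq {d' : ℕ} {P : SimplicialPolytope d} {Q : SimplicialPolytope d'}
    (h : P.Iso Q) : degreeSqSum P.boundaryComplex = degreeSqSum Q.boundaryComplex := by
  obtain ⟨e, he⟩ := h
  exact Fintype.sum_equiv e _ _ fun v => by rw [degree_map_equiv e he]

theorem exists_facet_embedding (P : SimplicialPolytope d) (hd : 1 ≤ d) (v : Fin P.n) :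
    ∃ (a : Fin d ↪ Fin P.n) (k : Fin d), Finset.univ.map a ∈ P.boundaryComplex ∧ a k = v := by
  obtain ⟨H, hH, hcard, hv⟩ := (P.isOrientablePseudomanifold hd).exists_facet_mem v
  obtain ⟨a, rfl⟩ := exists_embedding_map_univ_eq hcard
  obtain ⟨k, -, hk⟩ := Finset.mem_map.1 hv
  exact ⟨a, k, hH, hk⟩

theorem exists_isConnectedSum_not_isDegreeRegular (hd : 3 ≤ d) (A B : SimplicialPolytope d) :
    ∃ P, IsConnectedSum A B P ∧ ¬ IsDegreeRegular P.boundaryComplex := by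
  have hpseudo (R : SimplicialPolytope d) := R.isOrientablePseudomanifold (by lia)
  obtain ⟨u, hu⟩ := Finite.exists_max (degree A.boundaryComplex)
  obtain ⟨a, k, ha, rfl⟩ := A.exists_facet_embedding (by lia) u
  obtain ⟨b, -, hb, -⟩ := B.exists_facet_embedding (by lia) (Classical.arbitrary _)
  obtain ⟨P, f₁, f₂, h, -⟩ := exists_isGluing (by lia) A B a b ha hb
  refine ⟨P, isConnectedSum_iff.2 ⟨_, _, _, _, h⟩, fun hreg => ?_⟩
  obtain ⟨i, hi⟩ := (Set.ne_univ_iff_exists_notMem _).1 (A.range_ne_univ a)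
  have hlt := h.degree_lt_degree hd (hpseudo A).isLowerSet (hpseudo B) (i := a k) (by simp)
  rw [hreg (f₁ (a k)) (f₁ i), h.degree_of_notMem hd (by simpa using hi)] at hlt
  exact hlt.not_ge (hu i)

theorem exists_facet_degree_ne (hd : 2 ≤ d) {P : SimplicialPolytope d}
    (hP : ¬ IsDegreeRegular P.boundaryComplex) :
    ∃ (a : Fin d ↪ Fin P.n) (k l : Fin d), Finset.univ.map a ∈ P.boundaryComplex ∧
      degree P.boundaryComplex (a k) ≠ degree P.boundaryComplex (a l) := by
  by_contra! hcon
  refine hP ((P.isOrientablePseudomanifold (by lia)).eq_of_forall_facet_eq hd fun H hH hcard => ?_)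
  obtain ⟨a, rfl⟩ := exists_embedding_map_univ_eq hcard
  simpa using fun k l => hcon a k l hH

theorem exists_isConnectedSum_degreeSqSum_ne (hd : 3 ≤ d) {A B : SimplicialPolytope d}
    (hA : ¬ IsDegreeRegular A.boundaryComplex) (hB : ¬ IsDegreeRegular B.boundaryComplex) :
    ∃ P Q, IsConnectedSum A B P ∧ IsConnectedSum A B Q ∧
      degreeSqSum P.boundaryComplex ≠ degreeSqSum Q.boundaryComplex := by
  have hlower (R : SimplicialPolytope d) := (R.isOrientablePseudomanifold (by lia)).isLowerSet
  obtain ⟨a, k, l, ha, hkl⟩ := exists_facet_degree_ne (by lia) hA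
  obtain ⟨b, k', l', hb, hkl'⟩ := exists_facet_degree_ne (by lia) hB
  have hne : k ≠ l := fun h => hkl (by rw [h])
  have hne' : k' ≠ l' := fun h => hkl' (by rw [h])
  obtain ⟨σ, rfl, rfl⟩ := MulAction.is_two_pretransitive_iff.1
    (Equiv.Perm.isMultiplyPretransitive (Fin d) 2) hne hne'
  have hglue (τ : Equiv.Perm (Fin d)) :=
    exists_isGluing (by lia) A B a (τ.toEmbedding.trans b) ha
      (by rwa [← Finset.map_map, Finset.map_univ_equiv])
  obtain ⟨P, f₁, f₂, hP, hf⟩ := hglue σ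
  obtain ⟨Q, g₁, g₂, hQ, hg⟩ := hglue (σ * Equiv.swap k l)
  refine ⟨P, Q, isConnectedSum_iff.2 ⟨_, _, _, _, hP⟩, isConnectedSum_iff.2 ⟨_, _, _, _, hQ⟩,
    fun heq => ?_⟩
  have hswap := sum_mul_comp_swap (fun i => (degree A.boundaryComplex (a i) : ℤ))
    (fun i => (degree B.boundaryComplex (b (σ i)) : ℤ)) k l
  have hsum := Equiv.sum_comp (Equiv.swap k l)
    fun i => (degree B.boundaryComplex (b (σ i)) : ℤ)
  rw [hP.degreeSqSum_eq hd (hlower A) (hlower B) rfl rfl hf,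
    hQ.degreeSqSum_eq hd (hlower A) (hlower B) rfl rfl hg] at heq
  simp only [Function.Embedding.trans_apply, Equiv.toEmbedding_apply, Equiv.Perm.mul_apply, hswap,
    hsum] at heq
  have hmul : ((degree A.boundaryComplex (a k) : ℤ) - degree A.boundaryComplex (a l)) *
      (degree B.boundaryComplex (b (σ k)) - degree B.boundaryComplex (b (σ l))) = 0 := by
    linarith
  obtain h | h := mul_eq_zero.1 hmul
  · exact hkl (by exact_mod_cast sub_eq_zero.1 h)
  · exact hkl' (by exact_mod_cast sub_eq_zero.1 h)

end SimplicialPolytope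

end DegreeRegularity

section Simplices

theorem exists_eq_insert_erase_of_card_inter_add_one {V : Type*} [DecidableEq V] {F G : Finset V}
    (hcard : G.card = F.card) (hinter : (G ∩ F).card + 1 = F.card) {w : V} (hwG : w ∈ G)
    (hwF : w ∉ F) : ∃ x ∈ F, G = insert w (F.erase x) := by
  obtain ⟨x, hx, hxF⟩ := Finset.exists_eq_insert_iff.2 ⟨Finset.inter_subset_right, hinter⟩
  obtain ⟨y, -, hyG⟩ := Finset.exists_eq_insert_iff.2
    ⟨Finset.inter_subset_left, hinter.trans hcard.symm⟩
  have herase : F.erase x = G ∩ F := by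
    conv_lhs => rw [← hxF, Finset.erase_insert hx]
  have hwy : w = y := (Finset.mem_insert.1 (hyG ▸ hwG)).resolve_right fun h =>
    hwF (Finset.mem_inter.1 h).2
  exact ⟨x, hxF ▸ Finset.mem_insert_self x _, by rw [herase, hwy, hyG]⟩

namespace IsOrientablePseudomanifold

variable {V : Type*} [LinearOrder V] {Δ : Set (Finset V)} {m : ℕ}

theorem insert_erase_mem_of_forall_card_inter (hΔ : IsOrientablePseudomanifold Δ m) {F : Finset V}
    (hF : F.card = m) (h : ∀ G ∈ Δ, G.card = m → G ≠ F → (G ∩ F).card + 1 = m) {w y : V}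
    (hw : w ∉ F) (hy : y ∈ F) : insert w (F.erase y) ∈ Δ := by
  have hform : ∀ G ∈ Δ, G.card = m → w ∈ G → ∃ x ∈ F, G = insert w (F.erase x) :=
    fun G hG hcard hwG => exists_eq_insert_erase_of_card_inter_add_one (hcard.trans hF.symm)
      ((h G hG hcard fun he => hw (he ▸ hwG)).trans hF.symm) hwG hw
  obtain ⟨G, hG, hcard, hwG⟩ := hΔ.exists_facet_mem w
  obtain ⟨x, -, rfl⟩ := hform G hG hcard hwG
  obtain rfl | hyx := eq_or_ne y x
  · exact hG
  have hyG : y ∈ insert w (F.erase x) := Finset.mem_insert_of_mem (Finset.mem_erase.2 ⟨hyx, hy⟩)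
  obtain ⟨z, ⟨hz, hzG⟩, -⟩ := hΔ.existsUnique_adjacent _ hG hcard y hyG
  obtain ⟨v, -, hv⟩ := hform _ hzG ((card_insert_erase hyG hz).trans hcard)
    (Finset.mem_insert_of_mem (Finset.mem_erase.2
      ⟨fun he => hw (he ▸ hy), Finset.mem_insert_self _ _⟩))
  have hvy : y = v := by
    by_contra hne
    have hmem : y ∈ insert w (F.erase v) := Finset.mem_insert_of_mem (Finset.mem_erase.2 ⟨hne, hy⟩)
    rw [← hv, Finset.mem_insert] at hmem
    exact hmem.elim (fun he => hz (he ▸ hyG)) (Finset.notMem_erase _ _)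
  rwa [hvy, ← hv]

theorem card_eq_of_forall_card_inter [Fintype V] (hΔ : IsOrientablePseudomanifold Δ m)
    (hm : 1 ≤ m) {F : Finset V} (hFΔ : F ∈ Δ) (hF : F.card = m)
    (h : ∀ G ∈ Δ, G.card = m → G ≠ F → (G ∩ F).card + 1 = m) : Fintype.card V = m + 1 := by
  obtain ⟨x, hx⟩ : F.Nonempty := Finset.card_pos.1 (hF ▸ hm)
  obtain ⟨y, ⟨hy, -⟩, hunique⟩ := hΔ.existsUnique_adjacent F hFΔ hF x hx
  have hcompl : Fᶜ = {y} := by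
    refine Finset.eq_singleton_iff_unique_mem.2 ⟨Finset.mem_compl.2 hy, fun w hw => ?_⟩
    have hw := Finset.mem_compl.1 hw
    exact hunique w ⟨hw, hΔ.insert_erase_mem_of_forall_card_inter hF h hw hx⟩
  rw [← Finset.card_add_card_compl F, hF, hcompl, Finset.card_singleton]

theorem mem_iff_card_le [Fintype V] (hΔ : IsOrientablePseudomanifold Δ m)
    (hV : Fintype.card V = m + 1) {S : Finset V} : S ∈ Δ ↔ S.card ≤ m := by
  refine ⟨fun hS => ?_, fun hS => ?_⟩
  · obtain ⟨H, -, rfl, hSH⟩ := hΔ.exists_facet_superset S hS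
    exact Finset.card_le_card hSH
  have herase : ∀ {G : Finset V} {v}, G.card = m → v ∉ G → G = Finset.univ.erase v :=
    fun hcard hv => Finset.eq_of_subset_of_card_le
      (Finset.subset_erase.2 ⟨Finset.subset_univ _, hv⟩) (by simp [hV, hcard])
  obtain ⟨v, hv⟩ : ∃ v, v ∉ S := by
    by_contra! hall
    rw [Finset.eq_univ_of_forall hall, Finset.card_univ] at hS
    lia
  suffices hvΔ : Finset.univ.erase v ∈ Δ from
    hΔ.isLowerSet (Finset.subset_erase.2 ⟨Finset.subset_univ S, hv⟩) hvΔ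
  obtain ⟨H, hH, hcard, -⟩ := hΔ.exists_facet_mem v
  by_cases hvH : v ∈ H
  · obtain ⟨y, ⟨hy, hyH⟩, -⟩ := hΔ.existsUnique_adjacent H hH hcard v hvH
    rwa [herase (v := v) ((card_insert_erase hvH hy).trans hcard)
      (by simpa using ne_of_mem_of_not_mem hvH hy)] at hyH
  · rwa [← herase hcard hvH]

end IsOrientablePseudomanifold

namespace IsGluing

variable {α β γ : Type*} [LinearOrder α] [Fintype α] [LinearOrder β] [Fintype β] [Fintype γ]
  [DecidableEq γ] {m : ℕ} {Δ₁ : Set (Finset α)} {Δ₂ : Set (Finset β)} {Δ : Set (Finset γ)}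
  {f₁ : α ↪ γ} {f₂ : β ↪ γ} {F₁ : Finset α} {F₂ : Finset β}

theorem degree_eq_add_ite (h : IsGluing m Δ₁ Δ₂ Δ f₁ f₂ F₁ F₂) (hm : 3 ≤ m)
    (h₁ : IsLowerSet Δ₁) (h₂ : IsOrientablePseudomanifold Δ₂ m) (hΔ₂ : IsDegreeRegular Δ₂)
    (i : α) (j : β) :
    degree Δ (f₁ i) = degree Δ₁ i + if i ∈ F₁ then degree Δ₂ j - (m - 1) else 0 := by
  split_ifs with hi
  · obtain ⟨j', -, hj'⟩ := Finset.mem_map.1 (h.map_eq ▸ Finset.mem_map_of_mem f₁ hi)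
    have hadd := h.degree_add hm h₁ h₂.isLowerSet hj'.symm
    have hle := h₂.le_degree (by lia) j
    rw [hΔ₂ j' j] at hadd
    lia
  · rw [h.degree_of_notMem hm hi, add_zero]

theorem card_eq_of_forall_sum_degree_eq [Nonempty α] [Nonempty β]
    (h : IsGluing m Δ₁ Δ₂ Δ f₁ f₂ F₁ F₂) (hm : 3 ≤ m)
    (h₁ : IsOrientablePseudomanifold Δ₁ m) (h₂ : IsOrientablePseudomanifold Δ₂ m)
    (hΔ₁ : IsDegreeRegular Δ₁) (hΔ₂ : IsDegreeRegular Δ₂) {σ : ℕ}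
    (hσ : ∀ G ∈ Δ, G.card = m → ∑ v ∈ G, degree Δ v = σ) : Fintype.card α = m + 1 := by
  obtain ⟨i⟩ := ‹Nonempty α›
  obtain ⟨j⟩ := ‹Nonempty β›
  have hsum : ∀ G ∈ Δ₁, G.card = m → G ≠ F₁ →
      m * degree Δ₁ i + (G ∩ F₁).card * (degree Δ₂ j - (m - 1)) = σ := by
    intro G hG hcard hne
    rw [← hσ (G.map f₁) ((h.mem_iff _).2 (Or.inl ⟨G, hG, hne, rfl⟩)) (by rwa [Finset.card_map]),
      Finset.sum_map]
    simp only [h.degree_eq_add_ite hm h₁.isLowerSet h₂ hΔ₂ _ j, hΔ₁ _ i, Finset.sum_add_distrib,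
      Finset.sum_const, Finset.sum_ite_mem, smul_eq_mul, hcard]
  obtain ⟨x, hx⟩ : F₁.Nonempty := Finset.card_pos.1 (h.card_eq ▸ by lia)
  obtain ⟨y, ⟨hy, hyF⟩, -⟩ := h₁.existsUnique_adjacent F₁ h.mem₁ h.card_eq x hx
  have hadjacent := hsum _ hyF ((card_insert_erase hx hy).trans h.card_eq) fun he =>
    hy (he ▸ Finset.mem_insert_self _ _)
  rw [Finset.insert_inter_of_notMem hy, Finset.inter_eq_left.2 (Finset.erase_subset _ _)]
    at hadjacent
  have hle := h₂.le_degree (by lia) j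
  refine h₁.card_eq_of_forall_card_inter (by lia) h.mem₁ h.card_eq fun G hG hcard hne => ?_
  have hinter := Nat.eq_of_mul_eq_mul_right (by lia)
    (Nat.add_left_cancel ((hsum G hG hcard hne).trans hadjacent.symm))
  rw [hinter, Finset.card_erase_add_one hx, h.card_eq]

end IsGluing

namespace SimplicialPolytope

variable {d : ℕ}

theorem iso_of_n_eq (hd : 1 ≤ d) {P Q : SimplicialPolytope d} (hP : P.n = d + 1)
    (hQ : Q.n = d + 1) : P.Iso Q := by
  refine ⟨finCongr (hP.trans hQ.symm), fun S => ?_⟩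
  rw [(P.isOrientablePseudomanifold hd).mem_iff_card_le (by simpa),
    (Q.isOrientablePseudomanifold hd).mem_iff_card_le (by simpa), Finset.card_map]

theorem sum_degree_eq_of_forall_degreeSqSum_eq (hd : 3 ≤ d) {X C : SimplicialPolytope d}
    (hC : IsDegreeRegular C.boundaryComplex)
    (heq : ∀ P Q, IsConnectedSum X C P → IsConnectedSum X C Q →
      degreeSqSum P.boundaryComplex = degreeSqSum Q.boundaryComplex) {G H : Finset (Fin X.n)}
    (hG : G ∈ X.facets) (hH : H ∈ X.facets) :
    ∑ v ∈ G, degree X.boundaryComplex v = ∑ v ∈ H, degree X.boundaryComplex v := by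
  have hpseudo (R : SimplicialPolytope d) := R.isOrientablePseudomanifold (by lia)
  obtain ⟨a, rfl⟩ := exists_embedding_map_univ_eq hG.2
  obtain ⟨a', rfl⟩ := exists_embedding_map_univ_eq hH.2
  obtain ⟨c, k, hc, -⟩ := C.exists_facet_embedding (by lia) (Classical.arbitrary _)
  obtain ⟨P, f₁, f₂, hP, hf⟩ := exists_isGluing (by lia) X C a c hG.1 hc
  obtain ⟨Q, g₁, g₂, hQ, hg⟩ := exists_isGluing (by lia) X C a' c hH.1 hc
  have hsum := heq P Q (isConnectedSum_iff.2 ⟨_, _, _, _, hP⟩)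
    (isConnectedSum_iff.2 ⟨_, _, _, _, hQ⟩)
  rw [hP.degreeSqSum_eq hd (hpseudo X).isLowerSet (hpseudo C).isLowerSet rfl rfl hf,
    hQ.degreeSqSum_eq hd (hpseudo X).isLowerSet (hpseudo C).isLowerSet rfl rfl hg] at hsum
  simp only [hC (c _) (c k), ← Finset.sum_mul] at hsum
  have hle := (hpseudo C).le_degree (by lia) (c k)
  have hcoeff : (2 * (degree C.boundaryComplex (c k) - (d - 1)) : ℤ) ≠ 0 := by lia
  rw [Finset.sum_map, Finset.sum_map, ← Nat.cast_inj (R := ℤ)]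
  push_cast
  exact mul_left_cancel₀ hcoeff (by linarith)

theorem n_eq_of_forall_degreeSqSum_eq (hd : 3 ≤ d) {A B C X : SimplicialPolytope d}
    (hA : IsDegreeRegular A.boundaryComplex) (hB : IsDegreeRegular B.boundaryComplex)
    (hC : IsDegreeRegular C.boundaryComplex) (hX : IsConnectedSum A B X)
    (heq : ∀ P Q, IsConnectedSum X C P → IsConnectedSum X C Q →
      degreeSqSum P.boundaryComplex = degreeSqSum Q.boundaryComplex) : A.n = d + 1 := by
  have hpseudo (R : SimplicialPolytope d) := R.isOrientablePseudomanifold (by lia)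
  obtain ⟨f₁, f₂, F₁, F₂, h⟩ := isConnectedSum_iff.1 hX
  obtain ⟨H, hH, hcard, -⟩ := (hpseudo X).exists_facet_mem (Classical.arbitrary _)
  simpa using h.card_eq_of_forall_sum_degree_eq hd (hpseudo A) (hpseudo B) hA hB
    fun G hG hGcard =>
      sum_degree_eq_of_forall_degreeSqSum_eq hd hC heq ⟨hG, hGcard⟩ ⟨hH, hcard⟩

end SimplicialPolytope

end Simplices

section IteratedConnectedSums

namespace SimplicialPolytope

variable {d : ℕ} {s t : Multiset (SimplicialPolytope d)}

namespace IsIteratedConnectedSum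

theorem replicate {P T : SimplicialPolytope d} (h : IsIteratedConnectedSum s P)
    (hT : ∀ Q ∈ s, T.Iso Q) : IsIteratedConnectedSum (Multiset.replicate s.card T) P := by
  induction h with
  | single h => exact .single ((hT _ (Multiset.mem_singleton_self _)).trans h)
  | sum _ _ hP ihA ihB =>
    rw [Multiset.card_add, Multiset.replicate_add]
    exact .sum (ihA fun Q hQ => hT Q (Multiset.mem_add.2 (Or.inl hQ)))
      (ihB fun Q hQ => hT Q (Multiset.mem_add.2 (Or.inr hQ))) hP

theorem cons {A B P : SimplicialPolytope d} (hB : IsIteratedConnectedSum s B)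
    (hP : IsConnectedSum A B P) : IsIteratedConnectedSum (A ::ₘ s) P := by
  rw [← Multiset.singleton_add]
  exact .sum (.single (Iso.refl A)) hB hP

end IsIteratedConnectedSum

theorem exists_isIteratedConnectedSum (hd : 3 ≤ d) (hs : s ≠ 0) :
    ∃ P, IsIteratedConnectedSum s P := by
  induction s using Multiset.induction with
  | empty => exact absurd rfl hs
  | cons A t ih =>
    obtain rfl | ht := eq_or_ne t 0
    · exact ⟨A, .single (Iso.refl A)⟩
    · obtain ⟨B, hB⟩ := ih ht
      obtain ⟨P, hP, -⟩ := exists_isConnectedSum_not_isDegreeRegular hd A B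
      exact ⟨P, hB.cons hP⟩

theorem exists_isIteratedConnectedSum_not_isDegreeRegular (hd : 3 ≤ d) (hs : 2 ≤ s.card) :
    ∃ P, IsIteratedConnectedSum s P ∧ ¬ IsDegreeRegular P.boundaryComplex := by
  obtain ⟨A, hA⟩ := Multiset.card_pos_iff_exists_mem.1 (by lia : 0 < s.card)
  obtain ⟨t, rfl⟩ := Multiset.exists_cons_of_mem hA
  obtain ⟨B, hB⟩ := exists_isIteratedConnectedSum hd (s := t) (by rintro rfl; simp at hs)
  obtain ⟨P, hP, hreg⟩ := exists_isConnectedSum_not_isDegreeRegular hd A B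
  exact ⟨P, hB.cons hP, hreg⟩

theorem isDegreeRegular_of_forall_degreeSqSum_eq (hd : 3 ≤ d) (hs : 2 ≤ s.card)
    (heq : ∀ P Q, IsIteratedConnectedSum (s + t) P → IsIteratedConnectedSum (s + t) Q →
      degreeSqSum P.boundaryComplex = degreeSqSum Q.boundaryComplex)
    {C : SimplicialPolytope d} (hC : IsIteratedConnectedSum t C) :
    IsDegreeRegular C.boundaryComplex := by
  by_contra hreg
  obtain ⟨X, hX, hXreg⟩ := exists_isIteratedConnectedSum_not_isDegreeRegular hd hs
  obtain ⟨P, Q, hP, hQ, hne⟩ := exists_isConnectedSum_degreeSqSum_ne hd hXreg hreg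
  exact hne (heq P Q (.sum hX hC hP) (.sum hX hC hQ))

theorem card_le_three_of_forall_degreeSqSum_eq (hd : 3 ≤ d)
    (heq : ∀ P Q, IsIteratedConnectedSum s P → IsIteratedConnectedSum s Q →
      degreeSqSum P.boundaryComplex = degreeSqSum Q.boundaryComplex) : s.card ≤ 3 := by
  by_contra! hs
  obtain ⟨t, ht⟩ : ∃ t, t ∈ s.powersetCard 2 := Multiset.card_pos_iff_exists_mem.1 (by
    rw [Multiset.card_powersetCard]
    exact Nat.choose_pos (by lia))
  obtain ⟨hle, hcard⟩ := Multiset.mem_powersetCard.1 ht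
  obtain ⟨t', rfl⟩ := Multiset.le_iff_exists_add.1 hle
  rw [Multiset.card_add] at hs
  obtain ⟨C, hC, hreg⟩ := exists_isIteratedConnectedSum_not_isDegreeRegular hd (s := t') (by lia)
  exact hreg (isDegreeRegular_of_forall_degreeSqSum_eq hd hcard.ge heq hC)

theorem n_eq_of_forall_iterated_degreeSqSum_eq (hd : 3 ≤ d) (hs : s.card = 3)
    (heq : ∀ P Q, IsIteratedConnectedSum s P → IsIteratedConnectedSum s Q →
      degreeSqSum P.boundaryComplex = degreeSqSum Q.boundaryComplex)
    {A : SimplicialPolytope d} (hA : A ∈ s) : A.n = d + 1 := by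
  have hreg : ∀ Q ∈ s, IsDegreeRegular Q.boundaryComplex := by
    intro Q hQ
    obtain ⟨t, rfl⟩ := Multiset.exists_cons_of_mem hQ
    rw [Multiset.card_cons] at hs
    rw [← Multiset.singleton_add, add_comm] at heq
    exact isDegreeRegular_of_forall_degreeSqSum_eq hd (by lia) heq (.single (Iso.refl Q))
  obtain ⟨t, rfl⟩ := Multiset.exists_cons_of_mem hA
  obtain ⟨B, C, rfl⟩ := Multiset.card_eq_two.1 (Nat.succ_injective (Multiset.card_cons A t ▸ hs))
  obtain ⟨X, hX, -⟩ := exists_isConnectedSum_not_isDegreeRegular hd A B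
  have hXAB : IsIteratedConnectedSum {A, B} X := .cons (.single (Iso.refl B)) hX
  refine n_eq_of_forall_degreeSqSum_eq hd (hreg A (by simp)) (hreg B (by simp)) (hreg C (by simp))
    hX fun P Q hP hQ => ?_
  exact heq P Q (.sum hXAB (.single (Iso.refl C)) hP) (.sum hXAB (.single (Iso.refl C)) hQ)

end SimplicialPolytope

end IteratedConnectedSums

theorem mainTheorem7_general {d : ℕ} (hd : 3 ≤ d) (K : Type*) [Field K]
    (s : Multiset (SimplicialPolytope d)) (hs : 3 ≤ s.card) (P : SimplicialPolytope d)
    (hP : SimplicialPolytope.IsIteratedConnectedSum s P) (T : SimplicialPolytope d)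
    (hT : T.n = d + 1) (hne : ¬ SimplicialPolytope.IsIteratedConnectedSum {T, T, T} P) :
    ¬ SimplicialPolytope.IsRigid K P := by
  intro hrigid
  have hd₁ : 1 ≤ d := by lia
  have hiso : ∀ Q, SimplicialPolytope.IsIteratedConnectedSum s Q → P.Iso Q := fun Q hQ =>
    hrigid d Q (hP.gradedBetti_eq hd₁ K hQ)
  have heq : ∀ Q R, SimplicialPolytope.IsIteratedConnectedSum s Q →
      SimplicialPolytope.IsIteratedConnectedSum s R →
      degreeSqSum Q.boundaryComplex = degreeSqSum R.boundaryComplex := fun Q R hQ hR =>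
    (hiso Q hQ).degreeSqSum_eq.symm.trans (hiso R hR).degreeSqSum_eq
  have hcard : s.card = 3 :=
    (SimplicialPolytope.card_le_three_of_forall_degreeSqSum_eq hd heq).antisymm hs
  have hsimplex : ∀ Q ∈ s, T.Iso Q := fun Q hQ => SimplicialPolytope.iso_of_n_eq hd₁ hT
    (SimplicialPolytope.n_eq_of_forall_iterated_degreeSqSum_eq hd hcard heq hQ)
  have hreplicate := hP.replicate hsimplex
  rw [hcard] at hreplicate
  exact hne hreplicate

theorem mainTheorem7 (K : Type*) [Field K]
    (s : Multiset (SimplicialPolytope 3)) (hs : 3 ≤ s.card)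
    (hirr : ∀ Q ∈ s, SimplicialPolytope.IsIrreducible Q)
    (P : SimplicialPolytope 3) (hP : SimplicialPolytope.IsIteratedConnectedSum s P)
    (hne : ¬ SimplicialPolytope.IsIteratedConnectedSum {tetrahedron, tetrahedron, tetrahedron} P) :
    ¬ SimplicialPolytope.IsRigid K P := by
  exact mainTheorem7_general le_rfl K s hs P hP tetrahedron rfl hne
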